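/- Let $M$ be a complex manifold of complex dimension $m$ with a pseudo-Kähler form $\omega_{-1}$ (a closed nondegenerate real form of type $(1,1)$), and let $\ast$ be the standard star product with separation of variables on $(M,\omega_{-1})$: an associative unital product $f\ast g=\sum_{r\ge0}\nu^rC_r(f,g)$ on $C^\infty(M)[[\nu]]$ with $C_0(f,g)=fg$ and $C_1(f,g)-C_1(g,f)=i\{f,g\}$, where the bidifferential operators $C_r$ differentiate $f$ only in antiholomorphic and $g$ only in holomorphic directions, and such that the operator $R_h\colon u\mapsto u\ast h$ satisfies $R_{\partial\Phi/\partial\bar z^l}=\partial\Phi/\partial\bar z^l+\nu\,\partial/\partial\bar z^l$ for every potential $\Phi$ of $\omega_{-1}$ (i.e. $\omega_{-1}=i\partial\bar\partial\Phi$) on every contractible holomorphic chart. Let $(U,\{z^k\})$ be a holomorphic coordinate chart on $M$ and $\Phi_{-1}$ a potential of $\omega_{-1}$ on $U$; put $$g_{k_1\ldots k_r\bar l}=\frac{\partial^{r+1}\Phi_{-1}}{\partial z^{k_1}\cdots\partial z^{k_r}\partial\bar z^l},$$ and let $g^{\bar lk}$ be the inverse of the matrix $g_{k\bar l}$. Let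 $\{\zeta_k,\bar\zeta_l\}$ be the fibre coordinates on $T^*U$ dual to $\{z^k,\bar z^l\}$. Let $\mathcal E_p$ be the space of formal series in $\nu$ and $\zeta_1,\ldots,\zeta_m$ with coefficients in $C^\infty(U)$ all of whose monomials $\nu^r\zeta_{k_1}\cdots\zeta_{k_s}$ satisfy $r-s\ge p$, let $\mathcal E=\mathcal E_0$, and let $\mathcal E''$ be the kernel of $H\mapsto H|_{\zeta=0}$ on $\mathcal E$. On $\mathcal E$ consider the operators (with summation over repeated indices) $$\Gamma_r=g_{k_1\ldots k_r\bar l}\,g^{\bar lk}\zeta_k\frac{\partial^r}{\partial\zeta_{k_1}\cdots\partial\zeta_{k_r}}\ (r\ge1),\qquad D=\nu g^{\bar lk}\zeta_k\frac{\partial}{\partial\bar z^l},\qquad Q=-e^{-D}\Bigl(\sum_{r\ge2}\frac1{r!}\Gamma_r\Bigr)e^{D}.$$ The exponential series of $\pm D$ converge $\nu$-adically on $\mathcal E$, and $\sum_{r\ge2}\Gamma_r/r!$ converges in the topology of the filtration $\mathcal E_0\supset\mathcal E_1\supset\cdots$. The operator $\Gamma_1$ is invertible on $\mathcal E''$, the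 operator $Q$ maps $\mathcal E$ to $\mathcal E''$, and $1-\Gamma_1^{-1}Q$ is invertible on $\mathcal E$, its inverse being the sum of the series $\sum_{r\ge0}(\Gamma_1^{-1}Q)^r$, convergent in the filtration topology. For every $f\in C^\infty(U)[[\nu]]$ the total symbol $F=\tau(L_f)$ of the operator $L_f\colon u\mapsto f\ast u$ of left star multiplication by $f$ on $C^\infty(U)[[\nu]]$ (for the restriction of $\ast$ to $U$) is $$F=e^{D}\bigl(1-\Gamma_1^{-1}Q\bigr)^{-1}f;$$ in particular $F$ does not depend on $\bar\zeta_1,\ldots,\bar\zeta_m$ and lies in $\mathcal E$. -/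

import Mathlib

open scoped Manifold ContDiff Topology

noncomputable section

namespace SepVar

/-! ### Smooth functions on open subsets of `ℂ^m` and Wirtinger derivatives -/

/-- Extension by zero of a function on an open set `V` of `ℂ^m`. -/
def extendZero {m : ℕ} {V : TopologicalSpace.Opens (Fin m → ℂ)} (u : V → ℂ) :
    (Fin m → ℂ) → ℂ :=
  open Classical in fun x => if h : x ∈ V then u ⟨x, h⟩ else 0

theorem extendZero_of_mem {m : ℕ} {V : TopologicalSpace.Opens (Fin m → ℂ)} (u : V → ℂ)
    {x : Fin m → ℂ} (h : x ∈ V) : extendZero u x = u ⟨x, h⟩ := by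
  simp [extendZero, h]

/-- The algebra `C^∞(V)` of complex-valued functions on the open set `V ⊆ ℂ^m` that are smooth in
the real sense, as a subalgebra of the algebra of all functions. -/
def smoothSubalgebra {m : ℕ} (V : TopologicalSpace.Opens (Fin m → ℂ)) : Subalgebra ℂ (V → ℂ) where
  carrier := {u | ContDiffOn ℝ ∞ (extendZero u) V}
  mul_mem' := by
    intro a b ha hb
    refine (ContDiffOn.mul ha hb).congr ?_
    intro x hx
    change extendZero (a * b) x = extendZero a x * extendZero b x
    simp only [extendZero_of_mem _ hx, Pi.mul_apply]
  add_mem' := by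
    intro a b ha hb
    refine (ContDiffOn.add ha hb).congr ?_
    intro x hx
    change extendZero (a + b) x = extendZero a x + extendZero b x
    simp only [extendZero_of_mem _ hx, Pi.add_apply]
  algebraMap_mem' := by
    intro r
    refine (contDiffOn_const (c := r)).congr ?_
    intro x hx
    rw [extendZero_of_mem _ hx]
    rfl

/-- The algebra `C^∞(V)`. -/
def Smooth {m : ℕ} (V : TopologicalSpace.Opens (Fin m → ℂ)) : Type := smoothSubalgebra V

instance instCommRingSmooth {m : ℕ} (V : TopologicalSpace.Opens (Fin m → ℂ)) :
    CommRing (Smooth V) := inferInstanceAs (CommRing (smoothSubalgebra V))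

instance instAlgebraSmooth {m : ℕ} (V : TopologicalSpace.Opens (Fin m → ℂ)) :
    Algebra ℂ (Smooth V) := inferInstanceAs (Algebra ℂ (smoothSubalgebra V))

instance instCoeFunSmooth {m : ℕ} (V : TopologicalSpace.Opens (Fin m → ℂ)) :
    CoeFun (Smooth V) fun _ => V → ℂ := ⟨fun u => u.1⟩

/-- The inclusion of `C^∞(V)` into the algebra of all functions on `V`. -/
def Smooth.toFunHom {m : ℕ} (V : TopologicalSpace.Opens (Fin m → ℂ)) : Smooth V →+* (V → ℂ) :=
  (smoothSubalgebra V).val.toRingHom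

/-- The Wirtinger derivative `∂u/∂z^k = (∂u/∂x^k - i ∂u/∂y^k) / 2`. -/
def wirtinger {m : ℕ} (k : Fin m) (u : (Fin m → ℂ) → ℂ) (x : Fin m → ℂ) : ℂ :=
  (1 / 2 : ℂ) * (fderiv ℝ u x (Pi.single k 1) - Complex.I * fderiv ℝ u x (Pi.single k Complex.I))

/-- The Wirtinger derivative `∂u/∂z̄^l = (∂u/∂x^l + i ∂u/∂y^l) / 2`. -/
def wirtingerBar {m : ℕ} (l : Fin m) (u : (Fin m → ℂ) → ℂ) (x : Fin m → ℂ) : ℂ :=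
  (1 / 2 : ℂ) * (fderiv ℝ u x (Pi.single l 1) + Complex.I * fderiv ℝ u x (Pi.single l Complex.I))

section Derivatives

variable {m : ℕ} {V : TopologicalSpace.Opens (Fin m → ℂ)}

theorem differentiableAt_extendZero (u : Smooth V) {x : Fin m → ℂ} (hx : x ∈ V) :
    DifferentiableAt ℝ (extendZero u.1) x :=
  (u.2.contDiffAt (V.isOpen.mem_nhds hx)).differentiableAt (by simp)

theorem fderiv_extendZero_add (u v : Smooth V) {x : Fin m → ℂ} (hx : x ∈ V) :
    fderiv ℝ (extendZero (u + v).1) x =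
      fderiv ℝ (extendZero u.1) x + fderiv ℝ (extendZero v.1) x := by
  rw [← fderiv_add (differentiableAt_extendZero u hx) (differentiableAt_extendZero v hx)]
  apply Filter.EventuallyEq.fderiv_eq
  filter_upwards [V.isOpen.mem_nhds hx] with y hy
  rw [Pi.add_apply, extendZero_of_mem _ hy, extendZero_of_mem _ hy, extendZero_of_mem _ hy]
  rfl

theorem fderiv_extendZero_smul (c : ℂ) (u : Smooth V) {x : Fin m → ℂ} (hx : x ∈ V) :
    fderiv ℝ (extendZero (c • u).1) x = c • fderiv ℝ (extendZero u.1) x := by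
  rw [← fderiv_const_smul (differentiableAt_extendZero u hx) c]
  apply Filter.EventuallyEq.fderiv_eq
  filter_upwards [V.isOpen.mem_nhds hx] with y hy
  rw [Pi.smul_apply, extendZero_of_mem _ hy, extendZero_of_mem _ hy]
  rfl

theorem contDiffOn_fderiv_extendZero (u : Smooth V) (w : Fin m → ℂ) :
    ContDiffOn ℝ ∞ (fun x => fderiv ℝ (extendZero u.1) x w) V :=
  (u.2.fderiv_of_isOpen V.isOpen (by simp)).clm_apply contDiffOn_const

/-- `∂/∂z^k` as an operator on `C^∞(V)`. -/
def dz (k : Fin m) : Smooth V →ₗ[ℂ] Smooth V where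
  toFun u := ⟨fun x => wirtinger k (extendZero u.1) x, by
    refine ContDiffOn.congr (f := wirtinger k (extendZero u.1)) ?_
      (fun x hx => extendZero_of_mem _ hx)
    exact contDiffOn_const.mul ((contDiffOn_fderiv_extendZero u _).sub
      (contDiffOn_const.mul (contDiffOn_fderiv_extendZero u _)))⟩
  map_add' u v := by
    refine Subtype.ext (funext fun x => ?_)
    change wirtinger k (extendZero (u + v).1) x =
      wirtinger k (extendZero u.1) x + wirtinger k (extendZero v.1) x
    simp only [wirtinger, fderiv_extendZero_add u v x.2, add_apply]
    ring
  map_smul' c u := by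
    refine Subtype.ext (funext fun x => ?_)
    change wirtinger k (extendZero (c • u).1) x = c * wirtinger k (extendZero u.1) x
    simp only [wirtinger, fderiv_extendZero_smul c u x.2, smul_apply,
      smul_eq_mul]
    ring

/-- `∂/∂z̄^l` as an operator on `C^∞(V)`. -/
def dzbar (l : Fin m) : Smooth V →ₗ[ℂ] Smooth V where
  toFun u := ⟨fun x => wirtingerBar l (extendZero u.1) x, by
    refine ContDiffOn.congr (f := wirtingerBar l (extendZero u.1)) ?_
      (fun x hx => extendZero_of_mem _ hx)
    exact contDiffOn_const.mul ((contDiffOn_fderiv_extendZero u _).add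
      (contDiffOn_const.mul (contDiffOn_fderiv_extendZero u _)))⟩
  map_add' u v := by
    refine Subtype.ext (funext fun x => ?_)
    change wirtingerBar l (extendZero (u + v).1) x =
      wirtingerBar l (extendZero u.1) x + wirtingerBar l (extendZero v.1) x
    simp only [wirtingerBar, fderiv_extendZero_add u v x.2, add_apply]
    ring
  map_smul' c u := by
    refine Subtype.ext (funext fun x => ?_)
    change wirtingerBar l (extendZero (c • u).1) x = c * wirtingerBar l (extendZero u.1) x
    simp only [wirtingerBar, fderiv_extendZero_smul c u x.2, smul_apply,
      smul_eq_mul]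
    ring

/-- Multi-indices in the variables `z^k` (`Sum.inl k`) and `z̄^l` (`Sum.inr l`). -/
abbrev MultiIndex (m : ℕ) : Type := (Fin m ⊕ Fin m) →₀ ℕ

/-- The partial derivative `∂^a` of multi-index `a` in the variables `z, z̄`. -/
def partialD (a : MultiIndex m) : Module.End ℂ (Smooth V) :=
  (List.ofFn fun k : Fin m => (dz k : Module.End ℂ (Smooth V)) ^ a (Sum.inl k)).prod *
    (List.ofFn fun l : Fin m => (dzbar l : Module.End ℂ (Smooth V)) ^ a (Sum.inr l)).prod

end Derivatives

/-! ### Complex manifolds, charts and pseudo-Kähler forms -/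

/-- Multiplication of complex numbers is smooth in the real sense. -/
instance contMDiffRing_complex : ContMDiffRing 𝓘(ℝ, ℂ) ∞ ℂ :=
  { instNormedSpaceLieAddGroup with
    contMDiff_mul := by
      rw [← modelWithCornersSelf_prod, chartedSpaceSelf_prod]
      exact contDiff_mul.contMDiff }

/-- Smooth (in the real sense) complex-valued functions on a complex manifold modelled on `ℂ^m`. -/
abbrev SmoothFun (m : ℕ) (M : Type*) [TopologicalSpace M] [ChartedSpace (Fin m → ℂ) M] : Type _ :=
  C^∞⟮𝓘(ℝ, Fin m → ℂ), M; 𝓘(ℝ, ℂ), ℂ⟯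

/-- A holomorphic chart of `M`. -/
abbrev HolChart (m : ℕ) (M : Type*) [TopologicalSpace M] [ChartedSpace (Fin m → ℂ) M] : Type _ :=
  {φ : OpenPartialHomeomorph M (Fin m → ℂ) //
    φ ∈ IsManifold.maximalAtlas 𝓘(ℂ, Fin m → ℂ) ω M}

section Manifold

variable {m : ℕ} {M : Type*} [TopologicalSpace M] [ChartedSpace (Fin m → ℂ) M]

/-- The open set `φ(U) ⊆ ℂ^m` of values of the coordinates of a chart `(U, φ)`. Functions on `U`
are written in the coordinates, as functions on `φ(U)`. -/
def HolChart.dom (φ : HolChart m M) : TopologicalSpace.Opens (Fin m → ℂ) :=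
  ⟨φ.1.target, φ.1.open_target⟩

theorem contDiffOn_comp_symm (f : SmoothFun m M) (φ : HolChart m M) :
    ContDiffOn ℝ ∞ (f ∘ φ.1.symm) φ.1.target := by
  intro x hx
  set p := φ.1.symm x with hp
  have hps : p ∈ (chartAt (Fin m → ℂ) p).source := mem_chart_source _ p
  have h1 : ContDiffWithinAt ℝ ∞ (f ∘ (chartAt (Fin m → ℂ) p).symm) Set.univ
      (chartAt (Fin m → ℂ) p p) := by
    have := ((contMDiffAt_iff (I := 𝓘(ℝ, Fin m → ℂ)) (I' := 𝓘(ℝ, ℂ)) (n := ∞)).1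
      (f.contMDiff p)).2
    simpa [extChartAt, chartAt_self_eq, Function.comp_def] using this
  have hg := (mem_groupoid_of_pregroupoid.1
    (mem_maximalAtlas_iff.1 φ.2 _ (chart_mem_atlas (Fin m → ℂ) p)).1).1
  have h2 : ContDiffOn ℝ ∞ (chartAt (Fin m → ℂ) p ∘ φ.1.symm)
      (φ.1.symm ≫ₕ chartAt (Fin m → ℂ) p).source := by
    have h3 : ContDiffOn ℂ ω (chartAt (Fin m → ℂ) p ∘ φ.1.symm)
        (φ.1.symm ≫ₕ chartAt (Fin m → ℂ) p).source := by
      simpa [contDiffPregroupoid, contDiffGroupoid, Function.comp_def] using hg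
    exact (h3.restrict_scalars ℝ).of_le le_top
  have hx' : x ∈ (φ.1.symm ≫ₕ chartAt (Fin m → ℂ) p).source := by
    simp [hx, ← hp, hps]
  have h4 := (h2.contDiffAt ((φ.1.symm ≫ₕ chartAt (Fin m → ℂ) p).open_source.mem_nhds hx'))
  have h5 : ContDiffAt ℝ ∞ ((f ∘ (chartAt (Fin m → ℂ) p).symm) ∘
      (chartAt (Fin m → ℂ) p ∘ φ.1.symm)) x :=
    ContDiffAt.comp x (contDiffWithinAt_univ.1 h1) h4
  refine (h5.congr_of_eventuallyEq ?_).contDiffWithinAt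
  filter_upwards [(φ.1.symm ≫ₕ chartAt (Fin m → ℂ) p).open_source.mem_nhds hx'] with y hy
  have : φ.1.symm y ∈ (chartAt (Fin m → ℂ) p).source := by simpa using hy.2
  simp [this]

/-- The restriction of a smooth function on `M` to `U`, written in the coordinates of `(U, φ)`. -/
def HolChart.restrict (φ : HolChart m M) (f : SmoothFun m M) : Smooth φ.dom :=
  ⟨fun x => f (φ.1.symm x), (contDiffOn_comp_symm f φ).congr
    (fun x hx => by rw [extendZero_of_mem (V := φ.dom) _ hx]; rfl)⟩

/-- The coordinate expression on `φ(U)` of a real two-form on `M`. -/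
def formInChart
    (Ω : (p : M) → TangentSpace 𝓘(ℝ, Fin m → ℂ) p [⋀^Fin 2]→L[ℝ] ℝ)
    (φ : HolChart m M) (x : Fin m → ℂ) : (Fin m → ℂ) [⋀^Fin 2]→L[ℝ] ℝ :=
  (Ω (φ.1.symm x)).compContinuousLinearMap
    (mfderiv 𝓘(ℝ, Fin m → ℂ) 𝓘(ℝ, Fin m → ℂ) φ.1.symm x)

end Manifold

/-- A pseudo-Kähler form on `M`: a smooth closed nondegenerate real form of type `(1,1)`. -/
structure PseudoKahlerForm (m : ℕ) (M : Type*) [TopologicalSpace M]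
    [ChartedSpace (Fin m → ℂ) M] where
  form : (p : M) → TangentSpace 𝓘(ℝ, Fin m → ℂ) p [⋀^Fin 2]→L[ℝ] ℝ
  smooth : ∀ φ : HolChart m M, ContDiffOn ℝ ∞ (formInChart form φ) φ.1.target
  closed : ∀ φ : HolChart m M, ∀ x ∈ φ.1.target, extDeriv (formInChart form φ) x = 0
  type_one_one : ∀ φ : HolChart m M, ∀ x ∈ φ.1.target, ∀ v w : Fin m → ℂ,
    formInChart form φ x ![Complex.I • v, Complex.I • w] = formInChart form φ x ![v, w]
  nondegenerate : ∀ (p : M) (v : TangentSpace 𝓘(ℝ, Fin m → ℂ) p),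
    (∀ w : TangentSpace 𝓘(ℝ, Fin m → ℂ) p, form p ![v, w] = 0) → v = 0

section PseudoKahler

variable {m : ℕ} {M : Type*} [TopologicalSpace M] [ChartedSpace (Fin m → ℂ) M]

/-- The components `g_{k l̄}` of the form in a chart, `ω₋₁ = i g_{k l̄} dz^k ∧ dz̄^l`, that is,
`i g_{k l̄} = ω₋₁(∂/∂z^k, ∂/∂z̄^l)` for the complex-bilinear extension of `ω₋₁`, where
`∂/∂z^k = (∂/∂x^k - i ∂/∂y^k) / 2` and `∂/∂z̄^l = (∂/∂x^l + i ∂/∂y^l) / 2`. -/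
def PseudoKahlerForm.metric (Ω : PseudoKahlerForm m M) (φ : HolChart m M) (x : Fin m → ℂ) :
    Matrix (Fin m) (Fin m) ℂ :=
  Matrix.of fun k l => (-Complex.I / 4) *
    ((formInChart Ω.form φ x ![Pi.single k 1, Pi.single l 1] : ℂ) +
      Complex.I * (formInChart Ω.form φ x ![Pi.single k 1, Pi.single l Complex.I] : ℂ) -
      Complex.I * (formInChart Ω.form φ x ![Pi.single k Complex.I, Pi.single l 1] : ℂ) +
      (formInChart Ω.form φ x ![Pi.single k Complex.I, Pi.single l Complex.I] : ℂ))

/-- `Φ` is a potential of `ω₋₁` on the chart `(U, φ)`: `ω₋₁ = i ∂∂̄Φ`, that is,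
`g_{k l̄} = ∂²Φ/∂z^k∂z̄^l` (both sides of `ω₋₁ = i ∂∂̄Φ` being of type `(1,1)`). -/
def PseudoKahlerForm.IsPotential (Ω : PseudoKahlerForm m M) (φ : HolChart m M)
    (Φ : Smooth φ.dom) : Prop :=
  ∀ (x : φ.dom) (k l : Fin m), dz k (dzbar l Φ) x = Ω.metric φ x k l

/-- The Poisson bracket of `ω₋₁` in a chart,
`{u, v} = i g^{l̄ k} (∂u/∂z^k ∂v/∂z̄^l - ∂v/∂z^k ∂u/∂z̄^l)`. -/
def PseudoKahlerForm.poisson (Ω : PseudoKahlerForm m M) (φ : HolChart m M)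
    (u v : Smooth φ.dom) (x : φ.dom) : ℂ :=
  Complex.I * ∑ k : Fin m, ∑ l : Fin m, (Ω.metric φ x)⁻¹ l k *
    (dz k u x * dzbar l v x - dz k v x * dzbar l u x)

/-! ### Star products -/

/-- `c` is the (finite) family of coefficients of the bidifferential operator `B` in the chart `φ`:
`B(f, g) = ∑_{a,b} c_{a,b} ∂^a f ∂^b g` on `U`. -/
def IsBidiffCoeff (φ : HolChart m M) (B : SmoothFun m M → SmoothFun m M → SmoothFun m M)
    (c : MultiIndex m × MultiIndex m →₀ Smooth φ.dom) : Prop :=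
  ∀ f g : SmoothFun m M, φ.restrict (B f g) =
    c.sum fun ab coef => coef * partialD ab.1 (φ.restrict f) * partialD ab.2 (φ.restrict g)

/-- The product `f ∗ g = ∑_r ν^r C_r(f, g)` of formal functions, `C_r` being extended
`ν`-bilinearly. -/
def starMul (C : ℕ → SmoothFun m M → SmoothFun m M → SmoothFun m M)
    (f g : PowerSeries (SmoothFun m M)) : PowerSeries (SmoothFun m M) :=
  PowerSeries.mk fun n => ∑ p ∈ Finset.HasAntidiagonal.antidiagonal n, ∑ q ∈ Finset.HasAntidiagonal.antidiagonal p.2,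
    C p.1 (PowerSeries.coeff q.1 f) (PowerSeries.coeff q.2 g)

/-- A star product on the Poisson manifold `(M, ω₋₁)`. -/
structure StarProduct (Ω : PseudoKahlerForm m M) where
  C : ℕ → SmoothFun m M → SmoothFun m M → SmoothFun m M
  bidifferential : ∀ (r : ℕ) (φ : HolChart m M), ∃ c, IsBidiffCoeff φ (C r) c
  zeroth : ∀ f g : SmoothFun m M, C 0 f g = f * g
  first : ∀ (φ : HolChart m M) (f g : SmoothFun m M) (x : φ.dom),
    φ.restrict (C 1 f g) x - φ.restrict (C 1 g f) x =
      Complex.I * Ω.poisson φ (φ.restrict f) (φ.restrict g) x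
  one_star : ∀ f : PowerSeries (SmoothFun m M), starMul C 1 f = f
  star_one : ∀ f : PowerSeries (SmoothFun m M), starMul C f 1 = f
  assoc : ∀ f g h : PowerSeries (SmoothFun m M),
    starMul C (starMul C f g) h = starMul C f (starMul C g h)

/-- Separation of variables: every `C_r` differentiates the first argument in antiholomorphic
directions only and the second argument in holomorphic directions only. -/
def StarProduct.HasSeparationOfVariables {Ω : PseudoKahlerForm m M} (S : StarProduct Ω) : Prop :=
  ∀ (r : ℕ) (φ : HolChart m M), ∃ c, IsBidiffCoeff φ (S.C r) c ∧
    ∀ ab ∈ c.support, (∀ k, ab.1 (Sum.inl k) = 0) ∧ ∀ l, ab.2 (Sum.inr l) = 0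

/-- The restriction to `U` of a bidifferential operator `B` on `M`. The value at `x` of the
restricted operator on `u, v ∈ C^∞(U)` is that of `B` on arbitrary smooth functions on `M` which
agree with `u` and `v` near `x` (they exist if `M` is Hausdorff, and `B` is local). -/
def restrictBidiff (φ : HolChart m M) (B : SmoothFun m M → SmoothFun m M → SmoothFun m M)
    (u v : Smooth φ.dom) (x : φ.dom) : ℂ :=
  open Classical in
  if h : ∃ q : SmoothFun m M × SmoothFun m M,
      (φ.restrict q.1).1 =ᶠ[𝓝 x] u.1 ∧ (φ.restrict q.2).1 =ᶠ[𝓝 x] v.1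
  then φ.restrict (B h.choose.1 h.choose.2) x else 0

/-- The product `f ∗ g` of formal functions `f, g ∈ C^∞(U)[[ν]]` for the restriction of the star
product to `U`. -/
def StarProduct.localMul {Ω : PseudoKahlerForm m M} (S : StarProduct Ω) (φ : HolChart m M)
    (f g : PowerSeries (Smooth φ.dom)) : PowerSeries (φ.dom → ℂ) :=
  PowerSeries.mk fun n => ∑ p ∈ Finset.HasAntidiagonal.antidiagonal n, ∑ q ∈ Finset.HasAntidiagonal.antidiagonal p.2,
    restrictBidiff φ (S.C p.1) (PowerSeries.coeff q.1 f) (PowerSeries.coeff q.2 g)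

/-- The operator `L_f` of left star multiplication by `f ∈ C^∞(U)[[ν]]` on `U`. -/
def StarProduct.leftMul {Ω : PseudoKahlerForm m M} (S : StarProduct Ω) (φ : HolChart m M)
    (f : PowerSeries (Smooth φ.dom)) : PowerSeries (Smooth φ.dom) → PowerSeries (φ.dom → ℂ) :=
  fun g => S.localMul φ f g

/-- The operator `R_g` of right star multiplication by `g ∈ C^∞(U)[[ν]]` on `U`. -/
def StarProduct.rightMul {Ω : PseudoKahlerForm m M} (S : StarProduct Ω) (φ : HolChart m M)
    (g : PowerSeries (Smooth φ.dom)) : PowerSeries (Smooth φ.dom) → PowerSeries (φ.dom → ℂ) :=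
  fun f => S.localMul φ f g

/-- The standard star product: it is parametrized by the trivial deformation `ν⁻¹ ω₋₁` of `ω₋₁`,
that is, `R_{∂Φ/∂z̄^l} = ∂Φ/∂z̄^l + ν ∂/∂z̄^l` for every contractible chart and every potential `Φ`
of `ω₋₁` on it. -/
def StarProduct.IsStandard {Ω : PseudoKahlerForm m M} (S : StarProduct Ω) : Prop :=
  ∀ φ : HolChart m M, ContractibleSpace φ.1.source → ∀ Φ : Smooth φ.dom, Ω.IsPotential φ Φ →
    ∀ (l : Fin m) (u : PowerSeries (Smooth φ.dom)),
      S.rightMul φ (PowerSeries.C (dzbar l Φ)) u =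
        PowerSeries.map (Smooth.toFunHom φ.dom)
          (PowerSeries.C (dzbar l Φ) * u +
            PowerSeries.X * PowerSeries.mk fun n => dzbar l (PowerSeries.coeff n u))

end PseudoKahler

/-! ### Total symbols -/

section Symbols

variable {m : ℕ} {V : TopologicalSpace.Opens (Fin m → ℂ)}

/-- The differential operator on `V` in normal form whose total symbol is the polynomial `P` in the
fibre variables `ζ_k` (`Sum.inl k`) and `ζ̄_l` (`Sum.inr l`). -/
def symbolApply (P : MvPolynomial (Fin m ⊕ Fin m) (Smooth V)) (u : Smooth V) : Smooth V :=
  ∑ a ∈ P.support, P.coeff a * partialD a u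

/-- `F = ∑ ν^s F_s` is the total symbol `τ(L)` of the formal differential operator `L` on `V`:
`L = ∑ ν^s A_s`, where `A_s` is the differential operator with total symbol `F_s`. -/
def IsTotalSymbol (L : PowerSeries (Smooth V) → PowerSeries (V → ℂ))
    (F : PowerSeries (MvPolynomial (Fin m ⊕ Fin m) (Smooth V))) : Prop :=
  ∀ (g : PowerSeries (Smooth V)) (n : ℕ) (x : V), PowerSeries.coeff n (L g) x =
    ∑ p ∈ Finset.HasAntidiagonal.antidiagonal n,
      symbolApply (PowerSeries.coeff p.1 F) (PowerSeries.coeff p.2 g) x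

/-! ### The filtered space of formal series in `ν` and `ζ` -/

/-- The space `ℰ_p` of formal series in `ν` and `ζ_1, …, ζ_m` with coefficients in `C^∞(V)` all of
whose monomials `ν^r ζ_{k_1} ⋯ ζ_{k_s}` satisfy `r - s ≥ p`. As `s ≤ r`, the coefficient of `ν^r`
is a polynomial in `ζ`. -/
def Filt (V : TopologicalSpace.Opens (Fin m → ℂ)) (p : ℕ) :
    Submodule ℂ (PowerSeries (MvPolynomial (Fin m) (Smooth V))) where
  carrier := {F | ∀ (r : ℕ) (a : Fin m →₀ ℕ),
    MvPolynomial.coeff a (PowerSeries.coeff r F) ≠ 0 → a.degree + p ≤ r}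
  zero_mem' := by
    intro r a h
    simp at h
  add_mem' := by
    intro F G hF hG r a h
    by_contra hn
    apply h
    rw [map_add, MvPolynomial.coeff_add, not_not.1 (fun h' => hn (hF r a h')),
      not_not.1 (fun h' => hn (hG r a h')), add_zero]
  smul_mem' := by
    intro c F hF r a h
    refine hF r a fun h0 => h ?_
    rw [PowerSeries.coeff_smul, MvPolynomial.coeff_smul, h0, smul_zero]

/-- The space `ℰ = ℰ_0`. -/
abbrev ESpace (V : TopologicalSpace.Opens (Fin m → ℂ)) : Type := Filt V 0

theorem mem_ESpace_iff (F : PowerSeries (MvPolynomial (Fin m) (Smooth V))) :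
    F ∈ Filt V 0 ↔ ∀ r, PowerSeries.coeff r F ∈
      MvPolynomial.restrictTotalDegree (Fin m) (Smooth V) r := by
  refine forall_congr' fun r => ?_
  rw [MvPolynomial.mem_restrictTotalDegree, MvPolynomial.totalDegree, Finset.sup_le_iff]
  refine forall_congr' fun a => ?_
  rw [MvPolynomial.mem_support_iff, add_zero, Finsupp.degree_eq_sum]
  rw [Finsupp.sum_fintype _ _ (fun _ => rfl)]

/-- The subspace `ℰ''` of `ℰ`: the kernel of `H ↦ H|_{ζ = 0}`. -/
def ESpaceTwo (V : TopologicalSpace.Opens (Fin m → ℂ)) : Submodule ℂ (ESpace V) where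
  carrier := {F | ∀ r : ℕ, MvPolynomial.coeff 0 (PowerSeries.coeff r F.1) = 0}
  zero_mem' := by
    intro r
    simp
  add_mem' := by
    intro F G hF hG r
    change MvPolynomial.coeff 0 (PowerSeries.coeff r (F.1 + G.1)) = 0
    rw [map_add, MvPolynomial.coeff_add, hF r, hG r, add_zero]
  smul_mem' := by
    intro c F hF r
    change MvPolynomial.coeff 0 (PowerSeries.coeff r (c • F.1)) = 0
    rw [PowerSeries.coeff_smul, MvPolynomial.coeff_smul, hF r, smul_zero]

/-- A formal function `f ∈ C^∞(V)[[ν]]` as an element of `ℰ` that does not depend on `ζ`. -/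
def ofFun (f : PowerSeries (Smooth V)) : ESpace V :=
  ⟨PowerSeries.map MvPolynomial.C f, by
    rw [mem_ESpace_iff]
    intro r
    rw [MvPolynomial.mem_restrictTotalDegree, PowerSeries.coeff_map, MvPolynomial.totalDegree_C]
    exact Nat.zero_le r⟩

/-- An element of `ℰ` as a total symbol that does not depend on `ζ̄_1, …, ζ̄_m`. -/
def toSymbol (F : ESpace V) : PowerSeries (MvPolynomial (Fin m ⊕ Fin m) (Smooth V)) :=
  PowerSeries.map (MvPolynomial.rename (Sum.inl : Fin m → Fin m ⊕ Fin m)).toRingHom F.1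

/-! ### Operators on `ℰ` -/

/-- The linear operator on polynomials in `ζ` applying `T a` to the coefficient of `ζ^a`. -/
def mapCoeffs (T : (Fin m →₀ ℕ) → Smooth V →ₗ[ℂ] Smooth V) :
    MvPolynomial (Fin m) (Smooth V) →ₗ[ℂ] MvPolynomial (Fin m) (Smooth V) :=
  have key : ∀ (P : MvPolynomial (Fin m) (Smooth V)) (b : Fin m →₀ ℕ),
      MvPolynomial.coeff b (∑ a ∈ P.support, MvPolynomial.monomial a (T a (P.coeff a))) =
        T b (P.coeff b) := by
    intro P b
    classical
    simp only [MvPolynomial.coeff_sum, MvPolynomial.coeff_monomial, Finset.sum_ite_eq',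
      MvPolynomial.mem_support_iff]
    split_ifs with h
    · rfl
    · rw [not_not.1 h, map_zero]
  { toFun := fun P => ∑ a ∈ P.support, MvPolynomial.monomial a (T a (P.coeff a))
    map_add' := by
      intro P Q
      ext1 b
      rw [MvPolynomial.coeff_add, key, key, key, MvPolynomial.coeff_add, map_add]
    map_smul' := by
      intro c P
      ext1 b
      rw [RingHom.id_apply, MvPolynomial.coeff_smul, key, key, MvPolynomial.coeff_smul, map_smul] }

theorem coeff_mapCoeffs (T : (Fin m →₀ ℕ) → Smooth V →ₗ[ℂ] Smooth V)
    (P : MvPolynomial (Fin m) (Smooth V)) (b : Fin m →₀ ℕ) :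
    MvPolynomial.coeff b (mapCoeffs T P) = T b (P.coeff b) := by
  classical
  change MvPolynomial.coeff b (∑ a ∈ P.support, MvPolynomial.monomial a (T a (P.coeff a))) = _
  simp only [MvPolynomial.coeff_sum, MvPolynomial.coeff_monomial, Finset.sum_ite_eq',
    MvPolynomial.mem_support_iff]
  split_ifs with h
  · rfl
  · rw [not_not.1 h, map_zero]

theorem mapCoeffs_mem (T : (Fin m →₀ ℕ) → Smooth V →ₗ[ℂ] Smooth V) (d : ℕ)
    (P : MvPolynomial (Fin m) (Smooth V))
    (hP : P ∈ MvPolynomial.restrictTotalDegree (Fin m) (Smooth V) d) :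
    mapCoeffs T P ∈ MvPolynomial.restrictTotalDegree (Fin m) (Smooth V) d := by
  rw [MvPolynomial.mem_restrictTotalDegree] at hP ⊢
  refine le_trans (MvPolynomial.totalDegree_le_of_support_subset fun a ha => ?_) hP
  rw [MvPolynomial.mem_support_iff, coeff_mapCoeffs] at ha
  rw [MvPolynomial.mem_support_iff]
  exact fun h => ha (by rw [h, map_zero])

/-- A linear operator `T` on polynomials in `ζ` acting on `ℰ` coefficientwise in `ν` and combined
with the multiplication by `ν^s`, provided that `T` raises the degree by at most `s`. -/
def liftOp (s : ℕ) (T : MvPolynomial (Fin m) (Smooth V) →ₗ[ℂ] MvPolynomial (Fin m) (Smooth V))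
    (hT : ∀ d P, P ∈ MvPolynomial.restrictTotalDegree (Fin m) (Smooth V) d →
      T P ∈ MvPolynomial.restrictTotalDegree (Fin m) (Smooth V) (d + s)) :
    Module.End ℂ (ESpace V) where
  toFun F := ⟨PowerSeries.X ^ s * PowerSeries.mk fun n => T (PowerSeries.coeff n F.1), by
    rw [mem_ESpace_iff]
    intro r
    rw [PowerSeries.coeff_X_pow_mul']
    split_ifs with h
    · have := hT (r - s) _ ((mem_ESpace_iff F.1).1 F.2 (r - s))
      rw [Nat.sub_add_cancel h] at this
      rwa [PowerSeries.coeff_mk]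
    · exact Submodule.zero_mem _⟩
  map_add' F G := by
    apply Subtype.ext
    ext1 n
    simp only [Submodule.coe_add, map_add, PowerSeries.coeff_X_pow_mul', PowerSeries.coeff_mk]
    split_ifs <;> simp
  map_smul' c F := by
    apply Subtype.ext
    ext1 n
    simp only [Submodule.coe_smul, PowerSeries.coeff_smul, map_smul, RingHom.id_apply,
      PowerSeries.coeff_X_pow_mul', PowerSeries.coeff_mk]
    split_ifs <;> simp

/-- The sum `∑_{r ≥ 0} T_r` of a series of operators on `ℰ` such that `T_r F` has no terms of
`ν`-degree less than `r`: the coefficient of `ν^n` in `∑_r T_r F` is that in `∑_{r ≤ n} T_r F`. -/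
def opSum (T : ℕ → Module.End ℂ (ESpace V)) : Module.End ℂ (ESpace V) where
  toFun F := ⟨PowerSeries.mk fun n =>
      ∑ r ∈ Finset.range (n + 1), PowerSeries.coeff n (T r F).1, by
    rw [mem_ESpace_iff]
    intro n
    rw [PowerSeries.coeff_mk]
    exact Submodule.sum_mem _ fun r _ => (mem_ESpace_iff _).1 (T r F).2 n⟩
  map_add' F G := by
    apply Subtype.ext
    ext1 n
    simp only [map_add, Submodule.coe_add, PowerSeries.coeff_mk, Finset.sum_add_distrib]
  map_smul' c F := by
    apply Subtype.ext
    ext1 n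
    simp only [map_smul, Submodule.coe_smul, PowerSeries.coeff_mk, PowerSeries.coeff_smul,
      Finset.smul_sum, RingHom.id_apply]

/-- `∑_r T_r F = S F` for all `F ∈ ℰ`, with `ν`-adic convergence: every coefficient of a power of
`ν` stabilizes. -/
def ConvergesNu (T : ℕ → Module.End ℂ (ESpace V)) (S : Module.End ℂ (ESpace V)) : Prop :=
  ∀ (F : ESpace V) (n : ℕ), ∃ N₀ : ℕ, ∀ N ≥ N₀,
    PowerSeries.coeff n (∑ r ∈ Finset.range N, T r F).1 = PowerSeries.coeff n (S F).1

/-- `∑_r T_r F = S F` for all `F ∈ ℰ`, with convergence in the topology of the filtration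
`ℰ = ℰ_0 ⊃ ℰ_1 ⊃ …`. -/
def ConvergesFilt (T : ℕ → Module.End ℂ (ESpace V)) (S : Module.End ℂ (ESpace V)) : Prop :=
  ∀ (F : ESpace V) (p : ℕ), ∃ N₀ : ℕ, ∀ N ≥ N₀,
    (S F - ∑ r ∈ Finset.range N, T r F).1 ∈ Filt V p

/-- The terms `T^r / r!` of the exponential series. -/
def expTerm (T : Module.End ℂ (ESpace V)) (r : ℕ) : Module.End ℂ (ESpace V) :=
  ((r.factorial : ℂ)⁻¹) • T ^ r

/-- The exponential `e^T = ∑_r T^r / r!` of an operator `T` that raises the `ν`-degree. -/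
def expOp (T : Module.End ℂ (ESpace V)) : Module.End ℂ (ESpace V) :=
  opSum (expTerm T)

/-- The metric tensor `g_{k l̄} = ∂²Φ/∂z^k∂z̄^l` of a potential `Φ`; the entry of the inverse matrix
in row `l` and column `k` is `g^{l̄ k}`. -/
def metricTensor (Φ : Smooth V) : Matrix (Fin m) (Fin m) (Smooth V) :=
  Matrix.of fun k l => dz k (dzbar l Φ)

/-- `g_{k_1 … k_r l̄} = ∂^{r+1}Φ / ∂z^{k_1} ⋯ ∂z^{k_r} ∂z̄^l`. -/
def gTensor (Φ : Smooth V) {r : ℕ} (κ : Fin r → Fin m) (l : Fin m) : Smooth V :=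
  (List.ofFn fun i : Fin r => (dz (κ i) : Module.End ℂ (Smooth V))).prod (dzbar l Φ)

/-- The derivative `∂^r / ∂ζ_{k_1} ⋯ ∂ζ_{k_r}` on polynomials in `ζ`. -/
def fibreDeriv {r : ℕ} (κ : Fin r → Fin m) :
    Module.End (Smooth V) (MvPolynomial (Fin m) (Smooth V)) :=
  (List.ofFn fun i : Fin r => (MvPolynomial.pderiv (κ i) :
    Derivation (Smooth V) (MvPolynomial (Fin m) (Smooth V)) (MvPolynomial (Fin m) (Smooth V))
    ).toLinearMap).prod

/-- Multiplication by `c ζ_k` on polynomials in `ζ`, where `c ∈ C^∞(V)`. -/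
def mulZeta (c : Smooth V) (k : Fin m) :
    MvPolynomial (Fin m) (Smooth V) →ₗ[ℂ] MvPolynomial (Fin m) (Smooth V) :=
  LinearMap.mulLeft ℂ (MvPolynomial.C c * MvPolynomial.X k)

theorem mulZeta_mem (c : Smooth V) (k : Fin m) (d : ℕ) (P : MvPolynomial (Fin m) (Smooth V))
    (hP : P ∈ MvPolynomial.restrictTotalDegree (Fin m) (Smooth V) d) :
    mulZeta c k P ∈ MvPolynomial.restrictTotalDegree (Fin m) (Smooth V) (d + 1) := by
  rw [MvPolynomial.mem_restrictTotalDegree] at hP ⊢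
  have h1 : (MvPolynomial.C c * MvPolynomial.X k : MvPolynomial (Fin m) (Smooth V)).totalDegree
      ≤ 1 := by
    rw [MvPolynomial.C_mul_X_eq_monomial]
    refine (MvPolynomial.totalDegree_monomial_le _ _).trans ?_
    simp
  refine (MvPolynomial.totalDegree_mul _ _).trans ?_
  omega

theorem pderiv_mem (k : Fin m) (d : ℕ) (P : MvPolynomial (Fin m) (Smooth V))
    (hP : P ∈ MvPolynomial.restrictTotalDegree (Fin m) (Smooth V) d) :
    MvPolynomial.pderiv k P ∈ MvPolynomial.restrictTotalDegree (Fin m) (Smooth V) (d - 1) := by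
  rw [MvPolynomial.mem_restrictTotalDegree, MvPolynomial.totalDegree, Finset.sup_le_iff] at hP ⊢
  intro a ha
  rw [MvPolynomial.mem_support_iff, MvPolynomial.coeff_pderiv] at ha
  have := hP (a + Finsupp.single k 1) (MvPolynomial.mem_support_iff.2 (left_ne_zero_of_mul ha))
  rw [Finsupp.sum_add_index' (fun _ => rfl) (fun _ _ _ => rfl),
    Finsupp.sum_single_index rfl] at this
  omega

theorem fibreDeriv_mem {r : ℕ} (κ : Fin r → Fin m) (d : ℕ) (P : MvPolynomial (Fin m) (Smooth V))
    (hP : P ∈ MvPolynomial.restrictTotalDegree (Fin m) (Smooth V) d) :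
    fibreDeriv κ P ∈ MvPolynomial.restrictTotalDegree (Fin m) (Smooth V) (d - r) := by
  induction r with
  | zero => simpa [fibreDeriv] using hP
  | succ r ih =>
    have h := pderiv_mem (κ 0) _ _ (ih fun i => κ i.succ)
    rw [Nat.sub_sub] at h
    simpa [fibreDeriv, List.ofFn_succ] using h

/-- `Γ_r = g_{k_1 … k_r l̄} g^{l̄ k} ζ_k ∂^r / ∂ζ_{k_1} ⋯ ∂ζ_{k_r}` on polynomials in `ζ`. -/
def gammaPoly (Φ : Smooth V) (r : ℕ) :
    MvPolynomial (Fin m) (Smooth V) →ₗ[ℂ] MvPolynomial (Fin m) (Smooth V) :=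
  ∑ κ : Fin r → Fin m, ∑ l : Fin m, ∑ k : Fin m,
    mulZeta (gTensor Φ κ l * (metricTensor Φ)⁻¹ l k) k ∘ₗ
      (fibreDeriv κ).restrictScalars ℂ

theorem gammaPoly_mem (Φ : Smooth V) (r : ℕ) (d : ℕ) (P : MvPolynomial (Fin m) (Smooth V))
    (hP : P ∈ MvPolynomial.restrictTotalDegree (Fin m) (Smooth V) d) :
    gammaPoly Φ (r + 1) P ∈ MvPolynomial.restrictTotalDegree (Fin m) (Smooth V) (d + 0) := by
  simp only [gammaPoly, LinearMap.sum_apply, LinearMap.comp_apply]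
  refine Submodule.sum_mem _ fun κ _ => Submodule.sum_mem _ fun l _ =>
    Submodule.sum_mem _ fun k _ => ?_
  rcases Nat.eq_zero_or_pos d with rfl | hd
  · have h : fibreDeriv κ P = 0 := by
      rw [MvPolynomial.mem_restrictTotalDegree] at hP
      obtain ⟨c, rfl⟩ : ∃ c, P = MvPolynomial.C c :=
        ⟨_, MvPolynomial.totalDegree_eq_zero_iff_eq_C.1 (Nat.le_zero.1 hP)⟩
      have hz : ∀ (s : ℕ) (κ' : Fin (s + 1) → Fin m),
          fibreDeriv κ' (MvPolynomial.C c : MvPolynomial (Fin m) (Smooth V)) = 0 := by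
        intro s
        induction s with
        | zero => intro κ'; simp [fibreDeriv, List.ofFn_succ]
        | succ s ih =>
          intro κ'
          have h := ih fun i => κ' i.succ
          rw [fibreDeriv, List.ofFn_succ, List.prod_cons, Module.End.mul_apply]
          rw [fibreDeriv] at h
          rw [h, map_zero]
      exact hz r κ
    rw [LinearMap.restrictScalars_apply, h, map_zero]
    exact Submodule.zero_mem _
  · have h := mulZeta_mem (gTensor Φ κ l * (metricTensor Φ)⁻¹ l k) k _ _
      (fibreDeriv_mem κ d P hP)
    rw [MvPolynomial.mem_restrictTotalDegree] at h ⊢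
    refine h.trans ?_
    omega

/-- The operator `Γ_r` on `ℰ`, for `r ≥ 1` (set to zero for `r = 0`, which does not occur). -/
def Gam (Φ : Smooth V) : ℕ → Module.End ℂ (ESpace V)
  | 0 => 0
  | r + 1 => liftOp 0 (gammaPoly Φ (r + 1)) (gammaPoly_mem Φ r)

/-- `g^{l̄ k} ζ_k ∂/∂z̄^l` on polynomials in `ζ`. -/
def dPoly (Φ : Smooth V) :
    MvPolynomial (Fin m) (Smooth V) →ₗ[ℂ] MvPolynomial (Fin m) (Smooth V) :=
  ∑ l : Fin m, ∑ k : Fin m, mulZeta ((metricTensor Φ)⁻¹ l k) k ∘ₗ mapCoeffs fun _ => dzbar l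

theorem dPoly_mem (Φ : Smooth V) (d : ℕ) (P : MvPolynomial (Fin m) (Smooth V))
    (hP : P ∈ MvPolynomial.restrictTotalDegree (Fin m) (Smooth V) d) :
    dPoly Φ P ∈ MvPolynomial.restrictTotalDegree (Fin m) (Smooth V) (d + 1) := by
  simp only [dPoly, LinearMap.sum_apply, LinearMap.comp_apply]
  exact Submodule.sum_mem _ fun l _ => Submodule.sum_mem _ fun k _ =>
    mulZeta_mem _ _ _ _ (mapCoeffs_mem _ _ _ hP)

/-- The operator `D = ν g^{l̄ k} ζ_k ∂/∂z̄^l` on `ℰ`. -/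
def DOp (Φ : Smooth V) : Module.End ℂ (ESpace V) :=
  liftOp 1 (dPoly Φ) (dPoly_mem Φ)

/-- The inverse `Γ_1⁻¹` of the operator `Γ_1 = ζ_k ∂/∂ζ_k` on `ℰ''`, extended by zero to the
series that do not depend on `ζ`: it divides a monomial of degree `s ≥ 1` in `ζ` by `s`. -/
def GamOneInv (V : TopologicalSpace.Opens (Fin m → ℂ)) : Module.End ℂ (ESpace V) :=
  liftOp 0 (mapCoeffs fun a => ((a.degree : ℂ)⁻¹) • LinearMap.id) (mapCoeffs_mem _)

/-- The terms of the series `∑_{r ≥ 2} Γ_r / r!`. -/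
def higherTerm (Φ : Smooth V) (r : ℕ) : Module.End ℂ (ESpace V) :=
  if 2 ≤ r then ((r.factorial : ℂ)⁻¹) • Gam Φ r else 0

/-- The operator `Q = -e^{-D} (∑_{r ≥ 2} Γ_r / r!) e^D` on `ℰ`. -/
def QOp (Φ : Smooth V) : Module.End ℂ (ESpace V) :=
  -(expOp (-DOp Φ) * opSum (higherTerm Φ) * expOp (DOp Φ))

end Symbols

end SepVar

end

/-! By associativity `L_f` commutes with every right multiplication, in particular with `R_h = h + ν
∂/∂z̄^l` for `h = ∂Φ/∂z̄^l`. Separation of variables makes the total symbol `F` of `L_f` free of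
`ζ̄`. On such symbols, composing with multiplication by `h` gives the Taylor sum `∑_r (1/r!)
(∂_{k_1} ⋯ ∂_{k_r} h) ∂^r F / ∂ζ_{k_1} ⋯ ∂ζ_{k_r}` (`holHom_mul`), while commuting with `∂/∂z̄^l`
only differentiates the coefficients (`dzbar_holHom`). The `r = 0` term cancels. Contracting what
remains with `g^{l̄ k} ζ_k` gives the equation `∑_{r ≥ 1} Γ_r F / r! = D F` (`gammaSum_leftSymbol`),
and `f ∗ 1 = f` gives `F|_{ζ=0} = f`.

This problem has exactly one possible solution. `Γ_1` is the Euler operator in `ζ` (`gammaPoly_one`)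
and `D` raises the `ζ`-degree by one, so `[Γ_1, D] = D` and `e^{-D} Γ_1 e^D = Γ_1 + D`
(`commutator_expOp`). Writing `F = e^D G` turns the equation into `Γ_1 G = Q G` with `G|_{ζ=0} = f`,
that is, `(1 - Γ_1⁻¹ Q) G = f` (`eq_of_symbol_equation`). For `r ≥ 2` the operator `Γ_r` lowers the
`ζ`-degree by `r - 1`, so `Q` raises the filtration degree and the geometric series converges
(`Raises.geometric`). That `F` lies in `ℰ` at all follows from the equation by looking at its top
degree in `ζ` (`mem_restrictTotalDegree_of_gammaSum`).

Two further points need care. The product on `U` is defined through germs of global functions, and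
the condition on `R_h` is given on contractible charts only. Both are settled pointwise, by
extending germs with bump functions and shrinking to balls (`locStar_assoc`,
`locStar_dzbar_potential`). Invertibility of `g_{k l̄}` comes from nondegeneracy of the form
(`isUnit_det_metric`). Uniqueness of total symbols follows by testing on coordinate monomials. -/

noncomputable section

namespace SepVar

/-! ### Wirtinger calculus on open subsets of `ℂ^m`: Leibniz rules, commutation, locality,
multi-index derivatives. -/

section Calculus

variable {m : ℕ} {V W : TopologicalSpace.Opens (Fin m → ℂ)}

theorem Smooth.ext {u v : Smooth V} (h : ∀ x : V, u x = v x) : u = v :=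
  Subtype.ext (funext h)

theorem Smooth.mul_apply (u v : Smooth V) (x : V) : (u * v) x = u x * v x := rfl

theorem Smooth.add_apply (u v : Smooth V) (x : V) : (u + v) x = u x + v x := rfl

/-- Evaluation of smooth functions at a point. -/
def evalAt (x : V) : Smooth V →+* ℂ := (Pi.evalRingHom (fun _ : V => ℂ) x).comp (Smooth.toFunHom V)

theorem evalAt_apply (x : V) (u : Smooth V) : evalAt x u = u x := rfl

/-- Directional derivatives of smooth functions. -/
def dirDeriv (w : Fin m → ℂ) : Smooth V →ₗ[ℂ] Smooth V where
  toFun u := ⟨fun x => fderiv ℝ (extendZero u.1) x w,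
    (contDiffOn_fderiv_extendZero u w).congr fun _ hx => extendZero_of_mem _ hx⟩
  map_add' u v := by
    refine Subtype.ext (funext fun x => ?_)
    change fderiv ℝ (extendZero (u + v).1) x w =
      fderiv ℝ (extendZero u.1) x w + fderiv ℝ (extendZero v.1) x w
    rw [fderiv_extendZero_add u v x.2]
    rfl
  map_smul' c u := by
    refine Subtype.ext (funext fun x => ?_)
    change fderiv ℝ (extendZero (c • u).1) x w = c * fderiv ℝ (extendZero u.1) x w
    rw [fderiv_extendZero_smul c u x.2]
    rfl

theorem dirDeriv_apply (w : Fin m → ℂ) (u : Smooth V) (x : V) :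
    dirDeriv w u x = fderiv ℝ (extendZero u.1) x w := rfl

theorem dz_eq (k : Fin m) (u : Smooth V) : dz k u =
    (1 / 2 : ℂ) • (dirDeriv (Pi.single k 1) u -
      Complex.I • dirDeriv (Pi.single k Complex.I) u) := rfl

theorem dzbar_eq (k : Fin m) (u : Smooth V) : dzbar k u =
    (1 / 2 : ℂ) • (dirDeriv (Pi.single k 1) u +
      Complex.I • dirDeriv (Pi.single k Complex.I) u) := rfl

theorem dirDeriv_mul (w : Fin m → ℂ) (u v : Smooth V) :
    dirDeriv w (u * v) = u * dirDeriv w v + v * dirDeriv w u := by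
  refine Smooth.ext fun x => ?_
  have h : extendZero (u * v).1 =ᶠ[𝓝 (x : Fin m → ℂ)]
      fun y => extendZero u.1 y * extendZero v.1 y := by
    filter_upwards [V.isOpen.mem_nhds x.2] with y hy
    rw [extendZero_of_mem _ hy, extendZero_of_mem _ hy, extendZero_of_mem _ hy]
    rfl
  rw [dirDeriv_apply, h.fderiv_eq, fderiv_fun_mul (differentiableAt_extendZero u x.2)
    (differentiableAt_extendZero v x.2)]
  simp only [Smooth.add_apply, Smooth.mul_apply, dirDeriv_apply,
    add_apply, smul_apply, smul_eq_mul, extendZero_of_mem _ x.2]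

theorem dirDeriv_comm (w w' : Fin m → ℂ) (u : Smooth V) :
    dirDeriv w (dirDeriv w' u) = dirDeriv w' (dirDeriv w u) := by
  refine Smooth.ext fun x => ?_
  have key : ∀ a b : Fin m → ℂ, dirDeriv a (dirDeriv b u) x =
      fderiv ℝ (fderiv ℝ (extendZero u.1)) x a b := by
    intro a b
    have h : extendZero (dirDeriv b u).1 =ᶠ[𝓝 (x : Fin m → ℂ)]
        fun y => fderiv ℝ (extendZero u.1) y b := by
      filter_upwards [V.isOpen.mem_nhds x.2] with y hy
      rw [extendZero_of_mem _ hy, dirDeriv_apply]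
    have hd : DifferentiableAt ℝ (fderiv ℝ (extendZero u.1)) x :=
      ((u.2.fderiv_of_isOpen V.isOpen (m := ∞) (by simp)).contDiffAt
        (V.isOpen.mem_nhds x.2)).differentiableAt (by simp)
    rw [dirDeriv_apply, h.fderiv_eq, fderiv_clm_apply hd (differentiableAt_const b)]
    simp
  rw [key, key]
  refine (ContDiffAt.isSymmSndFDerivAt (n := ∞) (u.2.contDiffAt (V.isOpen.mem_nhds x.2)) ?_) w w'
  simpa using (WithTop.coe_le_coe.2 le_top : ((2 : ℕ∞) : WithTop ℕ∞) ≤ ∞)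

theorem dz_mul (k : Fin m) (u v : Smooth V) : dz k (u * v) = u * dz k v + v * dz k u := by
  simp only [dz_eq, dirDeriv_mul, Algebra.mul_smul_comm, mul_sub, smul_add, smul_sub]
  abel

theorem dzbar_mul (k : Fin m) (u v : Smooth V) :
    dzbar k (u * v) = u * dzbar k v + v * dzbar k u := by
  simp only [dzbar_eq, dirDeriv_mul, Algebra.mul_smul_comm, mul_add, smul_add]
  abel

theorem dz_comm (j k : Fin m) (u : Smooth V) : dz j (dz k u) = dz k (dz j u) := by
  simp only [dz_eq, map_smul, map_sub, smul_sub, dirDeriv_comm (Pi.single k _),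
    smul_comm _ (1 / 2 : ℂ)]
  abel

theorem dzbar_comm (j k : Fin m) (u : Smooth V) : dzbar j (dzbar k u) = dzbar k (dzbar j u) := by
  simp only [dzbar_eq, map_smul, map_add, smul_add, dirDeriv_comm (Pi.single k _),
    smul_comm _ (1 / 2 : ℂ)]
  abel

theorem dz_dzbar_comm (j k : Fin m) (u : Smooth V) : dz j (dzbar k u) = dzbar k (dz j u) := by
  simp only [dz_eq, dzbar_eq, map_smul, map_add, map_sub, smul_add, smul_sub,
    dirDeriv_comm (Pi.single k _), smul_comm _ (1 / 2 : ℂ)]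
  abel

/-! ### Germs -/

/-- `u` and `v` agree near `x`. -/
def GermEq (x : Fin m → ℂ) (u : Smooth V) (v : Smooth W) : Prop :=
  extendZero u.1 =ᶠ[𝓝 x] extendZero v.1

/-- `GermEq` lives in the ambient space so that functions on different open sets can be compared,
whereas `restrictBidiff` uses neighbourhoods inside the chart domain. This translates between the
two. -/
theorem germEq_iff {x : V} {u v : Smooth V} : GermEq x u v ↔ u.1 =ᶠ[𝓝 x] v.1 := by
  have : Filter.map ((↑) : V → Fin m → ℂ) (𝓝 x) = 𝓝 (x : Fin m → ℂ) :=
    map_nhds_subtype_coe_eq_nhds x.2 (V.isOpen.mem_nhds x.2)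
  rw [GermEq, ← this, Filter.EventuallyEq, Filter.eventually_map]
  refine Filter.eventually_congr (Filter.Eventually.of_forall fun y => ?_)
  rw [extendZero_of_mem _ y.2, extendZero_of_mem _ y.2]

theorem GermEq.eval {x : Fin m → ℂ} {u : Smooth V} {v : Smooth W} (h : GermEq x u v)
    (hV : x ∈ V) (hW : x ∈ W) : u ⟨x, hV⟩ = v ⟨x, hW⟩ := by
  have := h.eq_of_nhds
  rwa [extendZero_of_mem _ hV, extendZero_of_mem _ hW] at this

theorem germEq_of_forall {x : Fin m → ℂ} {u : Smooth V} {v : Smooth W} (hV : x ∈ V) (hW : x ∈ W)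
    (h : ∀ y (hV : y ∈ V) (hW : y ∈ W), u ⟨y, hV⟩ = v ⟨y, hW⟩) : GermEq x u v := by
  filter_upwards [V.isOpen.mem_nhds hV, W.isOpen.mem_nhds hW] with y h1 h2
  rw [extendZero_of_mem _ h1, extendZero_of_mem _ h2, h y h1 h2]

theorem GermEq.dirDeriv {x : Fin m → ℂ} {u : Smooth V} {v : Smooth W} (hV : x ∈ V) (hW : x ∈ W)
    (h : GermEq x u v) (w : Fin m → ℂ) : GermEq x (dirDeriv w u) (dirDeriv w v) := by
  filter_upwards [V.isOpen.mem_nhds hV, W.isOpen.mem_nhds hW,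
    eventually_eventually_nhds.2 h] with y h1 h2 h3
  rw [extendZero_of_mem _ h1, extendZero_of_mem _ h2]
  exact congrArg (fun L : (Fin m → ℂ) →L[ℝ] ℂ => L w)
    (Filter.EventuallyEq.fderiv_eq (𝕜 := ℝ) h3)

/-- A single congruence for all pointwise binary operations. Sums, products and both Wirtinger
derivatives are instances. -/
theorem GermEq.comp {x : Fin m → ℂ} {u u' : Smooth V} {v v' : Smooth W} (hV : x ∈ V) (hW : x ∈ W)
    (h : GermEq x u v) (h' : GermEq x u' v') {a : Smooth V} {b : Smooth W} (F : ℂ → ℂ → ℂ)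
    (ha : ∀ y, a y = F (u y) (u' y)) (hb : ∀ y, b y = F (v y) (v' y)) : GermEq x a b := by
  filter_upwards [V.isOpen.mem_nhds hV, W.isOpen.mem_nhds hW, h, h'] with y h1 h2 h3 h4
  rw [extendZero_of_mem _ h1, extendZero_of_mem _ h2] at h3 h4 ⊢
  exact (ha _).trans ((congrArg₂ F h3 h4).trans (hb _).symm)

theorem GermEq.dz {x : Fin m → ℂ} {u : Smooth V} {v : Smooth W} (hV : x ∈ V) (hW : x ∈ W)
    (h : GermEq x u v) (k : Fin m) : GermEq x (dz k u) (dz k v) :=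
  (h.dirDeriv hV hW _).comp hV hW (h.dirDeriv hV hW _)
    (fun a b => (1 / 2 : ℂ) * (a - Complex.I * b)) (fun _ => rfl) (fun _ => rfl)

theorem GermEq.dzbar {x : Fin m → ℂ} {u : Smooth V} {v : Smooth W} (hV : x ∈ V) (hW : x ∈ W)
    (h : GermEq x u v) (k : Fin m) : GermEq x (dzbar k u) (dzbar k v) :=
  (h.dirDeriv hV hW _).comp hV hW (h.dirDeriv hV hW _)
    (fun a b => (1 / 2 : ℂ) * (a + Complex.I * b)) (fun _ => rfl) (fun _ => rfl)

theorem GermEq.mul {x : V} {u u' v v' : Smooth V}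
    (h : GermEq x u v) (h' : GermEq x u' v') : GermEq x (u * u') (v * v') :=
  h.comp x.2 x.2 h' (fun a b => a * b) (fun _ => rfl) (fun _ => rfl)

theorem GermEq.add {x : V} {u u' v v' : Smooth V}
    (h : GermEq x u v) (h' : GermEq x u' v') : GermEq x (u + u') (v + v') :=
  h.comp x.2 x.2 h' (fun a b => a + b) (fun _ => rfl) (fun _ => rfl)

theorem GermEq.refl (x : Fin m → ℂ) (u : Smooth V) : GermEq x u u := Filter.EventuallyEq.rfl

theorem GermEq.sum {ι : Type*} {x : V} (s : Finset ι) {u v : ι → Smooth V}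
    (h : ∀ i ∈ s, GermEq x (u i) (v i)) : GermEq x (∑ i ∈ s, u i) (∑ i ∈ s, v i) := by
  classical
  induction s using Finset.induction_on with
  | empty => exact GermEq.refl _ _
  | insert i s hi ih =>
    rw [Finset.sum_insert hi, Finset.sum_insert hi]
    exact (h i (Finset.mem_insert_self _ _)).add (ih fun j hj => h j (Finset.mem_insert_of_mem hj))

theorem GermEq.pow_apply {x : V} {T : Module.End ℂ (Smooth V)}
    (hT : ∀ u v : Smooth V, GermEq x u v → GermEq x (T u) (T v)) (n : ℕ) {u v : Smooth V}
    (h : GermEq x u v) : GermEq x ((T ^ n) u) ((T ^ n) v) := by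
  induction n with
  | zero => exact h
  | succ n ih => rw [pow_succ', Module.End.mul_apply, Module.End.mul_apply]; exact hT _ _ ih

theorem GermEq.list_prod_apply {x : V} (L : List (Module.End ℂ (Smooth V)))
    (hL : ∀ T ∈ L, ∀ u v : Smooth V, GermEq x u v → GermEq x (T u) (T v)) {u v : Smooth V}
    (h : GermEq x u v) : GermEq x (L.prod u) (L.prod v) := by
  induction L with
  | nil => exact h
  | cons T L ih =>
    rw [List.prod_cons, Module.End.mul_apply, Module.End.mul_apply]
    exact hL _ (List.mem_cons_self) _ _ (ih fun S hS => hL S (List.mem_cons_of_mem _ hS))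

/-- Locality of differential operators, which makes the value of a restricted bidifferential
operator independent of the chosen global extensions. -/
theorem GermEq.partialD {x : V} {u v : Smooth V} (h : GermEq x u v) (a : MultiIndex m) :
    GermEq x (partialD a u) (partialD a v) := by
  rw [SepVar.partialD, Module.End.mul_apply, Module.End.mul_apply]
  refine GermEq.list_prod_apply _ ?_ (GermEq.list_prod_apply _ ?_ h)
  all_goals
    intro T hT u v h
    obtain ⟨k, rfl⟩ := (List.mem_ofFn' _ _).1 hT
  · exact h.pow_apply (fun _ _ h => h.dz x.2 x.2 k) _
  · exact h.pow_apply (fun _ _ h => h.dzbar x.2 x.2 k) _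

/-! ### Partial derivatives -/

/-- Raising one exponent puts one extra factor at the right end, since everything commutes.
Exponents are plain functions so that the induction on `n` can pass to `i.succ`. -/
theorem prod_ofFn_pow_add_single {A : Type*} [Monoid A] {n : ℕ} (g : Fin n → A)
    (hg : ∀ i j, Commute (g i) (g j)) (a b : Fin n → ℕ) (k : Fin n)
    (hb : ∀ i, b i = a i + if i = k then 1 else 0) :
    (List.ofFn fun i => g i ^ b i).prod = (List.ofFn fun i => g i ^ a i).prod * g k := by
  induction n with
  | zero => exact k.elim0
  | succ n ih =>
    simp only [List.ofFn_succ, List.prod_cons]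
    refine Fin.cases (fun hb => ?_) (fun j hb => ?_) k hb
    · have h0 : ∀ i : Fin n, b i.succ = a i.succ := fun i => by simp [hb]
      have hc : Commute (g 0) (List.ofFn fun i : Fin n => g i.succ ^ a i.succ).prod := by
        refine Commute.list_prod_right _ _ fun y hy => ?_
        obtain ⟨i, rfl⟩ := (List.mem_ofFn' _ _).1 hy
        exact (hg _ _).pow_right _
      simp only [h0, hb 0, if_true, pow_succ, mul_assoc]
      rw [hc.eq]
    · have h0 : b 0 = a 0 := by simp [hb, (Fin.succ_ne_zero j).symm]
      rw [h0, ih (fun i => g i.succ) (fun i j => hg _ _) (fun i => a i.succ) _ j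
        (fun i => by simp [hb]), mul_assoc]

theorem partialD_zero : (partialD 0 : Module.End ℂ (Smooth V)) = 1 := by
  simp [partialD]

theorem partialD_add_inl (a : MultiIndex m) (k : Fin m) (u : Smooth V) :
    partialD (a + Finsupp.single (Sum.inl k) 1) u = partialD a (dz k u) := by
  have h1 := prod_ofFn_pow_add_single (fun k : Fin m => (dz k : Module.End ℂ (Smooth V)))
    (fun i j => LinearMap.ext fun u => dz_comm i j u) (fun i => a (Sum.inl i))
    (fun i => (a + Finsupp.single (Sum.inl k) 1 : MultiIndex m) (Sum.inl i)) k (fun i => by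
      simp [Finsupp.single_apply, eq_comm])
  have hc : Commute (dz k : Module.End ℂ (Smooth V))
      (List.ofFn fun l : Fin m => (dzbar l : Module.End ℂ (Smooth V)) ^ a (Sum.inr l)).prod := by
    refine Commute.list_prod_right _ _ fun y hy => ?_
    obtain ⟨i, rfl⟩ := (List.mem_ofFn' _ _).1 hy
    exact Commute.pow_right (LinearMap.ext fun u => dz_dzbar_comm k i u) _
  have h2 : ∀ l : Fin m, (a + Finsupp.single (Sum.inl k) 1 : MultiIndex m) (Sum.inr l) = a (Sum.inr l) :=
    fun l => by simp
  rw [partialD, h1]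
  simp only [h2]
  rw [mul_assoc, hc.eq, ← mul_assoc]
  rfl

theorem partialD_add_inr (a : MultiIndex m) (k : Fin m) (u : Smooth V) :
    partialD (a + Finsupp.single (Sum.inr k) 1) u = partialD a (dzbar k u) := by
  have h1 := prod_ofFn_pow_add_single (fun k : Fin m => (dzbar k : Module.End ℂ (Smooth V)))
    (fun i j => LinearMap.ext fun u => dzbar_comm i j u) (fun i => a (Sum.inr i))
    (fun i => (a + Finsupp.single (Sum.inr k) 1 : MultiIndex m) (Sum.inr i)) k (fun i => by
      simp [Finsupp.single_apply, eq_comm])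
  have h2 : ∀ l : Fin m, (a + Finsupp.single (Sum.inr k) 1 : MultiIndex m) (Sum.inl l) = a (Sum.inl l) :=
    fun l => by simp
  rw [partialD, h1]
  simp only [h2]
  rw [← mul_assoc]
  rfl

/-- Multi-indices are built one unit at a time, to match `partialD_add_inl`, `partialD_add_inr` and
multiplication of symbols by one `ζ_k`. -/
theorem finsupp_induction_add_single {σ : Type*} {p : (σ →₀ ℕ) → Prop} (h0 : p 0)
    (h : ∀ a i, p a → p (a + Finsupp.single i 1)) (a : σ →₀ ℕ) : p a := by
  induction a using Finsupp.induction with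
  | zero => exact h0
  | single_add i n f _ _ ih =>
    -- The facts `n ≠ 0` and `i ∉ f.support` must go before an induction on `n` is possible.
    clear * - h ih
    induction n with
    | zero => simpa using ih
    | succ n ihn =>
      have := h _ i ihn
      rwa [add_right_comm, ← Finsupp.single_add] at this

theorem dzbar_partialD (l : Fin m) (a : MultiIndex m) (u : Smooth V) :
    dzbar l (partialD a u) = partialD a (dzbar l u) := by
  induction a using finsupp_induction_add_single generalizing u with
  | h0 => simp [partialD_zero]
  | h a i ih =>
    rcases i with k | k
    · rw [partialD_add_inl, partialD_add_inl, ih, dz_dzbar_comm]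
    · rw [partialD_add_inr, partialD_add_inr, ih, dzbar_comm]

theorem dz_one (k : Fin m) : dz k (1 : Smooth V) = 0 := by
  have := dz_mul k (1 : Smooth V) 1
  simpa using this

theorem dzbar_one (k : Fin m) : dzbar k (1 : Smooth V) = 0 := by
  have := dzbar_mul k (1 : Smooth V) 1
  simpa using this

theorem partialD_one {a : MultiIndex m} (ha : a ≠ 0) : partialD a (1 : Smooth V) = 0 := by
  obtain ⟨i, hi⟩ : ∃ i, a i ≠ 0 := by
    by_contra! h
    exact ha (Finsupp.ext h)
  have : a = (a - Finsupp.single i 1) + Finsupp.single i 1 :=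
    (tsub_add_cancel_of_le (Finsupp.single_le_iff.2 (Nat.one_le_iff_ne_zero.2 hi))).symm
  rw [this]
  rcases i with k | k
  · rw [partialD_add_inl, dz_one, map_zero]
  · rw [partialD_add_inr, dzbar_one, map_zero]

end Calculus

/-! ### Symbols of differential operators: uniqueness and composition formulas. -/

section SymbolCalculus

variable {m : ℕ} {V : TopologicalSpace.Opens (Fin m → ℂ)}

/-- The action of symbols on a fixed function, as a linear map in the symbol. -/
def symbolHom (u : Smooth V) :
    MvPolynomial (Fin m ⊕ Fin m) (Smooth V) →ₗ[Smooth V] Smooth V :=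
  (MvPolynomial.basisMonomials _ _).constr (Smooth V) fun a => partialD a u

theorem symbolHom_monomial (u c : Smooth V) (a : MultiIndex m) :
    symbolHom u (MvPolynomial.monomial a c) = c * partialD a u := by
  have : MvPolynomial.monomial a c =
      c • (MvPolynomial.basisMonomials (Fin m ⊕ Fin m) (Smooth V)) a := by
    rw [MvPolynomial.coe_basisMonomials, MvPolynomial.smul_monomial, smul_eq_mul, mul_one]
  rw [this, map_smul, symbolHom, Module.Basis.constr_basis, smul_eq_mul]

/-- Linearity in the symbol is invisible in the sum over the support. With `symbolHom` every
identity reduces to monomials. -/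
theorem symbolApply_eq (P : MvPolynomial (Fin m ⊕ Fin m) (Smooth V)) (u : Smooth V) :
    symbolApply P u = symbolHom u P := by
  conv_rhs => rw [← MvPolynomial.support_sum_monomial_coeff P]
  rw [map_sum]
  exact Finset.sum_congr rfl fun a _ => (symbolHom_monomial u _ a).symm

/-- The coordinate functions centred at a point. -/
def coordZ (x : Fin m → ℂ) (k : Fin m) : Smooth V :=
  ⟨fun y => y.1 k - x k, by
    refine ContDiffOn.congr (f := fun y : Fin m → ℂ => y k - x k) ?_
      (fun y hy => extendZero_of_mem _ hy)
    fun_prop⟩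

/-- The conjugate coordinate functions centred at a point. -/
def coordZbar (x : Fin m → ℂ) (k : Fin m) : Smooth V :=
  ⟨fun y => (starRingEnd ℂ) (y.1 k - x k), by
    refine ContDiffOn.congr (f := fun y : Fin m → ℂ => (starRingEnd ℂ) (y k - x k)) ?_
      (fun y hy => extendZero_of_mem _ hy)
    exact Complex.conjCLE.contDiff.comp_contDiffOn (by fun_prop)⟩

theorem dirDeriv_coordZ (w x : Fin m → ℂ) (k : Fin m) :
    dirDeriv w (coordZ x k : Smooth V) = algebraMap ℂ (Smooth V) (w k) := by
  refine Smooth.ext fun y => ?_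
  have h : extendZero (coordZ x k : Smooth V).1 =ᶠ[𝓝 (y : Fin m → ℂ)]
      fun y => y k - x k := by
    filter_upwards [V.isOpen.mem_nhds y.2] with z hz
    rw [extendZero_of_mem _ hz]
    rfl
  rw [dirDeriv_apply, h.fderiv_eq]
  have : HasFDerivAt (𝕜 := ℝ) (fun y : Fin m → ℂ => y k - x k)
      (ContinuousLinearMap.proj (R := ℝ) (φ := fun _ : Fin m => ℂ) k) y :=
    ((ContinuousLinearMap.proj (R := ℝ) (φ := fun _ : Fin m => ℂ) k).hasFDerivAt).sub_const _
  rw [this.fderiv]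
  rfl

theorem dirDeriv_coordZbar (w x : Fin m → ℂ) (k : Fin m) :
    dirDeriv w (coordZbar x k : Smooth V) =
      algebraMap ℂ (Smooth V) ((starRingEnd ℂ) (w k)) := by
  refine Smooth.ext fun y => ?_
  have h : extendZero (coordZbar x k : Smooth V).1 =ᶠ[𝓝 (y : Fin m → ℂ)]
      fun y => Complex.conjCLE (y k - x k) := by
    filter_upwards [V.isOpen.mem_nhds y.2] with z hz
    rw [extendZero_of_mem _ hz]
    rfl
  rw [dirDeriv_apply, h.fderiv_eq]
  have : HasFDerivAt (𝕜 := ℝ) (fun y : Fin m → ℂ => Complex.conjCLE (y k - x k))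
      ((Complex.conjCLE : ℂ →L[ℝ] ℂ).comp
        (ContinuousLinearMap.proj (R := ℝ) (φ := fun _ : Fin m => ℂ) k)) y :=
    (Complex.conjCLE : ℂ →L[ℝ] ℂ).hasFDerivAt.comp _
    (((ContinuousLinearMap.proj (R := ℝ) (φ := fun _ : Fin m => ℂ) k).hasFDerivAt).sub_const _)
  rw [this.fderiv]
  rfl

theorem half_smul_sub_I (a : ℂ) :
    (1 / 2 : ℂ) • (algebraMap ℂ (Smooth V) a - Complex.I • algebraMap ℂ (Smooth V)
      (a * Complex.I)) = algebraMap ℂ (Smooth V) a := by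
  rw [Algebra.smul_def, Algebra.smul_def, ← map_mul, ← map_sub, ← map_mul]
  congr 1
  linear_combination (-1 / 2 * a) * Complex.I_sq

theorem half_smul_add_I (a : ℂ) :
    (1 / 2 : ℂ) • (algebraMap ℂ (Smooth V) a + Complex.I • algebraMap ℂ (Smooth V)
      (a * Complex.I)) = 0 := by
  rw [Algebra.smul_def, Algebra.smul_def, ← map_mul, ← map_add, ← map_mul, ← map_zero
    (algebraMap ℂ (Smooth V))]
  congr 1
  linear_combination (1 / 2 * a) * Complex.I_sq

theorem single_I_apply (j k : Fin m) :
    (Pi.single k Complex.I : Fin m → ℂ) j = (Pi.single k 1 : Fin m → ℂ) j * Complex.I := by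
  by_cases h : j = k
  · subst h; simp
  · simp [h]

theorem conj_single_one (j k : Fin m) :
    (starRingEnd ℂ) ((Pi.single k 1 : Fin m → ℂ) j) = (Pi.single k 1 : Fin m → ℂ) j := by
  by_cases h : j = k
  · subst h; simp
  · simp [h]

theorem dz_coordZ (x : Fin m → ℂ) (j k : Fin m) :
    dz k (coordZ x j : Smooth V) = algebraMap ℂ (Smooth V) ((Pi.single k 1 : Fin m → ℂ) j) := by
  rw [dz_eq, dirDeriv_coordZ, dirDeriv_coordZ, single_I_apply, half_smul_sub_I]

theorem dzbar_coordZ (x : Fin m → ℂ) (j k : Fin m) :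
    dzbar k (coordZ x j : Smooth V) = 0 := by
  rw [dzbar_eq, dirDeriv_coordZ, dirDeriv_coordZ, single_I_apply, half_smul_add_I]

theorem dz_coordZbar (x : Fin m → ℂ) (j k : Fin m) :
    dz k (coordZbar x j : Smooth V) = 0 := by
  rw [dz_eq, dirDeriv_coordZbar, dirDeriv_coordZbar, single_I_apply, map_mul, Complex.conj_I,
    conj_single_one, mul_neg, map_neg, smul_neg, sub_neg_eq_add, half_smul_add_I]

theorem dzbar_coordZbar (x : Fin m → ℂ) (j k : Fin m) :
    dzbar k (coordZbar x j : Smooth V) =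
      algebraMap ℂ (Smooth V) ((Pi.single k 1 : Fin m → ℂ) j) := by
  rw [dzbar_eq, dirDeriv_coordZbar, dirDeriv_coordZbar, single_I_apply, map_mul, Complex.conj_I,
    conj_single_one, mul_neg, map_neg, smul_neg, ← sub_eq_add_neg, half_smul_sub_I]

/-- Polynomials in the coordinates and their conjugates, centred at a point. -/
def coordPoly (x : Fin m → ℂ) : MvPolynomial (Fin m ⊕ Fin m) ℂ →ₐ[ℂ] Smooth V :=
  MvPolynomial.aeval (Sum.elim (coordZ x) (coordZbar x))

theorem dz_algebraMap (k : Fin m) (c : ℂ) : dz k (algebraMap ℂ (Smooth V) c) = 0 := by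
  rw [Algebra.algebraMap_eq_smul_one, map_smul, dz_one, smul_zero]

theorem dzbar_algebraMap (k : Fin m) (c : ℂ) : dzbar k (algebraMap ℂ (Smooth V) c) = 0 := by
  rw [Algebra.algebraMap_eq_smul_one, map_smul, dzbar_one, smul_zero]

theorem coordPoly_X (x : Fin m → ℂ) (i : Fin m ⊕ Fin m) :
    (coordPoly x (MvPolynomial.X i) : Smooth V) = Sum.elim (coordZ x) (coordZbar x) i := by
  simp [coordPoly]

/-- A derivation is determined on polynomials by its values on the generators. Stated for a general
`T`, it serves both kinds of Wirtinger derivative. -/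
theorem map_coordPoly_of_leibniz (x : Fin m → ℂ) (i : Fin m ⊕ Fin m)
    (T : Smooth V →ₗ[ℂ] Smooth V) (hmul : ∀ u v, T (u * v) = u * T v + v * T u)
    (hc : ∀ c, T (algebraMap ℂ (Smooth V) c) = 0)
    (hX : ∀ j, T (coordPoly x (MvPolynomial.X j)) =
      algebraMap ℂ (Smooth V) ((Pi.single i 1 : _ → ℂ) j))
    (p : MvPolynomial (Fin m ⊕ Fin m) ℂ) :
    T (coordPoly x p) = coordPoly x (MvPolynomial.pderiv i p) := by
  induction p using MvPolynomial.induction_on with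
  | C c =>
    rw [MvPolynomial.pderiv_C, map_zero]
    have : (coordPoly x (MvPolynomial.C c) : Smooth V) = algebraMap ℂ (Smooth V) c := by
      simp [coordPoly]
    rw [this, hc]
  | add p q hp hq => simp only [map_add, hp, hq]
  | mul_X p j hp =>
    rw [map_mul, hmul, hp, hX, Derivation.leibniz, MvPolynomial.pderiv_X, map_add, smul_eq_mul,
      smul_eq_mul, map_mul, map_mul]
    congr 2
    by_cases h : j = i
    · subst h; simp
    · simp [h]

theorem dz_coordPoly (x : Fin m → ℂ) (k : Fin m) (p : MvPolynomial (Fin m ⊕ Fin m) ℂ) :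
    dz k (coordPoly x p : Smooth V) = coordPoly x (MvPolynomial.pderiv (Sum.inl k) p) := by
  refine map_coordPoly_of_leibniz x _ _ (dz_mul k) (dz_algebraMap k) (fun j => ?_) p
  rw [coordPoly_X]
  rcases j with j | j
  · rw [Sum.elim_inl, dz_coordZ]
    congr 1
    simp [Pi.single_apply]
  · rw [Sum.elim_inr, dz_coordZbar]
    simp

theorem dzbar_coordPoly (x : Fin m → ℂ) (k : Fin m) (p : MvPolynomial (Fin m ⊕ Fin m) ℂ) :
    dzbar k (coordPoly x p : Smooth V) = coordPoly x (MvPolynomial.pderiv (Sum.inr k) p) := by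
  refine map_coordPoly_of_leibniz x _ _ (dzbar_mul k) (dzbar_algebraMap k) (fun j => ?_) p
  rw [coordPoly_X]
  rcases j with j | j
  · rw [Sum.elim_inl, dzbar_coordZ]
    simp
  · rw [Sum.elim_inr, dzbar_coordZbar]
    congr 1
    simp [Pi.single_apply]

theorem evalAt_coordPoly (x : V) (p : MvPolynomial (Fin m ⊕ Fin m) ℂ) :
    evalAt x (coordPoly (x : Fin m → ℂ) p : Smooth V) = MvPolynomial.coeff 0 p := by
  induction p using MvPolynomial.induction_on with
  | C c => simp [coordPoly]; rfl
  | add p q hp hq => simp only [map_add, hp, hq, MvPolynomial.coeff_add]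
  | mul_X p j hp =>
    rw [map_mul, coordPoly_X, map_mul, MvPolynomial.coeff_mul_X']
    have : evalAt x (Sum.elim (coordZ x.1) (coordZbar x.1) j : Smooth V) = 0 := by
      rcases j with j | j
      · exact sub_self (x.1 j)
      · change (starRingEnd ℂ) (x.1 j - x.1 j) = 0
        simp
    simp [this]

/-- At the centre `x`, the derivative `∂^a` reads off the Taylor coefficient of index `a` up to a
factorial. Only `c ≠ 0` is needed later, so the factorial is not named. -/
theorem exists_evalAt_partialD_coordPoly (x : V) (a : MultiIndex m) : ∃ c : ℂ, c ≠ 0 ∧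
    ∀ p, evalAt x (partialD a (coordPoly (x : Fin m → ℂ) p : Smooth V)) =
      c * MvPolynomial.coeff a p := by
  induction a using finsupp_induction_add_single with
  | h0 => exact ⟨1, one_ne_zero, fun p => by
      rw [partialD_zero, Module.End.one_apply, evalAt_coordPoly, one_mul]⟩
  | h a i ih =>
    obtain ⟨c, hc, h⟩ := ih
    refine ⟨c * (a i + 1), mul_ne_zero hc (Nat.cast_add_one_ne_zero _), fun p => ?_⟩
    have key : partialD (a + Finsupp.single i 1) (coordPoly (x : Fin m → ℂ) p : Smooth V) =
        partialD a (coordPoly (x : Fin m → ℂ) (MvPolynomial.pderiv i p)) := by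
      rcases i with k | k
      · rw [partialD_add_inl, dz_coordPoly]
      · rw [partialD_add_inr, dzbar_coordPoly]
    rw [key, h, MvPolynomial.coeff_pderiv]
    ring

/-- A differential operator determines its total symbol. -/
theorem eq_zero_of_symbolHom_eq_zero {P : MvPolynomial (Fin m ⊕ Fin m) (Smooth V)}
    (h : ∀ u, symbolHom u P = 0) : P = 0 := by
  classical
  ext1 b
  refine Smooth.ext fun x => ?_
  -- The coordinate monomial of exponent `b` centred at `x` isolates the coefficient of index `b` at
  -- `x`.
  have h1 := congrArg (evalAt x) (h (coordPoly x.1 (MvPolynomial.monomial b 1)))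
  choose c hc hcp using exists_evalAt_partialD_coordPoly x
  rw [← symbolApply_eq, symbolApply, map_sum, map_zero] at h1
  simp only [map_mul, hcp, MvPolynomial.coeff_monomial, mul_ite, mul_one, mul_zero,
    Finset.sum_ite_eq] at h1
  change evalAt x (P.coeff b) = evalAt x 0
  rw [map_zero]
  by_cases hb : b ∈ P.support
  · rw [if_pos hb] at h1
    exact (mul_eq_zero.1 h1).resolve_right (hc b)
  · rw [MvPolynomial.notMem_support_iff.1 hb, map_zero]

/-! ### Symbols in the holomorphic directions -/

/-- The action on a fixed function of symbols that do not depend on `ζ̄`. -/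
def holHom (u : Smooth V) : MvPolynomial (Fin m) (Smooth V) →ₗ[Smooth V] Smooth V :=
  symbolHom u ∘ₗ (MvPolynomial.rename (Sum.inl : Fin m → Fin m ⊕ Fin m)).toLinearMap

theorem holHom_monomial (u c : Smooth V) (a : Fin m →₀ ℕ) :
    holHom u (MvPolynomial.monomial a c) = c * partialD (a.mapDomain Sum.inl) u := by
  rw [holHom, LinearMap.comp_apply, AlgHom.toLinearMap_apply, MvPolynomial.rename_monomial,
    symbolHom_monomial]

theorem eq_zero_of_holHom_eq_zero {P : MvPolynomial (Fin m) (Smooth V)}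
    (h : ∀ u, holHom u P = 0) : P = 0 :=
  MvPolynomial.rename_injective _ Sum.inl_injective
    ((eq_zero_of_symbolHom_eq_zero h).trans (map_zero _).symm)

/-- Constants are killed by every derivative. This is how `f ∗ 1 = f` becomes the initial condition
at `ζ = 0`. -/
theorem holHom_one (P : MvPolynomial (Fin m) (Smooth V)) : holHom 1 P = P.coeff 0 := by
  classical
  induction P using MvPolynomial.induction_on' with
  | monomial a c =>
    rw [holHom_monomial, MvPolynomial.coeff_monomial]
    split_ifs with h
    · rw [h, Finsupp.mapDomain_zero, partialD_zero, Module.End.one_apply, mul_one]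
    · rw [partialD_one, mul_zero]
      rw [Ne, ← Finsupp.mapDomain_zero (f := Sum.inl)]
      exact fun h' => h (Finsupp.mapDomain_injective Sum.inl_injective h')
  | add p q hp hq => rw [map_add, hp, hq, MvPolynomial.coeff_add]

theorem holHom_add (u v : Smooth V) (P : MvPolynomial (Fin m) (Smooth V)) :
    holHom (u + v) P = holHom u P + holHom v P := by
  induction P using MvPolynomial.induction_on' with
  | monomial a c => simp only [holHom_monomial, map_add, mul_add]
  | add p q hp hq =>
    simp only [map_add, hp, hq]
    abel

theorem holHom_X_mul (u : Smooth V) (k : Fin m) (P : MvPolynomial (Fin m) (Smooth V)) :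
    holHom u (MvPolynomial.X k * P) = holHom (dz k u) P := by
  induction P using MvPolynomial.induction_on' with
  | monomial a c =>
    rw [MvPolynomial.X, MvPolynomial.monomial_mul, one_mul, holHom_monomial, holHom_monomial,
      add_comm, Finsupp.mapDomain_add, Finsupp.mapDomain_single, partialD_add_inl]
  | add p q hp hq => rw [mul_add, map_add, hp, hq, map_add]

theorem mapCoeffs_monomial (T : (Fin m →₀ ℕ) → Smooth V →ₗ[ℂ] Smooth V) (a : Fin m →₀ ℕ)
    (c : Smooth V) :
    mapCoeffs T (MvPolynomial.monomial a c) = MvPolynomial.monomial a (T a c) := by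
  classical
  ext1 b
  rw [coeff_mapCoeffs, MvPolynomial.coeff_monomial, MvPolynomial.coeff_monomial]
  split_ifs with h
  · rw [h]
  · rw [map_zero]

/-- `∂/∂z̄^l` commutes with all coordinate derivatives, so its commutator with the operator of
symbol `P` only sees the coefficients of `P`. -/
theorem dzbar_holHom (l : Fin m) (u : Smooth V) (P : MvPolynomial (Fin m) (Smooth V)) :
    dzbar l (holHom u P) = holHom u (mapCoeffs (fun _ => dzbar l) P) + holHom (dzbar l u) P := by
  induction P using MvPolynomial.induction_on' with
  | monomial a c =>
    rw [mapCoeffs_monomial, holHom_monomial, holHom_monomial, holHom_monomial, dzbar_mul,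
      dzbar_partialD]
    ring
  | add p q hp hq =>
    simp only [map_add, hp, hq]
    abel

/-! ### The symbol of the composition with a multiplication operator -/

/-- The operator `∑_κ (∂h / ∂z^{k_1} ⋯ ∂z^{k_r}) ∂^r / ∂ζ_{k_1} ⋯ ∂ζ_{k_r}`. -/
def jetOp (r : ℕ) (h : Smooth V) : Module.End (Smooth V) (MvPolynomial (Fin m) (Smooth V)) :=
  ∑ κ : Fin r → Fin m,
    ((List.ofFn fun i : Fin r => (dz (κ i) : Module.End ℂ (Smooth V))).prod h) • fibreDeriv κ

theorem jetOp_zero (h : Smooth V) (P : MvPolynomial (Fin m) (Smooth V)) :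
    jetOp 0 h P = h • P := by
  simp [jetOp, fibreDeriv]

theorem prod_ofFn_snoc {A ι : Type*} [Monoid A] (r : ℕ) (F : ι → A) (κ : Fin r → ι) (k : ι) :
    (List.ofFn fun i : Fin (r + 1) => F ((Fin.snoc κ k : Fin (r + 1) → ι) i)).prod =
      (List.ofFn fun i => F (κ i)).prod * F k := by
  rw [List.ofFn_succ', List.prod_concat]
  simp

/-- The last factor of each product of operators acts first, so splitting off the last index
differentiates `h` and `P` themselves and leaves a `jetOp` of lower order. -/
theorem jetOp_succ (r : ℕ) (h : Smooth V) (P : MvPolynomial (Fin m) (Smooth V)) :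
    jetOp (r + 1) h P = ∑ k, jetOp r (dz k h) (MvPolynomial.pderiv k P) := by
  rw [jetOp, LinearMap.sum_apply,
    ← (Fin.snocEquiv fun _ : Fin (r + 1) => Fin m).sum_comp, Fintype.sum_prod_type]
  refine Finset.sum_congr rfl fun k _ => ?_
  rw [jetOp, LinearMap.sum_apply]
  refine Finset.sum_congr rfl fun κ _ => ?_
  have h1 := prod_ofFn_snoc r (fun k => (dz k : Module.End ℂ (Smooth V))) κ k
  have h2 := prod_ofFn_snoc r (fun k => (MvPolynomial.pderiv k :
    Derivation (Smooth V) (MvPolynomial (Fin m) (Smooth V)) (MvPolynomial (Fin m) (Smooth V))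
    ).toLinearMap) κ k
  simp only [Fin.snocEquiv_apply, LinearMap.smul_apply, fibreDeriv]
  erw [h1, h2]
  rfl

/-- Each of the `r + 1` derivatives in `ζ` may hit the factor `ζ_k`. All these contributions agree
because derivatives of `h` commute. -/
theorem jetOp_X_mul (r : ℕ) (h : Smooth V) (k : Fin m) (P : MvPolynomial (Fin m) (Smooth V)) :
    jetOp (r + 1) h (MvPolynomial.X k * P) =
      MvPolynomial.X k * jetOp (r + 1) h P + ((r + 1 : ℕ) : ℂ) • jetOp r (dz k h) P := by
  have key : ∀ (s : ℕ) (k j : Fin m) (h : Smooth V) (P : MvPolynomial (Fin m) (Smooth V)),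
      jetOp s (dz j h) (MvPolynomial.pderiv j (MvPolynomial.X k * P)) =
        jetOp s (dz j h) (MvPolynomial.X k * MvPolynomial.pderiv j P) +
          if j = k then jetOp s (dz j h) P else 0 := by
    intro s k j h P
    rw [Derivation.leibniz, map_add, smul_eq_mul, smul_eq_mul, MvPolynomial.pderiv_X]
    congr 1
    by_cases hj : j = k
    · subst hj; simp
    · simp [hj, Ne.symm hj]
  induction r generalizing h k P with
  | zero =>
    simp only [jetOp_succ, key, Finset.sum_add_distrib, Finset.sum_ite_eq', Finset.mem_univ,
      if_true, jetOp_zero, Finset.mul_sum, mul_smul_comm]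
    simp
  | succ r ih =>
    rw [jetOp_succ]
    simp only [key, Finset.sum_add_distrib, Finset.sum_ite_eq', Finset.mem_univ, if_true, ih]
    rw [jetOp_succ (r + 1) h P, Finset.mul_sum, ← Finset.smul_sum]
    have : ∑ j, jetOp r (dz k (dz j h)) (MvPolynomial.pderiv j P) = jetOp (r + 1) (dz k h) P := by
      rw [jetOp_succ]
      exact Finset.sum_congr rfl fun j _ => by rw [dz_comm]
    rw [this]
    push_cast
    module

/-- The truncated sum `∑_{r < N} (1/r!) (∂_κ h) ∂_κ`. -/
def taylorOp (N : ℕ) (h : Smooth V) (P : MvPolynomial (Fin m) (Smooth V)) :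
    MvPolynomial (Fin m) (Smooth V) :=
  ∑ r ∈ Finset.range N, ((r.factorial : ℂ)⁻¹) • jetOp r h P

/-- The factor `r + 1` of `jetOp_X_mul` turns `1/(r+1)!` into `1/r!`. The outcome mirrors the
Leibniz rule for `∂/∂z^k (h u)`, at the price of one truncation order in the second term. -/
theorem taylorOp_X_mul (N : ℕ) (h : Smooth V) (k : Fin m)
    (P : MvPolynomial (Fin m) (Smooth V)) :
    taylorOp (N + 1) h (MvPolynomial.X k * P) =
      MvPolynomial.X k * taylorOp (N + 1) h P + taylorOp N (dz k h) P := by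
  rw [taylorOp, taylorOp, Finset.sum_range_succ', Finset.sum_range_succ', mul_add, Finset.mul_sum,
    add_right_comm, taylorOp, ← Finset.sum_add_distrib]
  congr 1
  · refine Finset.sum_congr rfl fun r _ => ?_
    rw [jetOp_X_mul, smul_add, mul_smul_comm, smul_smul]
    congr 2
    rw [Nat.factorial_succ, Nat.cast_mul]
    have h1 : ((r + 1 : ℕ) : ℂ) ≠ 0 := Nat.cast_ne_zero.2 (Nat.succ_ne_zero r)
    have h2 : ((r.factorial : ℕ) : ℂ) ≠ 0 := Nat.cast_ne_zero.2 r.factorial_ne_zero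
    field_simp
  · simp only [jetOp_zero, mul_smul_comm]

theorem taylorOp_C (N : ℕ) (h c : Smooth V) :
    taylorOp (N + 1) h (MvPolynomial.C c) = h • MvPolynomial.C c := by
  rw [taylorOp, Finset.sum_range_succ', jetOp_zero, Finset.sum_eq_zero, zero_add]
  · simp
  · intro r _
    rw [jetOp_succ]
    simp

/-- The general Leibniz rule as a composition formula for symbols. Both sides satisfy the same
recursion under multiplication of the symbol by `ζ_i`; the condition `d < N` ensures that the
truncated Taylor sum omits only vanishing terms. -/
theorem holHom_mul (h : Smooth V) (d : ℕ) (P : MvPolynomial (Fin m) (Smooth V))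
    (hP : P ∈ MvPolynomial.restrictTotalDegree (Fin m) (Smooth V) d) (N : ℕ) (hN : d < N)
    (u : Smooth V) : holHom (h * u) P = holHom u (taylorOp N h P) := by
  classical
  -- `h`, `N` and `u` stay quantified because the inductive step also uses `∂h/∂z^i` with a smaller
  -- truncation order, and `∂u/∂z^i`.
  have key : ∀ (a : Fin m →₀ ℕ) (c h : Smooth V) (N : ℕ), a.degree < N → ∀ u,
      holHom (h * u) (MvPolynomial.monomial a c) =
        holHom u (taylorOp N h (MvPolynomial.monomial a c)) := by
    intro a
    induction a using finsupp_induction_add_single with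
    | h0 =>
      intro c h N hN u
      obtain ⟨N, rfl⟩ := Nat.exists_eq_succ_of_ne_zero (Nat.ne_zero_of_lt hN)
      change _ = holHom u (taylorOp (N + 1) h (MvPolynomial.C c))
      rw [taylorOp_C, map_smul, MvPolynomial.C_apply, holHom_monomial, holHom_monomial,
        Finsupp.mapDomain_zero, partialD_zero, Module.End.one_apply, Module.End.one_apply,
        smul_eq_mul]
      ring
    | h a i ih =>
      intro c h N hN u
      rw [map_add, Finsupp.degree_single] at hN
      obtain ⟨N, rfl⟩ := Nat.exists_eq_succ_of_ne_zero (Nat.ne_zero_of_lt hN)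
      have hX : MvPolynomial.monomial (a + Finsupp.single i 1) c =
          MvPolynomial.X i * MvPolynomial.monomial a c := by
        rw [MvPolynomial.X, MvPolynomial.monomial_mul, one_mul, add_comm]
      rw [hX, holHom_X_mul, Nat.succ_eq_add_one, taylorOp_X_mul, map_add, holHom_X_mul, dz_mul,
        holHom_add, ih _ _ (N + 1) (by omega), mul_comm u, ih _ _ N (by omega)]
  rw [← MvPolynomial.support_sum_monomial_coeff P]
  have hsum : ∀ (s : Finset (Fin m →₀ ℕ)) (f : (Fin m →₀ ℕ) → MvPolynomial (Fin m) (Smooth V)),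
      taylorOp N h (∑ a ∈ s, f a) = ∑ a ∈ s, taylorOp N h (f a) := by
    intro s f
    simp only [taylorOp, map_sum, Finset.smul_sum]
    exact Finset.sum_comm
  rw [hsum, map_sum, map_sum]
  refine Finset.sum_congr rfl fun a ha => key a _ h N (lt_of_le_of_lt ?_ hN) u
  rw [MvPolynomial.mem_restrictTotalDegree] at hP
  refine le_trans ?_ hP
  have := MvPolynomial.le_totalDegree ha
  rwa [Finsupp.sum_fintype _ _ (fun _ => rfl), ← Finsupp.degree_eq_sum] at this

end SymbolCalculus

/-! ### The underlying real manifold and invertibility of the metric tensor. -/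

section RealStructure

variable {m : ℕ} {M : Type*} [TopologicalSpace M] [ChartedSpace (Fin m → ℂ) M]

theorem contDiffGroupoid_complex_le_real :
    contDiffGroupoid ω 𝓘(ℂ, Fin m → ℂ) ≤ contDiffGroupoid ∞ 𝓘(ℝ, Fin m → ℂ) := by
  intro e he
  have h := mem_groupoid_of_pregroupoid.1 he
  refine mem_groupoid_of_pregroupoid.2 ⟨?_, ?_⟩
  · have h1 : ContDiffOn ℂ ω e e.source := by
      simpa [contDiffPregroupoid, Function.comp_def] using h.1
    simpa [contDiffPregroupoid, Function.comp_def] using (h1.restrict_scalars ℝ).of_le le_top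
  · have h1 : ContDiffOn ℂ ω e.symm e.target := by
      simpa [contDiffPregroupoid, Function.comp_def] using h.2
    simpa [contDiffPregroupoid, Function.comp_def] using (h1.restrict_scalars ℝ).of_le le_top

theorem isManifold_real [IsManifold 𝓘(ℂ, Fin m → ℂ) ω M] :
    IsManifold 𝓘(ℝ, Fin m → ℂ) ∞ M :=
  have : HasGroupoid M (contDiffGroupoid ∞ 𝓘(ℝ, Fin m → ℂ)) :=
    hasGroupoid_of_le (G₁ := contDiffGroupoid ω 𝓘(ℂ, Fin m → ℂ)) inferInstance
      contDiffGroupoid_complex_le_real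
  IsManifold.mk' _ _ _

theorem HolChart.mem_maximalAtlas_real (φ : HolChart m M) :
    φ.1 ∈ IsManifold.maximalAtlas 𝓘(ℝ, Fin m → ℂ) ∞ M :=
  StructureGroupoid.maximalAtlas_mono contDiffGroupoid_complex_le_real φ.2

theorem HolChart.mdifferentiable (φ : HolChart m M) :
    φ.1.MDifferentiable 𝓘(ℝ, Fin m → ℂ) 𝓘(ℝ, Fin m → ℂ) :=
  ⟨(contMDiffOn_of_mem_maximalAtlas φ.mem_maximalAtlas_real).mdifferentiableOn (by simp),
    (contMDiffOn_symm_of_mem_maximalAtlas φ.mem_maximalAtlas_real).mdifferentiableOn (by simp)⟩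

/-! ### Nondegeneracy of the metric tensor -/

/-- An alternating form as a bilinear map. -/
def twoFormBilin {E : Type*} [NormedAddCommGroup E] [NormedSpace ℝ E]
    (α : E [⋀^Fin 2]→L[ℝ] ℝ) : E →ₗ[ℝ] E →ₗ[ℝ] ℝ :=
  have h0 : ∀ (v w z : E), Function.update ![v, w] 0 z = ![z, w] := by
    intro v w z; funext i; fin_cases i <;> simp
  have h1 : ∀ (v w z : E), Function.update ![v, w] 1 z = ![v, z] := by
    intro v w z; funext i; fin_cases i <;> simp
  LinearMap.mk₂ ℝ (fun v w => α ![v, w])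
    (fun v v' w => by
      have := α.map_update_add ![v, w] 0 v v'
      rwa [h0, h0, h0] at this)
    (fun c v w => by
      have := α.map_update_smul ![v, w] 0 c v
      rwa [h0, h0] at this)
    (fun v w w' => by
      have := α.map_update_add ![v, w] 1 w w'
      rwa [h1, h1, h1] at this)
    (fun c v w => by
      have := α.map_update_smul ![v, w] 1 c w
      rwa [h1, h1] at this)

/-- Type `(1,1)` means invariance under multiplication by `i`, so the form is, up to a factor, the
imaginary part of a sesquilinear `H` whose matrix is `g_{k l̄}`. A vector `v` in the left kernel of
this matrix has `H v = 0`, hence pairs to zero with everything, against nondegeneracy. -/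
theorem isUnit_det_metric (Ω : PseudoKahlerForm m M) (φ : HolChart m M)
    {x : Fin m → ℂ} (hx : x ∈ φ.1.target) : IsUnit (Ω.metric φ x).det := by
  classical
  rw [isUnit_iff_ne_zero]
  intro hdet
  obtain ⟨v, hv0, hv⟩ := Matrix.exists_vecMul_eq_zero_iff.2 hdet
  set B := twoFormBilin (formInChart Ω.form φ x) with hB
  have hJ : ∀ v w, B (Complex.I • v) (Complex.I • w) = B v w := Ω.type_one_one φ x hx
  have hI : ∀ v : Fin m → ℂ, Complex.I • Complex.I • v = -v := by
    intro v
    rw [smul_smul, Complex.I_mul_I, neg_one_smul]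
  have hJ' : ∀ v w, B (Complex.I • v) w = - B v (Complex.I • w) := by
    intro v w
    have := hJ (Complex.I • v) w
    rw [hI, map_neg, LinearMap.neg_apply] at this
    exact this.symm
  -- the hermitian form of `B`, complex linear in the first argument
  let H : (Fin m → ℂ) → (Fin m → ℂ) → ℂ := fun v w =>
    (1 / 2 : ℂ) * ((B v (Complex.I • w) : ℂ) - Complex.I * (B v w : ℂ))
  have Hadd : ∀ v v' w, H (v + v') w = H v w + H v' w := by
    intro v v' w
    simp only [H, map_add, LinearMap.add_apply, Complex.ofReal_add]
    ring
  have HI : ∀ v w, H (Complex.I • v) w = Complex.I * H v w := by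
    intro v w
    simp only [H, hJ, hJ', Complex.ofReal_neg]
    linear_combination (1 / 2 * (B v w : ℂ)) * Complex.I_sq
  have Hreal : ∀ (c : ℝ) v w, H ((c : ℂ) • v) w = (c : ℂ) * H v w := by
    intro c v w
    have : (c : ℂ) • v = c • v := by ext i; simp
    simp only [H, this, map_smul, LinearMap.smul_apply, smul_eq_mul, Complex.ofReal_mul]
    ring
  have Hsmul : ∀ (c : ℂ) v w, H (c • v) w = c * H v w := by
    intro c v w
    conv_lhs => rw [← Complex.re_add_im c]
    rw [add_smul, Hadd, Hreal, mul_smul, Hreal, HI]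
    conv_rhs => rw [← Complex.re_add_im c]
    ring
  have Hadd' : ∀ v w w', H v (w + w') = H v w + H v w' := by
    intro v w w'
    simp only [H, smul_add, map_add, Complex.ofReal_add]
    ring
  have HI' : ∀ v w, H v (Complex.I • w) = -(Complex.I * H v w) := by
    intro v w
    simp only [H, hI, map_neg, Complex.ofReal_neg]
    linear_combination (-1 / 2 * (B v w : ℂ)) * Complex.I_sq
  have Hreal' : ∀ (c : ℝ) v w, H v ((c : ℂ) • w) = (c : ℂ) * H v w := by
    intro c v w
    have h1 : (c : ℂ) • w = c • w := by ext i; simp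
    have h2 : Complex.I • c • w = c • Complex.I • w := smul_comm _ _ _
    simp only [H, h1, h2, map_smul, smul_eq_mul, Complex.ofReal_mul]
    ring
  have Hsmul' : ∀ (c : ℂ) v w, H v w = 0 → H v (c • w) = 0 := by
    intro c v w h
    conv_lhs => rw [← Complex.re_add_im c]
    rw [add_smul, Hadd', Hreal', mul_smul, Hreal', HI', h]
    simp
  have hmetric : ∀ k l, Ω.metric φ x k l = H (Pi.single k 1) (Pi.single l 1) := by
    intro k l
    have hs : ∀ k : Fin m, (Pi.single k Complex.I : Fin m → ℂ) =
        Complex.I • (Pi.single k (1 : ℂ) : Fin m → ℂ) := by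
      intro k
      rw [← Pi.single_smul, smul_eq_mul, mul_one]
    have e : Ω.metric φ x k l = (-Complex.I / 4) *
      ((B (Pi.single k 1) (Pi.single l 1) : ℂ) +
      Complex.I * (B (Pi.single k 1) (Pi.single l Complex.I) : ℂ) -
      Complex.I * (B (Pi.single k Complex.I) (Pi.single l 1) : ℂ) +
      (B (Pi.single k Complex.I) (Pi.single l Complex.I) : ℂ)) := rfl
    rw [e, hs, hs, hJ, hJ']
    simp only [H]
    push_cast
    linear_combination (-1 / 2 *
      (B (Pi.single k 1) (Complex.I • (Pi.single l 1 : Fin m → ℂ)) : ℂ)) * Complex.I_sq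
  have hzero : ∀ (v : Fin m → ℂ), v = ∑ k, v k • (Pi.single k (1 : ℂ) : Fin m → ℂ) := fun v => by
    funext i
    simp [Finset.sum_apply, Pi.single_apply]
  have Hsum : ∀ (s : Finset (Fin m)) (f : Fin m → Fin m → ℂ) w,
      H (∑ k ∈ s, f k) w = ∑ k ∈ s, H (f k) w := by
    intro s f w
    exact map_sum (AddMonoidHom.mk' (fun v => H v w) (fun a b => Hadd a b w)) f s
  have Hsum' : ∀ (s : Finset (Fin m)) (f : Fin m → Fin m → ℂ) v,
      H v (∑ k ∈ s, f k) = ∑ k ∈ s, H v (f k) := by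
    intro s f v
    exact map_sum (AddMonoidHom.mk' (fun w => H v w) (fun a b => Hadd' v a b)) f s
  have Hl : ∀ l, H v (Pi.single l 1) = 0 := by
    intro l
    have := congrFun hv l
    rw [Matrix.vecMul, dotProduct, Pi.zero_apply] at this
    rw [hzero v, Hsum, ← this]
    exact Finset.sum_congr rfl fun k _ => by rw [Hsmul, hmetric]
  have Hw : ∀ w, H v w = 0 := by
    intro w
    rw [hzero w, Hsum']
    exact Finset.sum_eq_zero fun l _ => Hsmul' _ _ _ (Hl l)
  have hBv : ∀ w, B v w = 0 := by
    intro w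
    have := congrArg Complex.im (Hw w)
    simpa [H] using this
  -- transport to the tangent space
  have hbij := φ.mdifferentiable.symm.mfderiv_bijective (x := x) hx
  apply hv0
  apply hbij.1
  refine Eq.trans ?_ (ContinuousLinearMap.map_zero _).symm
  refine Ω.nondegenerate _ _ fun w => ?_
  obtain ⟨w', rfl⟩ := hbij.2 w
  refine Eq.trans ?_ (hBv w')
  exact congrArg (fun z => Ω.form (φ.1.symm x) z) (funext fun i => by fin_cases i <;> rfl)

theorem smooth_isUnit {V : TopologicalSpace.Opens (Fin m → ℂ)} (u : Smooth V)
    (h : ∀ x : V, u x ≠ 0) : IsUnit u := by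
  have hs : ContDiffOn ℝ ∞ (extendZero fun x => (u x)⁻¹) V := by
    refine (ContDiffOn.inv u.2 fun x hx => ?_).congr (fun x hx => ?_)
    · rw [extendZero_of_mem _ hx]
      exact h _
    · rw [extendZero_of_mem _ hx, Pi.inv_apply, extendZero_of_mem _ hx]
  refine IsUnit.of_mul_eq_one (⟨fun x => (u x)⁻¹, hs⟩ : Smooth V) ?_
  exact Smooth.ext fun x => mul_inv_cancel₀ (h x)

theorem isUnit_det_metricTensor (Ω : PseudoKahlerForm m M) (φ : HolChart m M)
    (Φ : Smooth φ.dom) (hΦ : Ω.IsPotential φ Φ) : IsUnit (metricTensor Φ).det := by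
  refine smooth_isUnit _ fun x => ?_
  have : (metricTensor Φ).det x = (Ω.metric φ x).det := by
    rw [← evalAt_apply, RingHom.map_det]
    congr 1
    ext k l
    exact hΦ x k l
  rw [this]
  exact (isUnit_det_metric Ω φ x.2).ne_zero

end RealStructure

/-! ### The star product on a chart and transfer of its global properties. -/

section LocalStar

variable {m : ℕ} {M : Type*} [TopologicalSpace M] [ChartedSpace (Fin m → ℂ) M]

/-- The restriction of functions to a chart, as an additive map. -/
def HolChart.restrictHom (φ : HolChart m M) : SmoothFun m M →+ Smooth φ.dom where
  toFun := φ.restrict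
  map_zero' := rfl
  map_add' _ _ := rfl

theorem HolChart.restrict_sum (φ : HolChart m M) {ι : Type*} (s : Finset ι)
    (f : ι → SmoothFun m M) : φ.restrict (∑ i ∈ s, f i) = ∑ i ∈ s, φ.restrict (f i) :=
  map_sum φ.restrictHom f s

/-- Multiply `u` by a bump function supported in the chart and extend by zero. Hausdorffness of `M`
enters here, through the bump function. -/
theorem exists_germ_extension [T2Space M] [IsManifold 𝓘(ℂ, Fin m → ℂ) ω M] (φ : HolChart m M)
    (u : Smooth φ.dom) (x : φ.dom) : ∃ q : SmoothFun m M, GermEq x (φ.restrict q) u := by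
  have hreal : IsManifold 𝓘(ℝ, Fin m → ℂ) ∞ M := isManifold_real
  have hx : φ.1.symm x ∈ φ.1.source := φ.1.map_target x.2
  obtain ⟨f, -, hf⟩ := (SmoothBumpFunction.nhds_basis_tsupport (I := 𝓘(ℝ, Fin m → ℂ))
    (φ.1.symm x)).mem_iff.1 (φ.1.open_source.mem_nhds hx)
  have hg : ContMDiffOn 𝓘(ℝ, Fin m → ℂ) 𝓘(ℝ, ℂ) ∞ (fun p => extendZero u.1 (φ.1 p))
      φ.1.source :=
    u.2.contMDiffOn.comp (contMDiffOn_of_mem_maximalAtlas φ.mem_maximalAtlas_real)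
      (fun p hp => φ.1.map_source hp)
  have hq : ContMDiff 𝓘(ℝ, Fin m → ℂ) 𝓘(ℝ, ℂ) ∞
      (fun p => f p • extendZero u.1 (φ.1 p)) := by
    refine contMDiff_of_tsupport fun p hp => ?_
    have hp' : p ∈ φ.1.source := hf (tsupport_smul_subset_left _ _ hp)
    exact f.contMDiffAt.smul ((hg p hp').contMDiffAt (φ.1.open_source.mem_nhds hp'))
  refine ⟨⟨_, hq⟩, ?_⟩
  have h1 := (φ.1.continuousAt_symm x.2).eventually f.eventuallyEq_one
  filter_upwards [h1, φ.1.open_target.mem_nhds x.2] with y hy hyt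
  rw [extendZero_of_mem (V := φ.dom) _ hyt]
  change f (φ.1.symm y) • extendZero u.1 (φ.1 (φ.1.symm y)) = _
  rw [hy, φ.1.right_inv hyt, Pi.one_apply, one_smul]

/-- The bidifferential operator with given coefficients. -/
def bidiffOp {V : TopologicalSpace.Opens (Fin m → ℂ)}
    (c : MultiIndex m × MultiIndex m →₀ Smooth V) (u v : Smooth V) : Smooth V :=
  c.sum fun ab coef => coef * partialD ab.1 u * partialD ab.2 v

theorem GermEq.bidiffOp {V : TopologicalSpace.Opens (Fin m → ℂ)}
    (c : MultiIndex m × MultiIndex m →₀ Smooth V) {x : V} {u u' v v' : Smooth V}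
    (h : GermEq x u u') (h' : GermEq x v v') : GermEq x (bidiffOp c u v) (bidiffOp c u' v') :=
  GermEq.sum _ fun _ _ => ((GermEq.refl _ _).mul (h.partialD _)).mul (h'.partialD _)

/-- Coefficients in the chart make `B` local, so the extensions picked by choice may be replaced by
any others. -/
theorem restrictBidiff_eq (φ : HolChart m M) {B : SmoothFun m M → SmoothFun m M → SmoothFun m M}
    {c : MultiIndex m × MultiIndex m →₀ Smooth φ.dom} (hc : IsBidiffCoeff φ B c)
    {u v : Smooth φ.dom} {x : φ.dom} {a b : SmoothFun m M}
    (ha : GermEq x (φ.restrict a) u) (hb : GermEq x (φ.restrict b) v) :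
    restrictBidiff φ B u v x = φ.restrict (B a b) x := by
  have h : ∃ q : SmoothFun m M × SmoothFun m M,
      (φ.restrict q.1).1 =ᶠ[𝓝 x] u.1 ∧ (φ.restrict q.2).1 =ᶠ[𝓝 x] v.1 :=
    ⟨(a, b), germEq_iff.1 ha, germEq_iff.1 hb⟩
  rw [restrictBidiff, dif_pos h]
  have h1 := germEq_iff.2 h.choose_spec.1
  have h2 := germEq_iff.2 h.choose_spec.2
  have h3 : GermEq x (φ.restrict h.choose.1) (φ.restrict a) := h1.trans ha.symm
  have h4 : GermEq x (φ.restrict h.choose.2) (φ.restrict b) := h2.trans hb.symm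
  rw [hc, hc]
  exact (h3.bidiffOp c h4).eval x.2 x.2

/-- The product of formal functions given by a sequence of bidifferential operators. -/
def locStar {V : TopologicalSpace.Opens (Fin m → ℂ)}
    (c : ℕ → MultiIndex m × MultiIndex m →₀ Smooth V) (f g : PowerSeries (Smooth V)) :
    PowerSeries (Smooth V) :=
  PowerSeries.mk fun n => ∑ p ∈ Finset.HasAntidiagonal.antidiagonal n,
    ∑ q ∈ Finset.HasAntidiagonal.antidiagonal p.2,
      bidiffOp (c p.1) (PowerSeries.coeff q.1 f) (PowerSeries.coeff q.2 g)

theorem exists_formal_germ_extension [T2Space M] [IsManifold 𝓘(ℂ, Fin m → ℂ) ω M]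
    (φ : HolChart m M) (u : PowerSeries (Smooth φ.dom)) (x : φ.dom) :
    ∃ q : PowerSeries (SmoothFun m M),
      ∀ n, GermEq x (φ.restrict (PowerSeries.coeff n q)) (PowerSeries.coeff n u) := by
  choose q hq using fun n => exists_germ_extension φ (PowerSeries.coeff n u) x
  exact ⟨PowerSeries.mk q, fun n => by rw [PowerSeries.coeff_mk]; exact hq n⟩

/-- The restriction of a chart to the preimage of a ball. -/
def HolChart.shrink (φ : HolChart m M) (x : Fin m → ℂ) (r : ℝ) : HolChart m M :=
  ⟨φ.1.restr (φ.1.source ∩ φ.1 ⁻¹' Metric.ball x r), restr_mem_maximalAtlas _ φ.2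
    (φ.1.continuousOn.isOpen_inter_preimage φ.1.open_source Metric.isOpen_ball)⟩

theorem HolChart.shrink_source (φ : HolChart m M) (x : Fin m → ℂ) (r : ℝ) :
    (φ.shrink x r).1.source = φ.1.source ∩ φ.1 ⁻¹' Metric.ball x r := by
  rw [HolChart.shrink, OpenPartialHomeomorph.restr_source' _ _
    (φ.1.continuousOn.isOpen_inter_preimage φ.1.open_source Metric.isOpen_ball),
    ← Set.inter_assoc, Set.inter_self]

theorem HolChart.shrink_target (φ : HolChart m M) (x : Fin m → ℂ) (r : ℝ) :
    (φ.shrink x r).1.target = φ.1.target ∩ Metric.ball x r := by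
  rw [← (φ.shrink x r).1.image_source_eq_target, φ.shrink_source]
  exact φ.1.toPartialEquiv.image_source_inter_eq' _ |>.trans (by
    ext y
    constructor
    · rintro ⟨h1, h2⟩
      refine ⟨h1, ?_⟩
      have h3 : φ.1 (φ.1.symm y) ∈ Metric.ball x r := h2
      rwa [φ.1.right_inv h1] at h3
    · rintro ⟨h1, h2⟩
      refine ⟨h1, ?_⟩
      change φ.1 (φ.1.symm y) ∈ Metric.ball x r
      rwa [φ.1.right_inv h1])

/-- Preimages of small balls are contractible charts. They are needed because `IsStandard` says
nothing about other charts. -/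
theorem exists_contractible_shrink (φ : HolChart m M) {x : Fin m → ℂ} (hx : x ∈ φ.1.target) :
    ∃ r, x ∈ (φ.shrink x r).dom ∧ ContractibleSpace (φ.shrink x r).1.source := by
  obtain ⟨r, hr, hball⟩ := Metric.isOpen_iff.1 φ.1.open_target x hx
  have ht : (φ.shrink x r).1.target = Metric.ball x r := by
    rw [φ.shrink_target, Set.inter_eq_right.2 hball]
  refine ⟨r, ?_, ?_⟩
  · change x ∈ (φ.shrink x r).1.target
    rw [ht]
    exact Metric.mem_ball_self hr
  · rw [((φ.shrink x r).1.toHomeomorphSourceTarget.trans (Homeomorph.setCongr ht)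
      ).contractibleSpace_iff]
    exact Metric.contractibleSpace_ball hr

/-- The restriction of a smooth function to a smaller open set. -/
def Smooth.restrictTo {V W : TopologicalSpace.Opens (Fin m → ℂ)} (h : W ≤ V) (u : Smooth V) :
    Smooth W :=
  ⟨fun x => u ⟨x, h x.2⟩, (u.2.mono h).congr fun x hx => by
    rw [extendZero_of_mem _ hx, extendZero_of_mem _ (h hx)]⟩

theorem coeff_zero_C_mul_add_X_mul {R : Type*} [CommRing R] (a : R) (u : PowerSeries R)
    (T : R → R) : PowerSeries.coeff 0 (PowerSeries.C a * u +
      PowerSeries.X * PowerSeries.mk fun n => T (PowerSeries.coeff n u)) =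
        a * PowerSeries.coeff 0 u := by
  rw [map_add, PowerSeries.coeff_C_mul, PowerSeries.coeff_zero_X_mul, add_zero]

theorem coeff_succ_C_mul_add_X_mul {R : Type*} [CommRing R] (a : R) (u : PowerSeries R)
    (T : R → R) (n : ℕ) : PowerSeries.coeff (n + 1) (PowerSeries.C a * u +
      PowerSeries.X * PowerSeries.mk fun n => T (PowerSeries.coeff n u)) =
        a * PowerSeries.coeff (n + 1) u + T (PowerSeries.coeff n u) := by
  rw [map_add, PowerSeries.coeff_C_mul, PowerSeries.coeff_succ_X_mul, PowerSeries.coeff_mk]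

variable {Ω : PseudoKahlerForm m M} (S : StarProduct Ω) {φ : HolChart m M}
  {c : ℕ → MultiIndex m × MultiIndex m →₀ Smooth φ.dom}

/-- The bridge between the global product and `locStar`: identities assumed on `M` are carried to
the chart one point at a time. -/
theorem GermEq.starMul (hc : ∀ r, IsBidiffCoeff φ (S.C r) (c r)) {x : φ.dom}
    {F G : PowerSeries (SmoothFun m M)} {f g : PowerSeries (Smooth φ.dom)}
    (hF : ∀ n, GermEq x (φ.restrict (PowerSeries.coeff n F)) (PowerSeries.coeff n f))
    (hG : ∀ n, GermEq x (φ.restrict (PowerSeries.coeff n G)) (PowerSeries.coeff n g)) (n : ℕ) :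
    GermEq x (φ.restrict (PowerSeries.coeff n (starMul S.C F G)))
      (PowerSeries.coeff n (locStar c f g)) := by
  rw [SepVar.starMul, locStar, PowerSeries.coeff_mk, PowerSeries.coeff_mk, φ.restrict_sum]
  refine GermEq.sum _ fun p _ => ?_
  rw [φ.restrict_sum]
  refine GermEq.sum _ fun q _ => ?_
  rw [hc]
  exact (hF _).bidiffOp _ (hG _)

variable [T2Space M] [IsManifold 𝓘(ℂ, Fin m → ℂ) ω M]

theorem localMul_eq (hc : ∀ r, IsBidiffCoeff φ (S.C r) (c r)) (f g : PowerSeries (Smooth φ.dom)) :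
    S.localMul φ f g = PowerSeries.map (Smooth.toFunHom φ.dom) (locStar c f g) := by
  ext n x
  obtain ⟨F, hF⟩ := exists_formal_germ_extension φ f x
  obtain ⟨G, hG⟩ := exists_formal_germ_extension φ g x
  rw [StarProduct.localMul, locStar, PowerSeries.coeff_map, PowerSeries.coeff_mk,
    PowerSeries.coeff_mk, map_sum, Finset.sum_apply, Finset.sum_apply]
  refine Finset.sum_congr rfl fun p _ => ?_
  rw [map_sum, Finset.sum_apply, Finset.sum_apply]
  refine Finset.sum_congr rfl fun q _ => ?_
  rw [restrictBidiff_eq φ (hc p.1) (hF q.1) (hG q.2), hc]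
  exact ((hF q.1).bidiffOp _ (hG q.2)).eval x.2 x.2

theorem locStar_assoc (hc : ∀ r, IsBidiffCoeff φ (S.C r) (c r))
    (f g h : PowerSeries (Smooth φ.dom)) :
    locStar c (locStar c f g) h = locStar c f (locStar c g h) := by
  ext1 n
  refine Smooth.ext fun x => ?_
  obtain ⟨F, hF⟩ := exists_formal_germ_extension φ f x
  obtain ⟨G, hG⟩ := exists_formal_germ_extension φ g x
  obtain ⟨H, hH⟩ := exists_formal_germ_extension φ h x
  have h1 := GermEq.starMul S hc (GermEq.starMul S hc hF hG) hH n
  have h2 := GermEq.starMul S hc hF (GermEq.starMul S hc hG hH) n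
  rw [S.assoc] at h1
  exact GermEq.eval (h1.symm.trans h2) x.2 x.2

theorem locStar_one (hc : ∀ r, IsBidiffCoeff φ (S.C r) (c r)) (f : PowerSeries (Smooth φ.dom)) :
    locStar c f 1 = f := by
  ext1 n
  refine Smooth.ext fun x => ?_
  obtain ⟨F, hF⟩ := exists_formal_germ_extension φ f x
  have h1 : ∀ n, GermEq x (φ.restrict (PowerSeries.coeff n (1 : PowerSeries (SmoothFun m M))))
      (PowerSeries.coeff n (1 : PowerSeries (Smooth φ.dom))) := by
    intro n
    rw [PowerSeries.coeff_one, PowerSeries.coeff_one]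
    split_ifs
    · exact GermEq.refl _ _
    · exact GermEq.refl _ _
  have h2 := GermEq.starMul S hc hF h1 n
  rw [S.star_one] at h2
  exact GermEq.eval (h2.symm.trans (hF n)) x.2 x.2

/-- Both sides are local, so near `x` the chart may be shrunk to a contractible one, where the
formula is assumed. The products computed in the two charts agree at `x` because both represent the
same global product of extensions. -/
theorem locStar_dzbar_potential (hc : ∀ r, IsBidiffCoeff φ (S.C r) (c r)) (hstd : S.IsStandard)
    {Φ : Smooth φ.dom} (hΦ : Ω.IsPotential φ Φ) (l : Fin m) (u : PowerSeries (Smooth φ.dom)) :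
    locStar c u (PowerSeries.C (dzbar l Φ)) = PowerSeries.C (dzbar l Φ) * u +
      PowerSeries.X * PowerSeries.mk fun n => dzbar l (PowerSeries.coeff n u) := by
  ext1 n
  refine Smooth.ext fun x => ?_
  obtain ⟨r, hx', hcontr⟩ := exists_contractible_shrink φ x.2
  set φ' := φ.shrink x r with hφ'
  have hle : φ'.dom ≤ φ.dom := by
    intro y hy
    have : y ∈ (φ.shrink x r).1.target := hy
    rw [φ.shrink_target] at this
    exact this.1
  let x' : φ'.dom := ⟨x, hx'⟩
  set Φ' : Smooth φ'.dom := Φ.restrictTo hle with hΦ'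
  have hgerm : ∀ y (hy : y ∈ φ'.dom), GermEq y Φ' Φ := fun y hy =>
    germEq_of_forall hy (hle hy) fun _ _ _ => rfl
  have hpot : Ω.IsPotential φ' Φ' := by
    intro y k l
    have := (((hgerm y y.2).dzbar y.2 (hle y.2) l).dz y.2 (hle y.2) k).eval y.2 (hle y.2)
    exact this.trans (hΦ ⟨y, hle y.2⟩ k l)
  obtain ⟨U, hU⟩ := exists_formal_germ_extension φ u x
  obtain ⟨H, hH⟩ := exists_germ_extension φ (dzbar l Φ) x
  have hres : ∀ q : SmoothFun m M, GermEq (x : Fin m → ℂ) (φ'.restrict q) (φ.restrict q) :=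
    fun q => germEq_of_forall hx' x.2 fun _ _ _ => rfl
  have hCH : ∀ n, GermEq x (φ.restrict (PowerSeries.coeff n (PowerSeries.C H)))
      (PowerSeries.coeff n (PowerSeries.C (dzbar l Φ))) := by
    intro n
    rw [PowerSeries.coeff_C, PowerSeries.coeff_C]
    split_ifs
    · exact hH
    · exact GermEq.refl _ _
  have hCH' : ∀ n, GermEq x' (φ'.restrict (PowerSeries.coeff n (PowerSeries.C H)))
      (PowerSeries.coeff n (PowerSeries.C (dzbar l Φ'))) := by
    intro n
    rw [PowerSeries.coeff_C, PowerSeries.coeff_C]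
    split_ifs
    · exact ((hres H).trans hH).trans ((hgerm _ hx').dzbar hx' x.2 l).symm
    · exact GermEq.refl _ _
  set u' : PowerSeries (Smooth φ'.dom) :=
    PowerSeries.mk fun n => φ'.restrict (PowerSeries.coeff n U) with hu'
  have hu : ∀ n, GermEq x' (φ'.restrict (PowerSeries.coeff n U)) (PowerSeries.coeff n u') := by
    intro n
    rw [hu', PowerSeries.coeff_mk]
    exact GermEq.refl _ _
  have hu2 : ∀ n, GermEq x' (PowerSeries.coeff n u') (PowerSeries.coeff n u) := by
    intro n
    exact (hu n).symm.trans ((hres _).trans (hU n))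
  -- No relation between `c'` and `c` is needed: each is compared with the global product only.
  choose c' hc' using fun r => S.bidifferential r φ'
  have hst := hstd φ' hcontr Φ' hpot l u'
  rw [StarProduct.rightMul, localMul_eq S hc'] at hst
  have hst' := congrFun (congrArg (PowerSeries.coeff n) hst) x'
  rw [PowerSeries.coeff_map, PowerSeries.coeff_map] at hst'
  have e1 := (GermEq.starMul S hc hU hCH n).eval x.2 x.2
  have e2 := (GermEq.starMul S hc' hu hCH' n).eval hx' hx'
  have e3 := (hres (PowerSeries.coeff n (starMul S.C U (PowerSeries.C H)))).eval hx' x.2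
  refine e1.symm.trans (e3.symm.trans (e2.trans (hst'.trans ?_)))
  have hd : dzbar l Φ' x' = dzbar l Φ x :=
    ((hgerm _ hx').dzbar hx' x.2 l).eval hx' x.2
  have hv : ∀ n, PowerSeries.coeff n u' x' = PowerSeries.coeff n u x :=
    fun n => (hu2 n).eval hx' x.2
  have hdv : ∀ n, dzbar l (PowerSeries.coeff n u') x' = dzbar l (PowerSeries.coeff n u) x :=
    fun n => ((hu2 n).dzbar hx' x.2 l).eval hx' x.2
  rcases n with _ | n
  · have h0 := coeff_zero_C_mul_add_X_mul (dzbar l Φ) u fun v => dzbar l v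
    have h0' := coeff_zero_C_mul_add_X_mul (dzbar l Φ') u' fun v => dzbar l v
    exact (congrArg (evalAt x') h0').trans
      ((congrArg₂ (· * ·) hd (hv 0)).trans (congrArg (evalAt x) h0).symm)
  · have h0 := coeff_succ_C_mul_add_X_mul (dzbar l Φ) u (fun v => dzbar l v) n
    have h0' := coeff_succ_C_mul_add_X_mul (dzbar l Φ') u' (fun v => dzbar l v) n
    exact (congrArg (evalAt x') h0').trans
      ((congrArg₂ (· + ·) (congrArg₂ (· * ·) hd (hv _)) (hdv n)).trans
        (congrArg (evalAt x) h0).symm)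

end LocalStar

/-! ### Power series of operators on `ℰ`, filtration degrees and convergence. -/

section OperatorSeries

variable {m : ℕ} {V : TopologicalSpace.Opens (Fin m → ℂ)}

theorem ESpace.ext {F G : ESpace V}
    (h : ∀ n, PowerSeries.coeff n F.1 = PowerSeries.coeff n G.1) : F = G :=
  Subtype.ext (PowerSeries.ext h)

/-- The coefficient of `ν^n` as a linear map on `ℰ`. -/
def nuCoeff (n : ℕ) : ESpace V →ₗ[ℂ] MvPolynomial (Fin m) (Smooth V) where
  toFun F := PowerSeries.coeff n F.1
  map_add' F G := by rw [Submodule.coe_add, map_add]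
  map_smul' c F := by rw [Submodule.coe_smul, PowerSeries.coeff_smul, RingHom.id_apply]

theorem ESpace.ext_nuCoeff {F G : ESpace V} (h : ∀ n, nuCoeff n F = nuCoeff n G) : F = G :=
  ESpace.ext h

theorem nuCoeff_opSum (T : ℕ → Module.End ℂ (ESpace V)) (F : ESpace V) (n : ℕ) :
    nuCoeff n (opSum T F) = ∑ r ∈ Finset.range (n + 1), nuCoeff n (T r F) := by
  change PowerSeries.coeff n (PowerSeries.mk fun n =>
    ∑ r ∈ Finset.range (n + 1), PowerSeries.coeff n (T r F).1) = _
  rw [PowerSeries.coeff_mk]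
  rfl

theorem nuCoeff_liftOp (s : ℕ)
    (T : MvPolynomial (Fin m) (Smooth V) →ₗ[ℂ] MvPolynomial (Fin m) (Smooth V))
    (hT : ∀ d P, P ∈ MvPolynomial.restrictTotalDegree (Fin m) (Smooth V) d →
      T P ∈ MvPolynomial.restrictTotalDegree (Fin m) (Smooth V) (d + s)) (F : ESpace V) (n : ℕ) :
    nuCoeff n (liftOp s T hT F) = if s ≤ n then T (nuCoeff (n - s) F) else 0 := by
  change PowerSeries.coeff n (PowerSeries.X ^ s * PowerSeries.mk fun n =>
    T (PowerSeries.coeff n F.1)) = _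
  rw [PowerSeries.coeff_X_pow_mul']
  split_ifs
  · rw [PowerSeries.coeff_mk]
    rfl
  · rfl

theorem nuCoeff_liftOp_zero
    (T : MvPolynomial (Fin m) (Smooth V) →ₗ[ℂ] MvPolynomial (Fin m) (Smooth V))
    (hT : ∀ d P, P ∈ MvPolynomial.restrictTotalDegree (Fin m) (Smooth V) d →
      T P ∈ MvPolynomial.restrictTotalDegree (Fin m) (Smooth V) (d + 0)) (F : ESpace V) (n : ℕ) :
    nuCoeff n (liftOp 0 T hT F) = T (nuCoeff n F) := by
  rw [nuCoeff_liftOp, if_pos (Nat.zero_le n), Nat.sub_zero]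

/-- `F` has no terms of `ν`-degree less than `n`. -/
def NuGE (n : ℕ) (F : ESpace V) : Prop := ∀ j < n, nuCoeff j F = 0

/-- The operator `T` does not lower the `ν`-degree. -/
def NuPreserving (T : Module.End ℂ (ESpace V)) : Prop := ∀ n F, NuGE n F → NuGE n (T F)

theorem NuPreserving.mul {S T : Module.End ℂ (ESpace V)} (hS : NuPreserving S)
    (hT : NuPreserving T) : NuPreserving (S * T) := fun n F hF => hS n _ (hT n F hF)

theorem NuPreserving.one : NuPreserving (1 : Module.End ℂ (ESpace V)) := fun _ _ hF => hF

theorem NuPreserving.pow {T : Module.End ℂ (ESpace V)} (hT : NuPreserving T) (r : ℕ) :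
    NuPreserving (T ^ r) := by
  induction r with
  | zero => exact NuPreserving.one
  | succ r ih => rw [pow_succ]; exact ih.mul hT

theorem NuPreserving.smul {T : Module.End ℂ (ESpace V)} (hT : NuPreserving T) (c : ℂ) :
    NuPreserving (c • T) := fun n F hF j hj => by
  rw [LinearMap.smul_apply, map_smul, hT n F hF j hj, smul_zero]

theorem NuPreserving.neg {T : Module.End ℂ (ESpace V)} (hT : NuPreserving T) :
    NuPreserving (-T) := fun n F hF j hj => by
  rw [LinearMap.neg_apply, map_neg, hT n F hF j hj, neg_zero]

theorem NuPreserving.opSum {T : ℕ → Module.End ℂ (ESpace V)} (hT : ∀ r, NuPreserving (T r)) :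
    NuPreserving (opSum T) := fun n F hF j hj => by
  rw [nuCoeff_opSum]
  exact Finset.sum_eq_zero fun r _ => hT r n F hF j hj

theorem NuPreserving.liftOp (s : ℕ)
    (T : MvPolynomial (Fin m) (Smooth V) →ₗ[ℂ] MvPolynomial (Fin m) (Smooth V))
    (hT : ∀ d P, P ∈ MvPolynomial.restrictTotalDegree (Fin m) (Smooth V) d →
      T P ∈ MvPolynomial.restrictTotalDegree (Fin m) (Smooth V) (d + s)) :
    NuPreserving (liftOp s T hT) := fun n F hF j hj => by
  rw [nuCoeff_liftOp]
  split_ifs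
  · rw [hF _ (lt_of_le_of_lt (Nat.sub_le _ _) hj), map_zero]
  · rfl

/-- Power series in `T` converge `ν`-adically. -/
structure NuNilpotent (T : Module.End ℂ (ESpace V)) : Prop where
  preserving : NuPreserving T
  pow_nuGE : ∀ r F, NuGE r ((T ^ r) F)

theorem nuNilpotent_of_raises {T : Module.End ℂ (ESpace V)}
    (hT : ∀ n F, NuGE n F → NuGE (n + 1) (T F)) : NuNilpotent T where
  preserving n F hF j hj := hT n F hF j (Nat.lt_succ_of_lt hj)
  pow_nuGE r := by
    induction r with
    | zero => exact fun F j hj => absurd hj (Nat.not_lt_zero _)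
    | succ r ih => exact fun F => by rw [pow_succ', Module.End.mul_apply]; exact hT _ _ (ih F)

/-- The value `∑_r p_r T^r` of a power series `p` at an operator `T`. -/
def evalOp (T : Module.End ℂ (ESpace V)) (p : PowerSeries ℂ) : Module.End ℂ (ESpace V) :=
  opSum fun r => PowerSeries.coeff r p • T ^ r

theorem nuCoeff_evalOp (T : Module.End ℂ (ESpace V)) (p : PowerSeries ℂ) (F : ESpace V) (n : ℕ) :
    nuCoeff n (evalOp T p F) =
      ∑ r ∈ Finset.range (n + 1), PowerSeries.coeff r p • nuCoeff n ((T ^ r) F) := by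
  rw [evalOp, nuCoeff_opSum]
  exact Finset.sum_congr rfl fun r _ => by rw [LinearMap.smul_apply, map_smul]

/-- Multiplicativity reduces operator identities, such as `e^T e^{-T} = 1` and the geometric series,
to identities of scalar power series. -/
theorem evalOp_mul {T : Module.End ℂ (ESpace V)} (hT : NuNilpotent T) (p q : PowerSeries ℂ) :
    evalOp T (p * q) = evalOp T p * evalOp T q := by
  refine LinearMap.ext fun F => ESpace.ext_nuCoeff fun n => ?_
  rw [Module.End.mul_apply, nuCoeff_evalOp, nuCoeff_evalOp]
  -- At order `ν^n` the inner series may be replaced by its truncation, since powers of `T` do not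
  -- lower the `ν`-degree of the error.
  have hG : NuGE (n + 1) (evalOp T q F -
      ∑ j ∈ Finset.range (n + 1), PowerSeries.coeff j q • (T ^ j) F) := by
    intro k hk
    rw [map_sub, map_sum, nuCoeff_evalOp, sub_eq_zero]
    simp only [map_smul]
    refine Finset.sum_subset (Finset.range_mono hk) fun r _ hr => ?_
    rw [hT.pow_nuGE r F k (by simpa using hr), smul_zero]
  -- Terms with `i + j > n` vanish at order `ν^n`, which leaves a triangular sum to be regrouped by
  -- `i + j`.
  have hTi : ∀ i, nuCoeff n ((T ^ i) (evalOp T q F)) =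
      ∑ j ∈ Finset.range (n + 1 - i), PowerSeries.coeff j q • nuCoeff n ((T ^ (i + j)) F) := by
    intro i
    have h1 := (hT.preserving.pow i) _ _ hG n (Nat.lt_succ_self n)
    rw [map_sub, map_sub, sub_eq_zero] at h1
    rw [h1, map_sum, map_sum]
    simp only [map_smul, pow_add, Module.End.mul_apply]
    refine (Finset.sum_subset (Finset.range_mono (Nat.sub_le _ _)) fun r _ hr => ?_).symm
    rw [← Module.End.mul_apply, ← pow_add, hT.pow_nuGE (i + r) F n, smul_zero]
    rw [Finset.mem_range] at hr
    omega
  simp only [hTi, Finset.smul_sum]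
  rw [← Finset.sum_range_diag_flip (n + 1) fun i j => PowerSeries.coeff i p •
    PowerSeries.coeff j q • nuCoeff n ((T ^ (i + j)) F)]
  refine Finset.sum_congr rfl fun k _ => ?_
  rw [PowerSeries.coeff_mul, Finset.Nat.sum_antidiagonal_eq_sum_range_succ (fun i j =>
    PowerSeries.coeff i p * PowerSeries.coeff j q), Finset.sum_smul]
  refine Finset.sum_congr rfl fun i hi => ?_
  rw [smul_smul, Nat.add_sub_cancel' (Nat.lt_succ_iff.1 (Finset.mem_range.1 hi))]

theorem evalOp_one (T : Module.End ℂ (ESpace V)) : evalOp T 1 = 1 := by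
  refine LinearMap.ext fun F => ESpace.ext_nuCoeff fun n => ?_
  rw [nuCoeff_evalOp, Finset.sum_range_succ']
  simp [PowerSeries.coeff_one]

theorem evalOp_X {T : Module.End ℂ (ESpace V)} (hT : NuNilpotent T) :
    evalOp T PowerSeries.X = T := by
  refine LinearMap.ext fun F => ESpace.ext_nuCoeff fun n => ?_
  rw [nuCoeff_evalOp]
  simp only [PowerSeries.coeff_X, ite_smul, one_smul, zero_smul, Finset.sum_ite_eq',
    Finset.mem_range, pow_one]
  split_ifs with h
  · rfl
  · have := hT.pow_nuGE 1 F n (by omega)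
    rw [pow_one] at this
    exact this.symm

theorem evalOp_sub (T : Module.End ℂ (ESpace V)) (p q : PowerSeries ℂ) :
    evalOp T (p - q) = evalOp T p - evalOp T q := by
  refine LinearMap.ext fun F => ESpace.ext_nuCoeff fun n => ?_
  rw [LinearMap.sub_apply, map_sub]
  simp only [nuCoeff_evalOp, map_sub, sub_smul, Finset.sum_sub_distrib]

theorem expOp_eq_evalOp (T : Module.End ℂ (ESpace V)) :
    expOp T = evalOp T (PowerSeries.exp ℂ) := by
  rw [expOp, evalOp]
  congr 1
  funext r
  rw [expTerm, PowerSeries.coeff_exp]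
  simp

theorem expOp_neg_eq_evalOp (T : Module.End ℂ (ESpace V)) :
    expOp (-T) = evalOp T (PowerSeries.evalNegHom (PowerSeries.exp ℂ)) := by
  rw [expOp, evalOp]
  congr 1
  funext r
  have h : -T = (-1 : ℂ) • T := LinearMap.ext fun F => (neg_one_smul ℂ (T F)).symm
  rw [expTerm, PowerSeries.evalNegHom, PowerSeries.coeff_rescale, PowerSeries.coeff_exp, h,
    smul_pow, smul_smul]
  congr 1
  simp [mul_comm]

theorem expOp_mul_expOp_neg {T : Module.End ℂ (ESpace V)} (hT : NuNilpotent T) :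
    expOp T * expOp (-T) = 1 := by
  rw [expOp_eq_evalOp, expOp_neg_eq_evalOp, ← evalOp_mul hT, PowerSeries.exp_mul_exp_neg_eq_one,
    evalOp_one]

theorem expOp_neg_mul_expOp {T : Module.End ℂ (ESpace V)} (hT : NuNilpotent T) :
    expOp (-T) * expOp T = 1 := by
  rw [expOp_neg_eq_evalOp, expOp_eq_evalOp, ← evalOp_mul hT, mul_comm,
    PowerSeries.exp_mul_exp_neg_eq_one, evalOp_one]

theorem mul_expOp_comm {T : Module.End ℂ (ESpace V)} (hT : NuNilpotent T) :
    T * expOp T = expOp T * T := by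
  calc T * expOp T = evalOp T PowerSeries.X * evalOp T (PowerSeries.exp ℂ) := by
        rw [evalOp_X hT, expOp_eq_evalOp]
    _ = evalOp T (PowerSeries.exp ℂ) * evalOp T PowerSeries.X := by
        rw [← evalOp_mul hT, ← evalOp_mul hT, mul_comm]
    _ = expOp T * T := by rw [evalOp_X hT, expOp_eq_evalOp]

/-- If `[E, T] = T` then `[E, e^T] = e^T T`. -/
theorem commutator_expOp {T : Module.End ℂ (ESpace V)} (hT : NuNilpotent T)
    (e : MvPolynomial (Fin m) (Smooth V) →ₗ[ℂ] MvPolynomial (Fin m) (Smooth V))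
    (he : ∀ d P, P ∈ MvPolynomial.restrictTotalDegree (Fin m) (Smooth V) d →
      e P ∈ MvPolynomial.restrictTotalDegree (Fin m) (Smooth V) (d + 0))
    (h : liftOp 0 e he * T = T * liftOp 0 e he + T) :
    liftOp 0 e he * expOp T = expOp T * (liftOp 0 e he + T) := by
  set E := liftOp 0 e he with hE
  -- `[E, ·]` is a derivation that fixes `T`, so it multiplies `T^r` by `r`. Summed against `1/r!`
  -- this is `x d/dx e^x = e^x x`.
  have hpow : ∀ r : ℕ, E * T ^ r = T ^ r * E + (r : ℂ) • T ^ r := by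
    intro r
    induction r with
    | zero => simp
    | succ r ih =>
      calc E * T ^ (r + 1) = E * T ^ r * T := by rw [pow_succ, mul_assoc]
        _ = T ^ r * (E * T) + (r : ℂ) • (T ^ r * T) := by
            rw [ih, add_mul, mul_assoc, smul_mul_assoc]
        _ = T ^ (r + 1) * E + ((r + 1 : ℕ) : ℂ) • T ^ (r + 1) := by
            rw [h, mul_add, ← mul_assoc, ← pow_succ]
            push_cast
            module
  have hder : evalOp T (PowerSeries.mk fun r => (r : ℂ) * PowerSeries.coeff r (PowerSeries.exp ℂ)) =
      expOp T * T := by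
    have : (PowerSeries.mk fun r => (r : ℂ) * PowerSeries.coeff r (PowerSeries.exp ℂ)) =
        PowerSeries.exp ℂ * PowerSeries.X := by
      ext r
      rw [PowerSeries.coeff_mk]
      rcases r with _ | r
      · simp
      · rw [PowerSeries.coeff_succ_mul_X, PowerSeries.coeff_exp, PowerSeries.coeff_exp,
          Nat.factorial_succ]
        have h1 : ((r : ℂ) + 1) ≠ 0 := Nat.cast_add_one_ne_zero r
        have h2 : ((r.factorial : ℕ) : ℂ) ≠ 0 := Nat.cast_ne_zero.2 r.factorial_ne_zero
        simp only [one_div, map_inv₀, map_natCast]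
        push_cast
        field_simp
    rw [this, evalOp_mul hT, evalOp_X hT, expOp_eq_evalOp]
  rw [mul_add, ← hder, expOp_eq_evalOp]
  refine LinearMap.ext fun F => ESpace.ext_nuCoeff fun n => ?_
  rw [LinearMap.add_apply, map_add, Module.End.mul_apply, Module.End.mul_apply, hE,
    nuCoeff_liftOp_zero, nuCoeff_evalOp, nuCoeff_evalOp, nuCoeff_evalOp, map_sum,
    ← Finset.sum_add_distrib]
  refine Finset.sum_congr rfl fun r _ => ?_
  -- `E` is a `liftOp 0`, so it acts separately on each coefficient of `ν^n` and can be moved inside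
  -- the finite sum.
  rw [map_smul, ← nuCoeff_liftOp_zero e he, ← hE, ← Module.End.mul_apply, hpow,
    LinearMap.add_apply, LinearMap.smul_apply, map_add, map_smul, smul_add, PowerSeries.coeff_mk,
    smul_smul, mul_comm, Module.End.mul_apply]

/-! ### Filtration degree -/

/-- Subtraction of naturals truncates: for `r < p` the degree bound alone would still allow
constants, hence the separate vanishing clause. -/
theorem mem_Filt_iff {p : ℕ} {F : ESpace V} : F.1 ∈ Filt V p ↔ ∀ r,
    nuCoeff r F ∈ MvPolynomial.restrictTotalDegree (Fin m) (Smooth V) (r - p) ∧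
      (r < p → nuCoeff r F = 0) := by
  have h : ∀ (r d : ℕ), nuCoeff r F ∈ MvPolynomial.restrictTotalDegree (Fin m) (Smooth V) d ↔
      ∀ a, MvPolynomial.coeff a (PowerSeries.coeff r F.1) ≠ 0 → a.degree ≤ d := by
    intro r d
    rw [MvPolynomial.mem_restrictTotalDegree, MvPolynomial.totalDegree, Finset.sup_le_iff]
    refine forall_congr' fun a => ?_
    rw [MvPolynomial.mem_support_iff, Finsupp.degree_eq_sum,
      Finsupp.sum_fintype _ _ (fun _ => rfl)]
    rfl
  constructor
  · intro hF r
    refine ⟨(h _ _).2 fun a ha => Nat.le_sub_of_add_le (hF r a ha), fun hr => ?_⟩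
    refine MvPolynomial.ext _ _ fun a => ?_
    by_contra hne
    have := hF r a (fun h0 => hne (h0.trans (MvPolynomial.coeff_zero a).symm))
    omega
  · intro hF r a ha
    have h1 := (h _ _).1 (hF r).1 a ha
    by_cases hr : r < p
    · refine absurd ?_ ha
      change MvPolynomial.coeff a (nuCoeff r F) = 0
      rw [(hF r).2 hr, MvPolynomial.coeff_zero]
    · omega

theorem Filt_antitone {p q : ℕ} (h : p ≤ q) : Filt V q ≤ Filt V p :=
  fun _ hF r a ha => le_trans (Nat.add_le_add_left h _) (hF r a ha)

/-- The operator `T` raises the filtration degree by at least `s`. -/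
def Raises (s : ℕ) (T : Module.End ℂ (ESpace V)) : Prop :=
  ∀ p F, F.1 ∈ Filt V p → (T F).1 ∈ Filt V (p + s)

theorem Raises.mul {s t : ℕ} {S T : Module.End ℂ (ESpace V)} (hS : Raises s S)
    (hT : Raises t T) : Raises (t + s) (S * T) := fun p F hF => by
  rw [← add_assoc]
  exact hS _ _ (hT p F hF)

theorem Raises.pow {s : ℕ} {T : Module.End ℂ (ESpace V)} (hT : Raises s T) (r : ℕ) :
    Raises (s * r) (T ^ r) := by
  induction r with
  | zero => exact fun p F hF => hF
  | succ r ih => rw [pow_succ', mul_add, mul_one]; exact hT.mul ih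

theorem Raises.smul {s : ℕ} {T : Module.End ℂ (ESpace V)} (hT : Raises s T) (c : ℂ) :
    Raises s (c • T) := fun p F hF => (Filt V (p + s)).smul_mem c (hT p F hF)

theorem Raises.neg {s : ℕ} {T : Module.End ℂ (ESpace V)} (hT : Raises s T) :
    Raises s (-T) := fun p F hF => (Filt V (p + s)).neg_mem (hT p F hF)

theorem Raises.opSum {s : ℕ} {T : ℕ → Module.End ℂ (ESpace V)} (hT : ∀ r, Raises s (T r)) :
    Raises s (opSum T) := fun p F hF => by
  rw [mem_Filt_iff]
  intro n
  rw [nuCoeff_opSum]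
  refine ⟨Submodule.sum_mem _ fun r _ => (mem_Filt_iff.1 (hT r p F hF) n).1, fun hn => ?_⟩
  exact Finset.sum_eq_zero fun r _ => (mem_Filt_iff.1 (hT r p F hF) n).2 hn

theorem Raises.liftOp {s k : ℕ}
    {T : MvPolynomial (Fin m) (Smooth V) →ₗ[ℂ] MvPolynomial (Fin m) (Smooth V)}
    (hT : ∀ d P, P ∈ MvPolynomial.restrictTotalDegree (Fin m) (Smooth V) d →
      T P ∈ MvPolynomial.restrictTotalDegree (Fin m) (Smooth V) (d + s))
    (h : ∀ d P, P ∈ MvPolynomial.restrictTotalDegree (Fin m) (Smooth V) d →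
      T P ∈ MvPolynomial.restrictTotalDegree (Fin m) (Smooth V) (d + s - k) ∧
      (d + s < k → T P = 0)) : Raises k (liftOp s T hT) := fun p F hF => by
  rw [mem_Filt_iff]
  intro n
  rw [nuCoeff_liftOp]
  split_ifs with hs
  · obtain ⟨h1, h2⟩ := mem_Filt_iff.1 hF (n - s)
    by_cases hn : n - s < p
    · rw [h2 hn, map_zero]
      exact ⟨Submodule.zero_mem _, fun _ => rfl⟩
    · obtain ⟨h3, h4⟩ := h _ _ h1
      have : n - s - p + s - k = n - (p + k) := by omega
      rw [this] at h3
      exact ⟨h3, fun hlt => h4 (by omega)⟩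
  · exact ⟨Submodule.zero_mem _, fun _ => rfl⟩

/-! ### Convergence of series of operators -/

theorem convergesNu_opSum {T : ℕ → Module.End ℂ (ESpace V)} (hT : ∀ r F, NuGE r (T r F)) :
    ConvergesNu T (opSum T) := by
  intro F n
  refine ⟨n + 1, fun N hN => ?_⟩
  change nuCoeff n (∑ r ∈ Finset.range N, T r F) = nuCoeff n (opSum T F)
  rw [map_sum, nuCoeff_opSum]
  refine (Finset.sum_subset (Finset.range_mono hN) fun r _ hr => ?_).symm
  exact hT r F n (by simpa using hr)

/-- The first hypothesis makes each coefficient of the remainder a finite sum, the second places its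
terms in the filtration. The index `r - 1` is the one that fits `Γ_r`. -/
theorem convergesFilt_opSum {T : ℕ → Module.End ℂ (ESpace V)} (hT : ∀ r F, NuGE r (T r F))
    (hT' : ∀ r F, (T r F).1 ∈ Filt V (r - 1)) : ConvergesFilt T (opSum T) := by
  intro F p
  -- Terms with `r ≥ p + 1` lie in `ℰ_{r-1} ⊆ ℰ_p`.
  refine ⟨p + 1, fun N hN => ?_⟩
  rw [mem_Filt_iff]
  intro n
  have hK : nuCoeff n (opSum T F - ∑ r ∈ Finset.range N, T r F) =
      ∑ r ∈ Finset.Ico N (max N (n + 1)), nuCoeff n (T r F) := by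
    rw [map_sub, map_sum, nuCoeff_opSum, Finset.sum_Ico_eq_sub _ (le_max_left _ _)]
    congr 1
    refine Finset.sum_subset (Finset.range_mono (le_max_right _ _)) fun r _ hr => ?_
    exact hT r F n (by simpa using hr)
  have hr : ∀ r ∈ Finset.Ico N (max N (n + 1)), (T r F).1 ∈ Filt V p := fun r hr =>
    Filt_antitone (by have := (Finset.mem_Ico.1 hr).1; omega) (hT' r F)
  rw [hK]
  exact ⟨Submodule.sum_mem _ fun r h => (mem_Filt_iff.1 (hr r h) n).1,
    fun hn => Finset.sum_eq_zero fun r h => (mem_Filt_iff.1 (hr r h) n).2 hn⟩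

theorem nuGE_of_mem_Filt {p : ℕ} {F : ESpace V} (hF : F.1 ∈ Filt V p) : NuGE p F :=
  fun j hj => (mem_Filt_iff.1 hF j).2 hj

/-- `T^r` maps into `ℰ_r`, whose elements start at `ν^r` because `ζ`-degrees are nonnegative. -/
theorem Raises.nuNilpotent {T : Module.End ℂ (ESpace V)} (hT : Raises 1 T)
    (hp : NuPreserving T) : NuNilpotent T where
  preserving := hp
  pow_nuGE r F := by
    have := hT.pow r 0 F F.2
    rw [one_mul, zero_add] at this
    exact nuGE_of_mem_Filt this

/-- The geometric series. -/
theorem Raises.geometric {T : Module.End ℂ (ESpace V)} (hT : Raises 1 T) (hp : NuPreserving T) :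
    IsUnit (1 - T) ∧ ConvergesFilt (fun r => T ^ r) (Ring.inverse (1 - T)) := by
  have hN := hT.nuNilpotent hp
  have h1 : evalOp T (1 - PowerSeries.X) = 1 - T := by
    rw [evalOp_sub, evalOp_one, evalOp_X hN]
  have h2 : evalOp T (PowerSeries.mk 1) * (1 - T) = 1 := by
    rw [← h1, ← evalOp_mul hN, PowerSeries.mk_one_mul_one_sub_eq_one, evalOp_one]
  have h3 : (1 - T) * evalOp T (PowerSeries.mk 1) = 1 := by
    rw [← h1, ← evalOp_mul hN, mul_comm, PowerSeries.mk_one_mul_one_sub_eq_one, evalOp_one]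
  have h4 : Ring.inverse (1 - T) = evalOp T (PowerSeries.mk 1) :=
    Ring.inverse_unit (⟨1 - T, _, h3, h2⟩ : (Module.End ℂ (ESpace V))ˣ)
  have h5 : evalOp T (PowerSeries.mk 1) = SepVar.opSum fun r => T ^ r := by
    simp [evalOp]
  refine ⟨⟨⟨1 - T, _, h3, h2⟩, rfl⟩, ?_⟩
  rw [h4, h5]
  refine convergesFilt_opSum hN.pow_nuGE fun r F => ?_
  have := hT.pow r 0 F F.2
  rw [one_mul, zero_add] at this
  exact Filt_antitone (Nat.sub_le _ _) this

end OperatorSeries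

/-! ### The operators of the formula and the solution of the symbol equation. -/

section SymbolEquation

variable {m : ℕ} {V : TopologicalSpace.Opens (Fin m → ℂ)}

/-! ### The operators `Γ_r` and `D` -/

theorem restrictTotalDegree_mono {d d' : ℕ} (h : d ≤ d') {P : MvPolynomial (Fin m) (Smooth V)}
    (hP : P ∈ MvPolynomial.restrictTotalDegree (Fin m) (Smooth V) d) :
    P ∈ MvPolynomial.restrictTotalDegree (Fin m) (Smooth V) d' := by
  rw [MvPolynomial.mem_restrictTotalDegree] at hP ⊢
  exact hP.trans h

theorem mem_restrictTotalDegree_iff_coeff {d : ℕ} {P : MvPolynomial (Fin m) (Smooth V)} :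
    P ∈ MvPolynomial.restrictTotalDegree (Fin m) (Smooth V) d ↔
      ∀ a : Fin m →₀ ℕ, d < a.degree → P.coeff a = 0 := by
  rw [MvPolynomial.mem_restrictTotalDegree, MvPolynomial.totalDegree, Finset.sup_le_iff]
  refine forall_congr' fun a => ?_
  rw [MvPolynomial.mem_support_iff, Finsupp.degree_eq_sum,
    Finsupp.sum_fintype _ _ (fun _ => rfl), ← not_imp_not, not_le, not_not]

theorem fibreDeriv_succ {r : ℕ} (κ : Fin (r + 1) → Fin m) (P : MvPolynomial (Fin m) (Smooth V)) :
    fibreDeriv κ P = MvPolynomial.pderiv (κ 0) (fibreDeriv (fun i => κ i.succ) P) := by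
  rw [fibreDeriv, List.ofFn_succ, List.prod_cons]
  rfl

theorem fibreDeriv_eq_zero {r : ℕ} (κ : Fin r → Fin m) {d : ℕ} (hd : d < r)
    {P : MvPolynomial (Fin m) (Smooth V)}
    (hP : P ∈ MvPolynomial.restrictTotalDegree (Fin m) (Smooth V) d) : fibreDeriv κ P = 0 := by
  induction r with
  | zero => exact absurd hd (Nat.not_lt_zero _)
  | succ r ih =>
    rw [fibreDeriv_succ]
    have h := fibreDeriv_mem (fun i => κ i.succ) d P hP
    rw [Nat.sub_eq_zero_of_le (Nat.lt_succ_iff.1 hd), MvPolynomial.mem_restrictTotalDegree,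
      Nat.le_zero, MvPolynomial.totalDegree_eq_zero_iff_eq_C] at h
    rw [h, MvPolynomial.pderiv_C]

/-- There are `r + 1` derivatives against one factor `ζ_k`: a net loss of `r` degrees, and zero once
the derivatives outnumber the degree. -/
theorem gammaPoly_mem_sub (Φ : Smooth V) (r : ℕ) {d : ℕ} {P : MvPolynomial (Fin m) (Smooth V)}
    (hP : P ∈ MvPolynomial.restrictTotalDegree (Fin m) (Smooth V) d) :
    gammaPoly Φ (r + 1) P ∈ MvPolynomial.restrictTotalDegree (Fin m) (Smooth V) (d - r) ∧
      (d < r + 1 → gammaPoly Φ (r + 1) P = 0) := by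
  have h0 : d < r + 1 → gammaPoly Φ (r + 1) P = 0 := by
    intro hd
    simp only [gammaPoly, LinearMap.sum_apply, LinearMap.comp_apply]
    refine Finset.sum_eq_zero fun κ _ => Finset.sum_eq_zero fun l _ =>
      Finset.sum_eq_zero fun k _ => ?_
    rw [LinearMap.restrictScalars_apply, fibreDeriv_eq_zero κ hd hP, map_zero]
  refine ⟨?_, h0⟩
  by_cases hd : d < r + 1
  · rw [h0 hd]
    exact Submodule.zero_mem _
  simp only [gammaPoly, LinearMap.sum_apply, LinearMap.comp_apply]
  refine Submodule.sum_mem _ fun κ _ => Submodule.sum_mem _ fun l _ =>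
    Submodule.sum_mem _ fun k _ => ?_
  have h := mulZeta_mem (gTensor Φ κ l * (metricTensor Φ)⁻¹ l k) k _ _ (fibreDeriv_mem κ d P hP)
  exact restrictTotalDegree_mono (by omega) h

theorem coeff_zero_mulZeta (c : Smooth V) (k : Fin m) (P : MvPolynomial (Fin m) (Smooth V)) :
    MvPolynomial.coeff 0 (mulZeta c k P) = 0 := by
  rw [mulZeta, LinearMap.mulLeft_apply, mul_assoc, MvPolynomial.coeff_C_mul,
    MvPolynomial.coeff_X_mul']
  simp

theorem coeff_zero_gammaPoly (Φ : Smooth V) (r : ℕ) (P : MvPolynomial (Fin m) (Smooth V)) :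
    MvPolynomial.coeff 0 (gammaPoly Φ r P) = 0 := by
  simp only [gammaPoly, LinearMap.sum_apply, LinearMap.comp_apply, MvPolynomial.coeff_sum,
    coeff_zero_mulZeta, Finset.sum_const_zero]

theorem coeff_zero_dPoly (Φ : Smooth V) (P : MvPolynomial (Fin m) (Smooth V)) :
    MvPolynomial.coeff 0 (dPoly Φ P) = 0 := by
  simp only [dPoly, LinearMap.sum_apply, LinearMap.comp_apply, MvPolynomial.coeff_sum,
    coeff_zero_mulZeta, Finset.sum_const_zero]

/-- `Γ_r` is the Taylor term of `h = ∂Φ/∂z̄^l` contracted with `g^{l̄ k} ζ_k`. This links it to the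
composition formula. -/
theorem gammaPoly_eq_sum_jetOp (Φ : Smooth V) (r : ℕ) (P : MvPolynomial (Fin m) (Smooth V)) :
    gammaPoly Φ r P = ∑ l, ∑ k, mulZeta ((metricTensor Φ)⁻¹ l k) k (jetOp r (dzbar l Φ) P) := by
  simp only [gammaPoly, LinearMap.sum_apply, LinearMap.comp_apply, jetOp, map_sum]
  rw [Finset.sum_comm]
  refine Finset.sum_congr rfl fun l _ => ?_
  rw [Finset.sum_comm]
  refine Finset.sum_congr rfl fun k _ => Finset.sum_congr rfl fun κ _ => ?_
  rw [LinearMap.smul_apply, LinearMap.restrictScalars_apply, mulZeta, mulZeta,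
    LinearMap.mulLeft_apply, LinearMap.mulLeft_apply, MvPolynomial.smul_eq_C_mul, gTensor, map_mul]
  ring

/-- The contraction `g_{j l̄} g^{l̄ k} = δ_j^k` leaves the Euler operator. -/
theorem gammaPoly_one (Φ : Smooth V) (hdet : IsUnit (metricTensor Φ).det)
    (P : MvPolynomial (Fin m) (Smooth V)) :
    gammaPoly Φ 1 P = ∑ j, MvPolynomial.X j * MvPolynomial.pderiv j P := by
  have hmul := Matrix.mul_nonsing_inv (metricTensor Φ) hdet
  have key : ∀ j k, ∑ l, metricTensor Φ j l * (metricTensor Φ)⁻¹ l k =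
      if j = k then 1 else 0 := by
    intro j k
    rw [← Matrix.mul_apply, hmul, Matrix.one_apply]
  calc gammaPoly Φ 1 P
      = ∑ l, ∑ k, ∑ j, MvPolynomial.C (metricTensor Φ j l * (metricTensor Φ)⁻¹ l k) *
          (MvPolynomial.X k * MvPolynomial.pderiv j P) := by
        rw [gammaPoly_eq_sum_jetOp]
        refine Finset.sum_congr rfl fun l _ => Finset.sum_congr rfl fun k _ => ?_
        rw [jetOp_succ, map_sum]
        refine Finset.sum_congr rfl fun j _ => ?_
        rw [jetOp_zero, mulZeta, LinearMap.mulLeft_apply, MvPolynomial.smul_eq_C_mul, map_mul]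
        change _ = MvPolynomial.C (dz j (dzbar l Φ)) * _ * _
        ring
    _ = ∑ j, ∑ k, MvPolynomial.C (∑ l, metricTensor Φ j l * (metricTensor Φ)⁻¹ l k) *
          (MvPolynomial.X k * MvPolynomial.pderiv j P) := by
        simp only [map_sum, Finset.sum_mul]
        rw [Finset.sum_comm]
        conv_lhs => enter [2, k]; rw [Finset.sum_comm]
        rw [Finset.sum_comm]
    _ = ∑ j, MvPolynomial.X j * MvPolynomial.pderiv j P := by
        refine Finset.sum_congr rfl fun j _ => ?_
        rw [Finset.sum_eq_single j]
        · rw [key, if_pos rfl, map_one, one_mul]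
        · intro k _ hk
          rw [key, if_neg hk.symm, map_zero, zero_mul]
        · intro h
          exact absurd (Finset.mem_univ j) h

theorem coeff_X_mul_pderiv (j : Fin m) (P : MvPolynomial (Fin m) (Smooth V)) (a : Fin m →₀ ℕ) :
    MvPolynomial.coeff a (MvPolynomial.X j * MvPolynomial.pderiv j P) =
      (a j : Smooth V) * P.coeff a := by
  rw [MvPolynomial.coeff_X_mul']
  split_ifs with h
  · have h1 : a j ≠ 0 := Finsupp.mem_support_iff.1 h
    have h2 : a - Finsupp.single j 1 + Finsupp.single j 1 = a :=
      tsub_add_cancel_of_le (Finsupp.single_le_iff.2 (Nat.one_le_iff_ne_zero.2 h1))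
    rw [MvPolynomial.coeff_pderiv, h2, mul_comm]
    congr 1
    have h3 : (a - Finsupp.single j 1 : Fin m →₀ ℕ) j + 1 = a j := by
      simp
      omega
    exact_mod_cast congrArg (Nat.cast : ℕ → Smooth V) h3
  · rw [Finsupp.notMem_support_iff.1 h, Nat.cast_zero, zero_mul]

theorem coeff_gammaPoly_one (Φ : Smooth V) (hdet : IsUnit (metricTensor Φ).det)
    (P : MvPolynomial (Fin m) (Smooth V)) (a : Fin m →₀ ℕ) :
    MvPolynomial.coeff a (gammaPoly Φ 1 P) = (a.degree : ℂ) • P.coeff a := by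
  rw [gammaPoly_one Φ hdet, MvPolynomial.coeff_sum]
  simp only [coeff_X_mul_pderiv]
  rw [← Finset.sum_mul, Finsupp.degree_eq_sum, Algebra.smul_def, map_natCast, Nat.cast_sum]

theorem coeff_mulZeta (c : Smooth V) (k : Fin m) (P : MvPolynomial (Fin m) (Smooth V))
    (a : Fin m →₀ ℕ) : MvPolynomial.coeff a (mulZeta c k P) =
      c * if k ∈ a.support then P.coeff (a - Finsupp.single k 1) else 0 := by
  rw [mulZeta, LinearMap.mulLeft_apply, mul_assoc, MvPolynomial.coeff_C_mul,
    MvPolynomial.coeff_X_mul']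

/-- `Γ_1` multiplies by the `ζ`-degree, and the operator of `D` raises that degree by one. -/
theorem gammaPoly_one_dPoly (Φ : Smooth V) (hdet : IsUnit (metricTensor Φ).det)
    (P : MvPolynomial (Fin m) (Smooth V)) :
    gammaPoly Φ 1 (dPoly Φ P) = dPoly Φ (gammaPoly Φ 1 P) + dPoly Φ P := by
  refine MvPolynomial.ext _ _ fun a => ?_
  rw [coeff_gammaPoly_one Φ hdet, MvPolynomial.coeff_add]
  simp only [dPoly, LinearMap.sum_apply, LinearMap.comp_apply, MvPolynomial.coeff_sum,
    coeff_mulZeta, coeff_mapCoeffs, coeff_gammaPoly_one Φ hdet, Finset.smul_sum,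
    ← Finset.sum_add_distrib]
  refine Finset.sum_congr rfl fun l _ => Finset.sum_congr rfl fun k _ => ?_
  split_ifs with h
  · have h1 : a k ≠ 0 := Finsupp.mem_support_iff.1 h
    have h2 : a - Finsupp.single k 1 + Finsupp.single k 1 = a :=
      tsub_add_cancel_of_le (Finsupp.single_le_iff.2 (Nat.one_le_iff_ne_zero.2 h1))
    have h3 : a.degree = (a - Finsupp.single k 1).degree + 1 := by
      conv_lhs => rw [← h2]
      rw [map_add, Finsupp.degree_single]
    rw [h3, map_smul, mul_smul_comm, Nat.cast_add, Nat.cast_one, add_smul, one_smul]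
  · simp

theorem nuCoeff_Gam (Φ : Smooth V) (r n : ℕ) (F : ESpace V) :
    nuCoeff n (Gam Φ (r + 1) F) = gammaPoly Φ (r + 1) (nuCoeff n F) :=
  nuCoeff_liftOp_zero _ (gammaPoly_mem Φ r) F n

theorem nuCoeff_DOp_succ (Φ : Smooth V) (n : ℕ) (F : ESpace V) :
    nuCoeff (n + 1) (DOp Φ F) = dPoly Φ (nuCoeff n F) := by
  rw [DOp, nuCoeff_liftOp, if_pos (Nat.le_add_left 1 n), Nat.add_sub_cancel]

theorem nuCoeff_DOp_zero (Φ : Smooth V) (F : ESpace V) : nuCoeff 0 (DOp Φ F) = 0 := by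
  rw [DOp, nuCoeff_liftOp, if_neg (by omega)]

theorem Gam_one_mul_DOp (Φ : Smooth V) (hdet : IsUnit (metricTensor Φ).det) :
    Gam Φ 1 * DOp Φ = DOp Φ * Gam Φ 1 + DOp Φ := by
  refine LinearMap.ext fun F => ESpace.ext_nuCoeff fun n => ?_
  rw [Module.End.mul_apply, nuCoeff_Gam, LinearMap.add_apply, map_add, Module.End.mul_apply]
  rcases n with _ | n
  · simp only [nuCoeff_DOp_zero, map_zero, add_zero]
  · simp only [nuCoeff_DOp_succ, nuCoeff_Gam]
    exact gammaPoly_one_dPoly Φ hdet _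

/-- Convergence of `e^D` rests on the factor `ν` alone. In the filtration degree `ν` and `ζ_k`
cancel, and `raises_DOp` gives no gain. -/
theorem nuNilpotent_DOp (Φ : Smooth V) : NuNilpotent (DOp Φ) :=
  nuNilpotent_of_raises fun n F hF j hj => by
    rcases j with _ | j
    · exact nuCoeff_DOp_zero Φ F
    · rw [nuCoeff_DOp_succ, hF j (by omega), map_zero]

theorem nuGE_neg {n : ℕ} {F : ESpace V} (hF : NuGE n F) : NuGE n (-F) := fun j hj => by
  rw [map_neg, hF j hj, neg_zero]

theorem nuNilpotent_neg_DOp (Φ : Smooth V) : NuNilpotent (-DOp Φ) :=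
  nuNilpotent_of_raises fun n F hF => nuGE_neg fun j hj => by
    rcases j with _ | j
    · exact nuCoeff_DOp_zero Φ F
    · rw [nuCoeff_DOp_succ, hF j (by omega), map_zero]

theorem NuNilpotent.nuGE_expTerm {T : Module.End ℂ (ESpace V)} (hT : NuNilpotent T) (r : ℕ)
    (F : ESpace V) : NuGE r (expTerm T r F) := fun j hj => by
  rw [expTerm, LinearMap.smul_apply, map_smul, hT.pow_nuGE r F j hj, smul_zero]

theorem NuNilpotent.convergesNu_expOp {T : Module.End ℂ (ESpace V)} (hT : NuNilpotent T) :
    ConvergesNu (expTerm T) (expOp T) :=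
  convergesNu_opSum hT.nuGE_expTerm

theorem NuNilpotent.preserving_expOp {T : Module.End ℂ (ESpace V)} (hT : NuNilpotent T) :
    NuPreserving (expOp T) :=
  NuPreserving.opSum fun r => (hT.preserving.pow r).smul _

theorem Raises.expOp {T : Module.End ℂ (ESpace V)} (hT : Raises 0 T) : Raises 0 (expOp T) :=
  Raises.opSum fun r => by
    have := hT.pow r
    rw [zero_mul] at this
    exact this.smul _

theorem raises_DOp (Φ : Smooth V) : Raises 0 (DOp Φ) :=
  Raises.liftOp _ fun d P hP => ⟨dPoly_mem Φ d P hP, fun h => absurd h (Nat.not_lt_zero _)⟩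

theorem raises_Gam (Φ : Smooth V) (r : ℕ) : Raises r (Gam Φ (r + 1)) :=
  Raises.liftOp (gammaPoly_mem Φ r) fun d P hP => ⟨(gammaPoly_mem_sub Φ r hP).1, fun h =>
    (gammaPoly_mem_sub Φ r hP).2 (by omega)⟩

theorem raises_GamOneInv : Raises 0 (GamOneInv V) :=
  Raises.liftOp _ fun d P hP => ⟨mapCoeffs_mem _ d P hP, fun h => absurd h (Nat.not_lt_zero _)⟩

theorem raises_zero_operator (s : ℕ) : Raises s (0 : Module.End ℂ (ESpace V)) :=
  fun p _ _ => (Filt V (p + s)).zero_mem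

theorem Raises.mono {s t : ℕ} (h : s ≤ t) {T : Module.End ℂ (ESpace V)} (hT : Raises t T) :
    Raises s T := fun p F hF => Filt_antitone (Nat.add_le_add_left h p) (hT p F hF)

theorem raises_higherTerm (Φ : Smooth V) (r : ℕ) : Raises (r - 1) (higherTerm Φ r) := by
  rw [higherTerm]
  split_ifs with h
  · obtain ⟨r, rfl⟩ := Nat.exists_eq_succ_of_ne_zero (by omega : r ≠ 0)
    exact (raises_Gam Φ r).smul _
  · exact raises_zero_operator _

theorem raises_one_higherTerm (Φ : Smooth V) (r : ℕ) : Raises 1 (higherTerm Φ r) := by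
  by_cases h : 2 ≤ r
  · exact (raises_higherTerm Φ r).mono (by omega)
  · rw [higherTerm, if_neg h]
    exact raises_zero_operator _

theorem nuPreserving_Gam (Φ : Smooth V) (r : ℕ) : NuPreserving (Gam Φ (r + 1)) :=
  NuPreserving.liftOp _ _ (gammaPoly_mem Φ r)

theorem nuPreserving_higherTerm (Φ : Smooth V) (r : ℕ) : NuPreserving (higherTerm Φ r) := by
  rw [higherTerm]
  split_ifs with h
  · obtain ⟨r, rfl⟩ := Nat.exists_eq_succ_of_ne_zero (by omega : r ≠ 0)
    exact (nuPreserving_Gam Φ r).smul _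
  · exact fun n F _ j _ => map_zero _

theorem nuCoeff_mem (F : ESpace V) (n : ℕ) :
    nuCoeff n F ∈ MvPolynomial.restrictTotalDegree (Fin m) (Smooth V) n :=
  (mem_ESpace_iff F.1).1 F.2 n

/-- In `ℰ` the coefficient of `ν^j` has `ζ`-degree at most `j`, so `r > j` derivatives annihilate
it. -/
theorem nuGE_higherTerm (Φ : Smooth V) (r : ℕ) (F : ESpace V) : NuGE r (higherTerm Φ r F) := by
  intro j hj
  rw [higherTerm]
  split_ifs with h
  · obtain ⟨r, rfl⟩ := Nat.exists_eq_succ_of_ne_zero (by omega : r ≠ 0)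
    rw [LinearMap.smul_apply, map_smul, nuCoeff_Gam,
      (gammaPoly_mem_sub Φ r (nuCoeff_mem F j)).2 hj, smul_zero]
  · exact map_zero _

theorem convergesFilt_higherTerm (Φ : Smooth V) :
    ConvergesFilt (higherTerm Φ) (opSum (higherTerm Φ)) :=
  convergesFilt_opSum (nuGE_higherTerm Φ) fun r F => by
    have := raises_higherTerm Φ r 0 F F.2
    rwa [zero_add] at this

/-- `e^{±D}` preserve the filtration, and `Γ_r` gains `r - 1 ≥ 1` for `r ≥ 2`. -/
theorem raises_QOp (Φ : Smooth V) : Raises 1 (QOp Φ) := by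
  have h := ((raises_DOp Φ).neg.expOp.mul
    (Raises.opSum (raises_one_higherTerm Φ))).mul (raises_DOp Φ).expOp
  exact h.neg

theorem nuPreserving_QOp (Φ : Smooth V) : NuPreserving (QOp Φ) :=
  (((nuNilpotent_neg_DOp Φ).preserving_expOp.mul
    (NuPreserving.opSum (nuPreserving_higherTerm Φ))).mul
      (nuNilpotent_DOp Φ).preserving_expOp).neg

theorem raises_GamOneInv_mul_QOp (Φ : Smooth V) : Raises 1 (GamOneInv V * QOp Φ) :=
  raises_GamOneInv.mul (raises_QOp Φ)

theorem nuPreserving_GamOneInv_mul_QOp (Φ : Smooth V) : NuPreserving (GamOneInv V * QOp Φ) :=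
  NuPreserving.mul (NuPreserving.liftOp _ _ _) (nuPreserving_QOp Φ)

/-! ### The restriction to `ζ = 0` -/

theorem mem_ESpaceTwo_iff {F : ESpace V} :
    F ∈ ESpaceTwo V ↔ ∀ n, MvPolynomial.coeff 0 (nuCoeff n F) = 0 := Iff.rfl

theorem DOp_mem_ESpaceTwo (Φ : Smooth V) (F : ESpace V) : DOp Φ F ∈ ESpaceTwo V := by
  rw [mem_ESpaceTwo_iff]
  intro n
  rcases n with _ | n
  · rw [nuCoeff_DOp_zero, MvPolynomial.coeff_zero]
  · rw [nuCoeff_DOp_succ, coeff_zero_dPoly]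

theorem Gam_mem_ESpaceTwo (Φ : Smooth V) (r : ℕ) (F : ESpace V) :
    Gam Φ (r + 1) F ∈ ESpaceTwo V := by
  rw [mem_ESpaceTwo_iff]
  intro n
  rw [nuCoeff_Gam, coeff_zero_gammaPoly]

theorem opSum_mem_ESpaceTwo {T : ℕ → Module.End ℂ (ESpace V)} {F : ESpace V}
    (h : ∀ r, T r F ∈ ESpaceTwo V) : opSum T F ∈ ESpaceTwo V := by
  rw [mem_ESpaceTwo_iff]
  intro n
  rw [nuCoeff_opSum, MvPolynomial.coeff_sum]
  exact Finset.sum_eq_zero fun r _ => h r n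

theorem opSum_higherTerm_mem_ESpaceTwo (Φ : Smooth V) (F : ESpace V) :
    opSum (higherTerm Φ) F ∈ ESpaceTwo V := by
  refine opSum_mem_ESpaceTwo fun r => ?_
  rw [higherTerm]
  split_ifs with h
  · obtain ⟨r, rfl⟩ := Nat.exists_eq_succ_of_ne_zero (by omega : r ≠ 0)
    exact (ESpaceTwo V).smul_mem _ (Gam_mem_ESpaceTwo Φ r F)
  · exact (ESpaceTwo V).zero_mem

theorem coeff_zero_nuCoeff_expOp {T : Module.End ℂ (ESpace V)} (hT : ∀ F, T F ∈ ESpaceTwo V)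
    (F : ESpace V) (n : ℕ) :
    MvPolynomial.coeff 0 (nuCoeff n (expOp T F)) = MvPolynomial.coeff 0 (nuCoeff n F) := by
  rw [expOp, nuCoeff_opSum, MvPolynomial.coeff_sum, Finset.sum_range_succ', Finset.sum_eq_zero,
    zero_add]
  · simp [expTerm]
  · intro r _
    rw [expTerm, pow_succ', LinearMap.smul_apply, Module.End.mul_apply]
    exact (ESpaceTwo V).smul_mem _ (hT _) n

theorem QOp_mem_ESpaceTwo (Φ : Smooth V) (F : ESpace V) : QOp Φ F ∈ ESpaceTwo V := by
  refine (ESpaceTwo V).neg_mem ?_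
  rw [mem_ESpaceTwo_iff]
  intro n
  rw [Module.End.mul_apply, Module.End.mul_apply, coeff_zero_nuCoeff_expOp fun F =>
    (ESpaceTwo V).neg_mem (DOp_mem_ESpaceTwo Φ F)]
  exact opSum_higherTerm_mem_ESpaceTwo Φ _ n

/-- For `a = 0` the convention `0⁻¹ = 0` gives the extension by zero off `ℰ''`. -/
theorem coeff_nuCoeff_GamOneInv (F : ESpace V) (n : ℕ) (a : Fin m →₀ ℕ) :
    MvPolynomial.coeff a (nuCoeff n (GamOneInv V F)) =
      ((a.degree : ℂ)⁻¹) • MvPolynomial.coeff a (nuCoeff n F) := by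
  rw [GamOneInv, nuCoeff_liftOp_zero, coeff_mapCoeffs]
  rfl

theorem coeff_nuCoeff_Gam_one (Φ : Smooth V) (hdet : IsUnit (metricTensor Φ).det) (F : ESpace V)
    (n : ℕ) (a : Fin m →₀ ℕ) : MvPolynomial.coeff a (nuCoeff n (Gam Φ 1 F)) =
      (a.degree : ℂ) • MvPolynomial.coeff a (nuCoeff n F) := by
  rw [nuCoeff_Gam, coeff_gammaPoly_one Φ hdet]

theorem degree_cast_ne_zero {a : Fin m →₀ ℕ} (ha : a ≠ 0) : (a.degree : ℂ) ≠ 0 := by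
  rw [Nat.cast_ne_zero, Ne, Finsupp.degree_eq_zero_iff]
  exact ha

theorem Gam_one_inverse (Φ : Smooth V) (hdet : IsUnit (metricTensor Φ).det) {H : ESpace V}
    (hH : H ∈ ESpaceTwo V) : Gam Φ 1 H ∈ ESpaceTwo V ∧ GamOneInv V H ∈ ESpaceTwo V ∧
      Gam Φ 1 (GamOneInv V H) = H ∧ GamOneInv V (Gam Φ 1 H) = H := by
  refine ⟨Gam_mem_ESpaceTwo Φ 0 H, fun n => ?_, ?_, ?_⟩
  · exact (coeff_nuCoeff_GamOneInv H n 0).trans (by rw [mem_ESpaceTwo_iff.1 hH, smul_zero])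
  all_goals
    refine ESpace.ext_nuCoeff fun n => MvPolynomial.ext _ _ fun a => ?_
    simp only [coeff_nuCoeff_Gam_one Φ hdet, coeff_nuCoeff_GamOneInv]
    by_cases ha : a = 0
    · rw [ha, mem_ESpaceTwo_iff.1 hH, smul_zero, smul_zero]
  · rw [smul_inv_smul₀ (degree_cast_ne_zero ha)]
  · rw [inv_smul_smul₀ (degree_cast_ne_zero ha)]

theorem nuCoeff_ofFun (f : PowerSeries (Smooth V)) (n : ℕ) :
    nuCoeff n (ofFun f) = MvPolynomial.C (PowerSeries.coeff n f) :=
  PowerSeries.coeff_map (MvPolynomial.C (σ := Fin m)) n f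

/-- The equation `Γ₁ F + ∑_{r ≥ 2} Γ_r F / r! = D F` and the initial condition `F|_{ζ = 0} = f`
determine `F`. -/
theorem eq_of_symbol_equation (Φ : Smooth V) (hdet : IsUnit (metricTensor Φ).det) {F : ESpace V}
    {f : PowerSeries (Smooth V)} (hF : Gam Φ 1 F + opSum (higherTerm Φ) F = DOp Φ F)
    (h0 : ∀ n, MvPolynomial.coeff 0 (nuCoeff n F) = PowerSeries.coeff n f) :
    F = expOp (DOp Φ) (Ring.inverse (1 - GamOneInv V * QOp Φ) (ofFun f)) := by
  have hD := nuNilpotent_DOp Φ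
  have hinv : ∀ G, expOp (DOp Φ) (expOp (-DOp Φ) G) = G := fun G => by
    rw [← Module.End.mul_apply, expOp_mul_expOp_neg hD, Module.End.one_apply]
  have hinv' : ∀ G, expOp (-DOp Φ) (expOp (DOp Φ) G) = G := fun G => by
    rw [← Module.End.mul_apply, expOp_neg_mul_expOp hD, Module.End.one_apply]
  -- The substitution `F = e^D G` is chosen so that the term `e^D D G` produced by `[Γ_1, e^D]`
  -- cancels `D F`.
  obtain ⟨G, rfl⟩ : ∃ G, F = expOp (DOp Φ) G := ⟨_, (hinv F).symm⟩
  have hcomm : Gam Φ 1 (expOp (DOp Φ) G) =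
      expOp (DOp Φ) (Gam Φ 1 G) + expOp (DOp Φ) (DOp Φ G) := by
    rw [← map_add]
    exact LinearMap.congr_fun (commutator_expOp hD (gammaPoly Φ 1) (gammaPoly_mem Φ 0)
      (Gam_one_mul_DOp Φ hdet)) G
  have hcomm' : DOp Φ (expOp (DOp Φ) G) = expOp (DOp Φ) (DOp Φ G) :=
    LinearMap.congr_fun (mul_expOp_comm hD) G
  rw [hcomm, hcomm', add_right_comm, add_eq_right] at hF
  have hQ : Gam Φ 1 G = QOp Φ G := by
    have h1 := congrArg (expOp (-DOp Φ)) hF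
    rw [map_add, hinv', map_zero] at h1
    exact eq_neg_of_add_eq_zero_left h1
  have hG0 : ∀ n, MvPolynomial.coeff 0 (nuCoeff n G) = PowerSeries.coeff n f := fun n => by
    rw [← h0, coeff_zero_nuCoeff_expOp (DOp_mem_ESpaceTwo Φ)]
  -- Here `Γ_1⁻¹ Q G = Γ_1⁻¹ Γ_1 G` is `G` without its `ζ`-free part, and that part is `f`.
  have hG : (1 - GamOneInv V * QOp Φ) G = ofFun f := by
    rw [LinearMap.sub_apply, Module.End.one_apply, Module.End.mul_apply, ← hQ]
    refine ESpace.ext_nuCoeff fun n => MvPolynomial.ext _ _ fun a => ?_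
    rw [map_sub, MvPolynomial.coeff_sub, coeff_nuCoeff_GamOneInv,
      coeff_nuCoeff_Gam_one Φ hdet, nuCoeff_ofFun]
    by_cases ha : a = 0
    · subst ha
      simp [hG0]
    · rw [inv_smul_smul₀ (degree_cast_ne_zero ha), sub_self, MvPolynomial.coeff_C, if_neg
        (Ne.symm ha)]
  have hunit := ((raises_GamOneInv_mul_QOp Φ).geometric (nuPreserving_GamOneInv_mul_QOp Φ)).1
  rw [← hG, ← Module.End.mul_apply (Ring.inverse _), Ring.inverse_mul_cancel _ hunit,
    Module.End.one_apply]

end SymbolEquation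

/-! ### Uniqueness of total symbols and the equation for the symbol of `L_f`. -/

section TotalSymbol

variable {m : ℕ} {V : TopologicalSpace.Opens (Fin m → ℂ)}

theorem symbolHom_zero (P : MvPolynomial (Fin m ⊕ Fin m) (Smooth V)) : symbolHom 0 P = 0 := by
  rw [← symbolApply_eq, symbolApply]
  simp

theorem holHom_zero (P : MvPolynomial (Fin m) (Smooth V)) : holHom 0 P = 0 := symbolHom_zero _

theorem sum_antidiagonal_C {R A : Type*} [Semiring R] [AddCommMonoid A] (f : ℕ → R → A)
    (hf : ∀ n, f n 0 = 0) (u : R) (n : ℕ) :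
    ∑ p ∈ Finset.HasAntidiagonal.antidiagonal n, f p.1 (PowerSeries.coeff p.2 (PowerSeries.C u)) =
      f n u := by
  rw [Finset.sum_eq_single (n, 0)]
  · rw [PowerSeries.coeff_zero_C]
  · rintro ⟨i, j⟩ hij hne
    rw [Finset.HasAntidiagonal.mem_antidiagonal] at hij
    rw [PowerSeries.coeff_C, if_neg, hf]
    rintro rfl
    exact hne (by simpa using hij)
  · intro h
    exact absurd (by simp) h

/-- The total symbol of a formal differential operator is unique. -/
theorem IsTotalSymbol.unique {L : PowerSeries (Smooth V) → PowerSeries (V → ℂ)}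
    {F G : PowerSeries (MvPolynomial (Fin m ⊕ Fin m) (Smooth V))}
    (hF : IsTotalSymbol L F) (hG : IsTotalSymbol L G) : F = G := by
  ext1 n
  refine sub_eq_zero.1 (eq_zero_of_symbolHom_eq_zero fun u => ?_)
  rw [map_sub, sub_eq_zero]
  refine Smooth.ext fun x => ?_
  have key : ∀ {F : PowerSeries (MvPolynomial (Fin m ⊕ Fin m) (Smooth V))}, IsTotalSymbol L F →
      PowerSeries.coeff n (L (PowerSeries.C u)) x = symbolHom u (PowerSeries.coeff n F) x := by
    intro F hF
    rw [hF]
    exact sum_antidiagonal_C (fun k v => symbolApply (PowerSeries.coeff k F) v x)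
      (fun k => by rw [symbolApply_eq, symbolHom_zero]; rfl) u n |>.trans (by rw [symbolApply_eq])
  rw [← key hF, ← key hG]

theorem sum_antidiagonal_assoc {A : Type*} [AddCommMonoid A] (f : ℕ → ℕ → ℕ → A) (n : ℕ) :
    ∑ p ∈ Finset.HasAntidiagonal.antidiagonal n,
      ∑ q ∈ Finset.HasAntidiagonal.antidiagonal p.2, f p.1 q.1 q.2 =
    ∑ p ∈ Finset.HasAntidiagonal.antidiagonal n,
      ∑ q ∈ Finset.HasAntidiagonal.antidiagonal p.1, f q.1 q.2 p.2 := by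
  rw [Finset.sum_sigma', Finset.sum_sigma']
  refine Finset.sum_nbij' (fun x => ⟨(x.1.1 + x.2.1, x.2.2), (x.1.1, x.2.1)⟩)
    (fun x => ⟨(x.2.1, x.2.2 + x.1.2), (x.2.2, x.1.2)⟩) ?_ ?_ ?_ ?_ ?_
  · rintro ⟨⟨a, b⟩, ⟨c, d⟩⟩ h
    simp only [Finset.mem_sigma, Finset.HasAntidiagonal.mem_antidiagonal] at h ⊢
    exact ⟨by omega, trivial⟩
  · rintro ⟨⟨a, b⟩, ⟨c, d⟩⟩ h
    simp only [Finset.mem_sigma, Finset.HasAntidiagonal.mem_antidiagonal] at h ⊢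
    exact ⟨by omega, trivial⟩
  · rintro ⟨⟨a, b⟩, ⟨c, d⟩⟩ h
    simp only [Finset.mem_sigma, Finset.HasAntidiagonal.mem_antidiagonal] at h ⊢
    obtain ⟨-, rfl⟩ := h
    rfl
  · rintro ⟨⟨a, b⟩, ⟨c, d⟩⟩ h
    simp only [Finset.mem_sigma, Finset.HasAntidiagonal.mem_antidiagonal] at h ⊢
    obtain ⟨-, rfl⟩ := h
    rfl
  · intro x _
    rfl

/-- The coefficient of `ν^n` in the total symbol of `u ↦ f ∗ u`. -/
def leftSymbol (c : ℕ → MultiIndex m × MultiIndex m →₀ Smooth V) (f : PowerSeries (Smooth V))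
    (n : ℕ) : MvPolynomial (Fin m) (Smooth V) :=
  ∑ q ∈ Finset.HasAntidiagonal.antidiagonal n, (c q.1).sum fun ab coef =>
    MvPolynomial.monomial (ab.2.comapDomain Sum.inl Sum.inl_injective.injOn)
      (coef * partialD ab.1 (PowerSeries.coeff q.2 f))

/-- Separation of variables enters here: the second multi-index has no antiholomorphic part, so
`comapDomain Sum.inl` in `leftSymbol` loses nothing. -/
theorem coeff_locStar (c : ℕ → MultiIndex m × MultiIndex m →₀ Smooth V)
    (hc : ∀ r, ∀ ab ∈ (c r).support, ∀ l, ab.2 (Sum.inr l) = 0) (f g : PowerSeries (Smooth V))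
    (n : ℕ) : PowerSeries.coeff n (locStar c f g) =
      ∑ p ∈ Finset.HasAntidiagonal.antidiagonal n,
        holHom (PowerSeries.coeff p.2 g) (leftSymbol c f p.1) := by
  have h1 : ∀ r u v, bidiffOp (c r) u v = holHom v ((c r).sum fun ab coef =>
      MvPolynomial.monomial (ab.2.comapDomain Sum.inl Sum.inl_injective.injOn)
        (coef * partialD ab.1 u)) := by
    intro r u v
    rw [bidiffOp, Finsupp.sum, Finsupp.sum, map_sum]
    refine Finset.sum_congr rfl fun ab hab => ?_
    rw [holHom_monomial, Finsupp.mapDomain_comapDomain _ Sum.inl_injective]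
    rintro (k | l) hi
    · exact ⟨k, rfl⟩
    · exact absurd (hc r ab hab l) (Finsupp.mem_support_iff.1 hi)
  rw [locStar, PowerSeries.coeff_mk]
  simp only [h1, leftSymbol, map_sum]
  exact sum_antidiagonal_assoc (fun i j k => holHom (PowerSeries.coeff k g)
    ((c i).sum fun ab coef =>
      MvPolynomial.monomial (ab.2.comapDomain Sum.inl Sum.inl_injective.injOn)
        (coef * partialD ab.1 (PowerSeries.coeff j f)))) n

theorem coeff_locStar_C {c : ℕ → MultiIndex m × MultiIndex m →₀ Smooth V}
    (hc : ∀ r, ∀ ab ∈ (c r).support, ∀ l, ab.2 (Sum.inr l) = 0) (f : PowerSeries (Smooth V))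
    (u : Smooth V) (n : ℕ) : PowerSeries.coeff n (locStar c f (PowerSeries.C u)) =
      holHom u (leftSymbol c f n) := by
  rw [coeff_locStar c hc]
  exact sum_antidiagonal_C (fun k v => holHom v (leftSymbol c f k)) (fun _ => holHom_zero _) u n

theorem taylorOp_succ_eq (N : ℕ) (h : Smooth V) (P : MvPolynomial (Fin m) (Smooth V)) :
    taylorOp (N + 1) h P =
      ∑ r ∈ Finset.range N, (((r + 1).factorial : ℂ)⁻¹) • jetOp (r + 1) h P + h • P := by
  rw [taylorOp, Finset.sum_range_succ', jetOp_zero]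
  simp

/-- The sum `∑_{1 ≤ r ≤ N} Γ_r / r!`. -/
def gammaSum (Φ : Smooth V) (N : ℕ) (P : MvPolynomial (Fin m) (Smooth V)) :
    MvPolynomial (Fin m) (Smooth V) :=
  ∑ r ∈ Finset.range N, (((r + 1).factorial : ℂ)⁻¹) • gammaPoly Φ (r + 1) P

theorem gammaSum_eq (Φ : Smooth V) (N : ℕ) (P : MvPolynomial (Fin m) (Smooth V)) :
    gammaSum Φ N P = ∑ l, ∑ k, mulZeta ((metricTensor Φ)⁻¹ l k) k
      (∑ r ∈ Finset.range N, (((r + 1).factorial : ℂ)⁻¹) • jetOp (r + 1) (dzbar l Φ) P) := by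
  simp only [gammaSum, gammaPoly_eq_sum_jetOp, map_sum, map_smul, Finset.smul_sum]
  rw [Finset.sum_comm]
  refine Finset.sum_congr rfl fun l _ => ?_
  rw [Finset.sum_comm]

/-- The commutation of left and right multiplications on the level of symbols. -/
theorem gammaSum_leftSymbol {c : ℕ → MultiIndex m × MultiIndex m →₀ Smooth V}
    (hc : ∀ r, ∀ ab ∈ (c r).support, ∀ l, ab.2 (Sum.inr l) = 0)
    (hassoc : ∀ f g h, locStar c (locStar c f g) h = locStar c f (locStar c g h)) {Φ : Smooth V}
    (hΦ : ∀ l u, locStar c u (PowerSeries.C (dzbar l Φ)) = PowerSeries.C (dzbar l Φ) * u +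
      PowerSeries.X * PowerSeries.mk fun n => dzbar l (PowerSeries.coeff n u))
    (f : PowerSeries (Smooth V)) :
    (∀ N, (leftSymbol c f 0).totalDegree ≤ N → gammaSum Φ N (leftSymbol c f 0) = 0) ∧
      ∀ n N, (leftSymbol c f (n + 1)).totalDegree ≤ N →
        gammaSum Φ N (leftSymbol c f (n + 1)) = dPoly Φ (leftSymbol c f n) := by
  -- This is `R_h L_f u = L_f R_h u` for `h = ∂Φ/∂z̄^l`, with `R_h` written out.
  have hmain : ∀ l u, PowerSeries.C (dzbar l Φ) * locStar c f (PowerSeries.C u) +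
      PowerSeries.X * PowerSeries.mk (fun n => dzbar l (PowerSeries.coeff n
        (locStar c f (PowerSeries.C u)))) =
      locStar c f (PowerSeries.C (dzbar l Φ) * PowerSeries.C u + PowerSeries.X * PowerSeries.mk
        fun n => dzbar l (PowerSeries.coeff n (PowerSeries.C u))) := by
    intro l u
    rw [← hΦ, ← hΦ, hassoc]
  have hw0 : ∀ l u, PowerSeries.coeff 0 (PowerSeries.C (dzbar l Φ) * PowerSeries.C u +
      PowerSeries.X * PowerSeries.mk fun n => dzbar l (PowerSeries.coeff n (PowerSeries.C u))) =
        dzbar l Φ * u := by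
    intro l u
    rw [coeff_zero_C_mul_add_X_mul _ _ fun v => dzbar l v, PowerSeries.coeff_zero_C]
  have hw1 : ∀ l u n, PowerSeries.coeff (n + 1) (PowerSeries.C (dzbar l Φ) * PowerSeries.C u +
      PowerSeries.X * PowerSeries.mk fun n => dzbar l (PowerSeries.coeff n (PowerSeries.C u))) =
        PowerSeries.coeff n (PowerSeries.C (dzbar l u)) := by
    intro l u n
    rw [coeff_succ_C_mul_add_X_mul _ _ fun v => dzbar l v, PowerSeries.coeff_C,
      if_neg (Nat.succ_ne_zero n), mul_zero, zero_add, PowerSeries.coeff_C, PowerSeries.coeff_C]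
    split_ifs
    · rfl
    · exact map_zero _
  have htaylor : ∀ l n N u, (leftSymbol c f n).totalDegree ≤ N →
      holHom (dzbar l Φ * u) (leftSymbol c f n) =
        holHom u (∑ r ∈ Finset.range N, (((r + 1).factorial : ℂ)⁻¹) •
          jetOp (r + 1) (dzbar l Φ) (leftSymbol c f n)) +
        dzbar l Φ * holHom u (leftSymbol c f n) := by
    intro l n N u hN
    rw [holHom_mul (dzbar l Φ) _ _ ((MvPolynomial.mem_restrictTotalDegree _ _ _).2 le_rfl) (N + 1)
      (Nat.lt_succ_of_le hN), taylorOp_succ_eq, map_add, map_smul, smul_eq_mul]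
  constructor
  · intro N hN
    rw [gammaSum_eq]
    refine Finset.sum_eq_zero fun l _ => Finset.sum_eq_zero fun k _ => ?_
    refine (congrArg _ (eq_zero_of_holHom_eq_zero fun u => ?_)).trans (map_zero _)
    have h := congrArg (PowerSeries.coeff 0) (hmain l u)
    rw [coeff_zero_C_mul_add_X_mul _ _ fun v => dzbar l v, coeff_locStar_C hc,
      coeff_locStar c hc, Finset.Nat.antidiagonal_zero, Finset.sum_singleton, hw0,
      htaylor l 0 N u hN] at h
    exact right_eq_add.1 h
  · intro n N hN
    rw [gammaSum_eq]
    simp only [dPoly, LinearMap.sum_apply, LinearMap.comp_apply]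
    refine Finset.sum_congr rfl fun l _ => Finset.sum_congr rfl fun k _ => ?_
    congr 1
    refine sub_eq_zero.1 (eq_zero_of_holHom_eq_zero fun u => ?_)
    rw [map_sub, sub_eq_zero]
    have h := congrArg (PowerSeries.coeff (n + 1)) (hmain l u)
    rw [coeff_succ_C_mul_add_X_mul _ _ fun v => dzbar l v, coeff_locStar_C hc,
      coeff_locStar_C hc, coeff_locStar c hc, Finset.Nat.sum_antidiagonal_succ', hw0] at h
    simp only [hw1] at h
    rw [sum_antidiagonal_C (fun k v => holHom v (leftSymbol c f k)) (fun _ => holHom_zero _),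
      htaylor l (n + 1) N u hN, dzbar_holHom] at h
    linear_combination -h

/-- A priori nothing bounds the order of the operators by the power of `ν`. If `P` has degree at
most `d + 1` with `d ≥ n`, the terms `Γ_r P`, `r ≥ 2`, have degree at most `d`, hence so does `Γ_1
P`. As `Γ_1` scales the part of degree `d + 1` by `d + 1 ≠ 0`, that part vanishes, and `d` can
descend to `n`. -/
theorem mem_restrictTotalDegree_of_gammaSum (Φ : Smooth V) (hdet : IsUnit (metricTensor Φ).det)
    {n N : ℕ} {P : MvPolynomial (Fin m) (Smooth V)}
    (h : gammaSum Φ (N + 1) P ∈ MvPolynomial.restrictTotalDegree (Fin m) (Smooth V) n) :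
    P ∈ MvPolynomial.restrictTotalDegree (Fin m) (Smooth V) n := by
  have key : ∀ d, n ≤ d → P ∈ MvPolynomial.restrictTotalDegree (Fin m) (Smooth V) d →
      P ∈ MvPolynomial.restrictTotalDegree (Fin m) (Smooth V) n := by
    intro d hd
    induction d, hd using Nat.le_induction with
    | base => exact id
    | succ d hd ih =>
      intro hP
      refine ih ?_
      have h1 : gammaPoly Φ 1 P ∈ MvPolynomial.restrictTotalDegree (Fin m) (Smooth V) d := by
        have h2 : gammaPoly Φ 1 P = gammaSum Φ (N + 1) P - ∑ r ∈ Finset.range N,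
            (((r + 1 + 1).factorial : ℂ)⁻¹) • gammaPoly Φ (r + 1 + 1) P := by
          rw [gammaSum, Finset.sum_range_succ']
          simp
        rw [h2]
        refine Submodule.sub_mem _ (restrictTotalDegree_mono hd h) (Submodule.sum_mem _ fun r _ => ?_)
        have h3 := restrictTotalDegree_mono (by omega : d + 1 - (r + 1) ≤ d)
          (gammaPoly_mem_sub Φ (r + 1) hP).1
        exact Submodule.smul_of_tower_mem _ _ h3
      rw [mem_restrictTotalDegree_iff_coeff] at h1 ⊢
      intro a ha
      have h4 := h1 a ha
      rw [coeff_gammaPoly_one Φ hdet] at h4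
      refine (smul_eq_zero_iff_right (Nat.cast_ne_zero.2 ?_)).1 h4
      omega
  refine key (max n P.totalDegree) (le_max_left _ _) ?_
  rw [MvPolynomial.mem_restrictTotalDegree]
  exact le_max_right _ _

/-- Solutions of the recursive system for the total symbol of a left multiplication operator
belong to `ℰ` and are given by the formula for the symbol. -/
theorem symbol_formula (Φ : Smooth V) (hdet : IsUnit (metricTensor Φ).det)
    {A : ℕ → MvPolynomial (Fin m) (Smooth V)} {f : PowerSeries (Smooth V)}
    (hA0 : ∀ N, (A 0).totalDegree ≤ N → gammaSum Φ N (A 0) = 0)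
    (hA : ∀ n N, (A (n + 1)).totalDegree ≤ N → gammaSum Φ N (A (n + 1)) = dPoly Φ (A n))
    (hf : ∀ n, (A n).coeff 0 = PowerSeries.coeff n f) (n : ℕ) :
    A n = nuCoeff n (expOp (DOp Φ) (Ring.inverse (1 - GamOneInv V * QOp Φ) (ofFun f))) := by
  have hdeg : ∀ n, A n ∈ MvPolynomial.restrictTotalDegree (Fin m) (Smooth V) n := by
    intro n
    induction n with
    | zero =>
      refine mem_restrictTotalDegree_of_gammaSum Φ hdet (N := (A 0).totalDegree) ?_
      rw [hA0 _ (Nat.le_succ _)]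
      exact Submodule.zero_mem _
    | succ n ih =>
      refine mem_restrictTotalDegree_of_gammaSum Φ hdet (N := (A (n + 1)).totalDegree) ?_
      rw [hA n _ (Nat.le_succ _)]
      exact dPoly_mem Φ n _ ih
  -- The bound `n` would do for the degree, but `n + 1` keeps `Γ_1` in `gammaSum` even when `n = 0`.
  have hle : ∀ n, (A n).totalDegree ≤ n + 1 := fun n =>
    ((MvPolynomial.mem_restrictTotalDegree _ _ _).1 (hdeg n)).trans (Nat.le_succ n)
  let F : ESpace V := ⟨PowerSeries.mk A, by
    rw [mem_ESpace_iff]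
    intro r
    rw [PowerSeries.coeff_mk]
    exact hdeg r⟩
  have hF : ∀ n, nuCoeff n F = A n := fun n => PowerSeries.coeff_mk n A
  have hsum : ∀ n, nuCoeff n (Gam Φ 1 F + opSum (higherTerm Φ) F) = gammaSum Φ (n + 1) (A n) := by
    intro n
    -- `opSum` stops at `r = n` while `gammaSum` runs up to `Γ_{n+1}`; the extra term vanishes at
    -- order `ν^n`.
    have h1 := nuGE_higherTerm Φ (n + 1) F n (Nat.lt_succ_self n)
    have h2 : nuCoeff n (opSum (higherTerm Φ) F) =
        ∑ r ∈ Finset.range n, nuCoeff n (higherTerm Φ (r + 1 + 1) F) := by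
      have h3 : nuCoeff n (opSum (higherTerm Φ) F) =
          ∑ r ∈ Finset.range (n + 1 + 1), nuCoeff n (higherTerm Φ r F) := by
        rw [nuCoeff_opSum, Finset.sum_range_succ _ (n + 1), h1, add_zero]
      rw [h3, Finset.sum_range_succ', Finset.sum_range_succ']
      simp [higherTerm]
    rw [map_add, h2, gammaSum, Finset.sum_range_succ', nuCoeff_Gam, hF, add_comm]
    congr 1
    · refine Finset.sum_congr rfl fun r _ => ?_
      rw [higherTerm, if_pos (by omega), LinearMap.smul_apply, map_smul, nuCoeff_Gam, hF]
    · simp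
  have hFeq : Gam Φ 1 F + opSum (higherTerm Φ) F = DOp Φ F := by
    refine ESpace.ext_nuCoeff fun n => ?_
    rw [hsum]
    rcases n with _ | n
    · rw [hA0 _ (hle 0), nuCoeff_DOp_zero]
    · rw [hA n _ (hle (n + 1)), nuCoeff_DOp_succ, hF]
  rw [← eq_of_symbol_equation Φ hdet hFeq fun n => by rw [hF, hf], hF]

end TotalSymbol

/-! ### The total symbol of left star multiplication. -/

section LeftMul

variable {m : ℕ} {M : Type*} [TopologicalSpace M] [T2Space M] [ChartedSpace (Fin m → ℂ) M]
  [IsManifold 𝓘(ℂ, Fin m → ℂ) ω M] {Ω : PseudoKahlerForm m M}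

/-- The symbol read off from the bidifferential coefficients satisfies the recursive system and the
initial condition, and `symbol_formula` identifies it with the closed expression. -/
theorem isTotalSymbol_leftMul (S : StarProduct Ω) (hsep : S.HasSeparationOfVariables)
    (hstd : S.IsStandard) {φ : HolChart m M} {Φ : Smooth φ.dom} (hΦ : Ω.IsPotential φ Φ)
    (f : PowerSeries (Smooth φ.dom)) :
    IsTotalSymbol (S.leftMul φ f) (toSymbol (expOp (DOp Φ)
      (Ring.inverse (1 - GamOneInv φ.dom * QOp Φ) (ofFun f)))) := by
  choose c hc hsupp using fun r => hsep r φ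
  have hinr : ∀ r, ∀ ab ∈ (c r).support, ∀ l, ab.2 (Sum.inr l) = 0 :=
    fun r ab hab => (hsupp r ab hab).2
  have hdet := isUnit_det_metricTensor Ω φ Φ hΦ
  obtain ⟨hA0, hA⟩ := gammaSum_leftSymbol hinr (locStar_assoc S hc)
    (locStar_dzbar_potential S hc hstd hΦ) f
  have hf : ∀ n, (leftSymbol c f n).coeff 0 = PowerSeries.coeff n f := by
    intro n
    rw [← holHom_one, ← coeff_locStar_C hinr, map_one, locStar_one S hc]
  have hformula := symbol_formula Φ hdet hA0 hA hf
  intro g n x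
  rw [StarProduct.leftMul, localMul_eq S hc, PowerSeries.coeff_map]
  have h1 := congrArg (evalAt x) (coeff_locStar c hinr f g n)
  rw [map_sum] at h1
  refine h1.trans (Finset.sum_congr rfl fun p _ => ?_)
  rw [hformula, symbolApply_eq]
  rfl

end LeftMul

end SepVar

end

open SepVar in
theorem theorem1 {m : ℕ} {M : Type*} [TopologicalSpace M] [T2Space M]
    [ChartedSpace (Fin m → ℂ) M] [IsManifold 𝓘(ℂ, Fin m → ℂ) ω M]
    (Ω : PseudoKahlerForm m M) (S : StarProduct Ω)
    (hsep : S.HasSeparationOfVariables) (hstd : S.IsStandard)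
    (φ : HolChart m M) (Φ : Smooth φ.dom) (hΦ : Ω.IsPotential φ Φ)
    (f : PowerSeries (Smooth φ.dom)) :
    -- the matrix `g_{k l̄}` is invertible over `C^∞(U)`
    IsUnit (metricTensor Φ).det ∧
    -- the series for `e^D`, `e^{-D}` and `∑_{r ≥ 2} Γ_r / r!` converge on `ℰ`
    ConvergesNu (expTerm (DOp Φ)) (expOp (DOp Φ)) ∧
    ConvergesNu (expTerm (-DOp Φ)) (expOp (-DOp Φ)) ∧
    ConvergesFilt (higherTerm Φ) (opSum (higherTerm Φ)) ∧
    -- `Γ₁` is invertible on `ℰ''` with inverse `Γ₁⁻¹`, and `Q` maps `ℰ` to `ℰ''`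
    (∀ H ∈ ESpaceTwo φ.dom, Gam Φ 1 H ∈ ESpaceTwo φ.dom ∧
      GamOneInv φ.dom H ∈ ESpaceTwo φ.dom ∧
      Gam Φ 1 (GamOneInv φ.dom H) = H ∧ GamOneInv φ.dom (Gam Φ 1 H) = H) ∧
    (∀ F : ESpace φ.dom, QOp Φ F ∈ ESpaceTwo φ.dom) ∧
    -- `1 - Γ₁⁻¹ Q` is invertible on `ℰ`, with inverse `∑_r (Γ₁⁻¹ Q)^r`
    IsUnit (1 - GamOneInv φ.dom * QOp Φ) ∧
    ConvergesFilt (fun r => (GamOneInv φ.dom * QOp Φ) ^ r)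
      (Ring.inverse (1 - GamOneInv φ.dom * QOp Φ)) ∧
    -- the total symbol of `L_f` exists and is `e^D (1 - Γ₁⁻¹ Q)⁻¹ f`
    ∀ F : PowerSeries (MvPolynomial (Fin m ⊕ Fin m) (Smooth φ.dom)),
      IsTotalSymbol (S.leftMul φ f) F ↔
        F = toSymbol (expOp (DOp Φ)
          (Ring.inverse (1 - GamOneInv φ.dom * QOp Φ) (ofFun f))) := by
  have hdet := isUnit_det_metricTensor Ω φ Φ hΦ
  have hgeom := (raises_GamOneInv_mul_QOp Φ).geometric (nuPreserving_GamOneInv_mul_QOp Φ)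
  have hsymb := isTotalSymbol_leftMul S hsep hstd hΦ f
  exact ⟨hdet, (nuNilpotent_DOp Φ).convergesNu_expOp, (nuNilpotent_neg_DOp Φ).convergesNu_expOp,
    convergesFilt_higherTerm Φ, fun H hH => Gam_one_inverse Φ hdet hH, QOp_mem_ESpaceTwo Φ,
    hgeom.1, hgeom.2, fun F => ⟨fun hF => hF.unique hsymb, fun hF => hF ▸ hsymb⟩⟩
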